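/- Setting. For a qubit channel (CPTP map) $\mathcal N$ let $\kappa=\|\mathcal N-\mathcal I\|_\diamond$ be its noise strength. For $\Delta>0$, call $\mathcal N$ $\Delta$-contracting if $\|\mathcal N(\rho-\sigma)\|_1\le(1-\Delta\kappa)\|\rho-\sigma\|_1$ for all qubit states $\rho,\sigma$. If $\sigma^*$ is a fixed state of $\mathcal N$, its purity parameter is $\eta=\sqrt{2\,\mathrm{Tr}[(\sigma^*)^2]-1}$. A noisy $d$-dimensional circuit acts on qubits placed at a finite set $\Lambda\subset\mathbb Z^d$. Each layer consists of disjoint one-qubit gates and nearest-neighbour two-qubit gates, and is followed by $\mathcal N$ on every qubit of $\Lambda$, idle or not. The elementary compressor $U_C$ acts on three qubits by a CNOT on qubit 2 controlled by qubit 3, then a swap of qubits 1 and 3 if qubit 2 is $|0\rangle$. Its output is qubit 1. A compound quantum compressor (CQC) with $k$ cycles has $3^k$ input qubits. In each cycle the current qubits are grouped into trios, gates are applied that (without noise) implement $U_C$ on all trios, and the outputs are brought to the input places of the next cycle by SWAPs and single-qubit rotations. A RESET of a target qubit $\tau\in\Lambda$ with $N_a=|\Lambda|-1$ ancillas (all the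 other qubits) is a noisy circuit with the following stages: 1. a settling stage: one layer of independent uniformly random Pauli gates on the ancillas, which makes them maximally mixed, followed by layers of single-qubit gates; 2. a CQC whose inputs are all the ancillas and which leaves the target in its place; 3. the exchange of the output of the CQC with the target, by SWAPs and single-qubit rotations. Its depth $T_{\rm RES}$ is the total number of layers. The output polarization is $z_{\rm out}=\mathrm{Tr}(Z_\tau\rho_{\rm out})$, where $\rho_{\rm out}$ is the final state of the register, averaged over the random gates. Statement. Let $d\ge1$, $\delta>0$, $\Delta>0$, $\mu=\frac{\log 3}{\log(3/2)}+\delta$ and $\alpha=\log_23$. There are constants $c,a,A,B,D,E>0$ and $p\in\mathbb N$, depending only on $d,\delta,\Delta$, such that the following holds. Let $\mathcal N$ be a $\Delta$-contracting qubit channel with strength $\kappa>0$ and a fixed state of purity parameter $\eta>0$, satisfying $$\kappa\le c\,\eta^{\mu/d},\qquad\text{and put}\quad \varepsilon=(\kappa\eta^{-\mu/d})^{d/(\mu+d)}.$$ Then there is a RESET on some finite set $\Lambda\subset\mathbb Z^d$, contained in a cube with at most $E\,N_a^{1/d}$ sites along each edge, whose output polarization is the same number $z_{\rm out}$ for every (possibly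 entangled) initial state of the target and the ancillas, and $$a\,\varepsilon\le 1-z_{\rm out}\le A\,\varepsilon,\qquad N_a\le B\,\frac{\bigl|\log(\kappa\eta^{-\mu/d})\bigr|^{\alpha}}{(\kappa\eta)^{\mu d/(\mu+d)}},\qquad \kappa\,T_{\rm RES}\le D\,\varepsilon\,(1+|\log\varepsilon|)^p .$$ -/

import Mathlib

open scoped ComplexOrder

/-! ## States and single-qubit channels -/

/-- Density matrices. -/
def IsDensity {n : Type*} [Fintype n] (ρ : Matrix n n ℂ) : Prop :=
  ρ.PosSemidef ∧ ρ.trace = 1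

/-- The trace norm `‖A‖₁`: the sum of the singular values of `A`. -/
noncomputable def traceNorm {n : Type*} [Fintype n] [DecidableEq n] (A : Matrix n n ℂ) : ℝ :=
  ∑ i, √((Matrix.isHermitian_conjTranspose_mul_self A).eigenvalues i)

/-- Linear maps on the operators of one qubit. -/
abbrev SuperOp : Type :=
  Matrix (Fin 2) (Fin 2) ℂ →ₗ[ℂ] Matrix (Fin 2) (Fin 2) ℂ

/-- `Φ ⊗ id`, where the second tensor factor is an `n`-level system. -/
def ampliation (Φ : SuperOp) (n : ℕ) (X : Matrix (Fin 2 × Fin n) (Fin 2 × Fin n) ℂ) :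
    Matrix (Fin 2 × Fin n) (Fin 2 × Fin n) ℂ :=
  Matrix.of fun x y => Φ (Matrix.of fun i j => X (i, x.2) (j, y.2)) x.1 y.1

/-- Completely positive trace preserving maps. -/
def IsCPTP (Φ : SuperOp) : Prop :=
  (∀ (n : ℕ) (X : Matrix (Fin 2 × Fin n) (Fin 2 × Fin n) ℂ),
      X.PosSemidef → (ampliation Φ n X).PosSemidef) ∧
    ∀ X, (Φ X).trace = X.trace

/-- The diamond norm: the norm of `Φ ⊗ id` induced by the trace norm, where the reference system
has the dimension of the input space. -/
noncomputable def diamondNorm (Φ : SuperOp) : ℝ :=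
  sSup {r | ∃ X : Matrix (Fin 2 × Fin 2) (Fin 2 × Fin 2) ℂ,
    traceNorm X ≤ 1 ∧ r = traceNorm (ampliation Φ 2 X)}

/-- The noise strength `κ = ‖𝒩 - ℐ‖_⋄`. -/
noncomputable def noiseStrength (N : SuperOp) : ℝ :=
  diamondNorm (N - LinearMap.id)

/-- `𝒩` contracts the trace distance of any two states by a factor `1 - Δ κ`. -/
def IsContracting (Δ : ℝ) (N : SuperOp) : Prop :=
  ∀ ρ σ : Matrix (Fin 2) (Fin 2) ℂ, IsDensity ρ → IsDensity σ →
    traceNorm (N (ρ - σ)) ≤ (1 - Δ * noiseStrength N) * traceNorm (ρ - σ)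

/-- The purity parameter `√(2 Tr σ² - 1)` of a single-qubit state. -/
noncomputable def purityParam (σ : Matrix (Fin 2) (Fin 2) ℂ) : ℝ :=
  √(2 * (σ * σ).trace.re - 1)

/-! ## Registers of qubits

The qubits are labelled by a finite type `Q`; the computational basis is `Q → Fin 2`. -/

section Register

variable {Q : Type} [Fintype Q] [DecidableEq Q]

/-- Operators on the register `Q`. -/
abbrev RegOp (Q : Type) : Type := Matrix (Q → Fin 2) (Q → Fin 2) ℂ

/-- The operator `u` applied to the qubits `w i`, tensored with the identity on all others. -/
def embedOp {ι : Type} [Fintype ι] (w : ι ↪ Q) (u : RegOp ι) : RegOp Q :=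
  Matrix.of fun x y =>
    if ∀ q, (∀ i, w i ≠ q) → x q = y q then u (fun i => x (w i)) (fun i => y (w i)) else 0

/-- The product operator `⨂_q A q`. -/
def tensorOp (A : Q → Matrix (Fin 2) (Fin 2) ℂ) : RegOp Q :=
  Matrix.of fun x y => ∏ q, A q (x q) (y q)

/-- The unitary that moves the state of the qubit `q` to the qubit `π q`, for all `q`. -/
def permOp (π : Equiv.Perm Q) : RegOp Q :=
  Matrix.of fun x y => if ∀ q, x (π q) = y q then 1 else 0

/-- The noise `𝒩^{⊗ Q}`: the map `𝒩` applied to every qubit, idle or not. The basis operator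
`⨂_q |a q⟩⟨b q|` is sent to `⨂_q 𝒩(|a q⟩⟨b q|)`. -/
noncomputable def noiseLayer (N : SuperOp) (ρ : RegOp Q) : RegOp Q :=
  ∑ a : Q → Fin 2, ∑ b : Q → Fin 2,
    ρ a b • tensorOp fun q => N (Matrix.single (a q) (b q) 1)

/-- Pauli matrices `I, X, Y, Z`. -/
def pauli : Fin 4 → Matrix (Fin 2) (Fin 2) ℂ :=
  ![1, !![0, 1; 1, 0], !![0, -Complex.I; Complex.I, 0], !![1, 0; 0, -1]]

/-- The polarization `Tr(Z_q ρ)` of the qubit `q`. -/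
def polarization (q : Q) (ρ : RegOp Q) : ℝ :=
  (tensorOp (fun q' => if q' = q then pauli 3 else 1) * ρ).trace.re

/-- The average state after a layer of independent uniformly random Pauli gates on all qubits
except `τ`. -/
noncomputable def randomize (τ : Q) (ρ : RegOp Q) : RegOp Q :=
  ((4 : ℂ) ^ (Fintype.card Q - 1))⁻¹ • ∑ P : {q : Q // q ≠ τ} → Fin 4,
    tensorOp (fun q => if h : q ≠ τ then pauli (P ⟨q, h⟩) else 1) * ρ *
      (tensorOp (fun q => if h : q ≠ τ then pauli (P ⟨q, h⟩) else 1)).conjTranspose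

/-! ## Local circuits -/

/-- A gate on one qubit, or on two qubits that are neighbours. -/
structure Gate (Adj : Q → Q → Prop) where
  arity : ℕ
  one_le_arity : 1 ≤ arity
  arity_le_two : arity ≤ 2
  wires : Fin arity ↪ Q
  adjacent : ∀ i j, i ≠ j → Adj (wires i) (wires j)
  mat : RegOp (Fin arity)
  mat_unitary : mat ∈ Matrix.unitaryGroup (Fin arity → Fin 2) ℂ

/-- A layer of a circuit: gates on pairwise disjoint sets of qubits. -/
structure Layer (Adj : Q → Q → Prop) where
  gates : List (Gate Adj)
  disjoint : gates.Pairwise fun g h => ∀ i j, g.wires i ≠ h.wires j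

/-- The unitary of a layer (its gates commute). -/
def Layer.unitary {Adj : Q → Q → Prop} (ℓ : Layer Adj) : RegOp Q :=
  (ℓ.gates.map fun g => embedOp g.wires g.mat).prod

/-- The unitary of a sequence of layers without noise; the head of the list acts first. -/
def idealUnitary {Adj : Q → Q → Prop} (L : List (Layer Adj)) : RegOp Q :=
  L.foldl (fun V ℓ => ℓ.unitary * V) 1

/-- The noisy evolution: every layer of gates is followed by noise on all qubits. -/
noncomputable def noisyRun {Adj : Q → Q → Prop} (N : SuperOp) (L : List (Layer Adj))
    (ρ : RegOp Q) : RegOp Q :=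
  L.foldl (fun ρ ℓ => noiseLayer N (ℓ.unitary * ρ * ℓ.unitary.conjTranspose)) ρ

/-! ## The compound quantum compressor -/

/-- The elementary compressor on basis states: CNOT on the second bit controlled by the third, then
a swap of the first and the third bit if the second is `0`. The first bit of the result is the
majority of the three inputs. -/
def compressorMap (y : Fin 3 → Fin 2) : Fin 3 → Fin 2 :=
  if y 1 + y 2 = 0 then ![y 2, y 1 + y 2, y 0] else ![y 0, y 1 + y 2, y 2]

/-- The elementary three-qubit compressor, applied to `n` trios in parallel. -/
def compressorOp (n : ℕ) : RegOp (Fin n × Fin 3) :=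
  Matrix.of fun x y =>
    if ∀ j, (fun i => x (j, i)) = compressorMap (fun i => y (j, i)) then 1 else 0

/-- `IsTransport L π`: without noise, every layer of `L` consists of SWAPs and single-qubit
rotations, and together these SWAPs take the qubit at `q` to `π q`. -/
inductive IsTransport {Adj : Q → Q → Prop} : List (Layer Adj) → Equiv.Perm Q → Prop
  | nil : IsTransport [] 1
  | cons (ℓ : Layer Adj) (L : List (Layer Adj)) (s π : Equiv.Perm Q)
      (rot : Q → Matrix.unitaryGroup (Fin 2) ℂ)
      (hℓ : ℓ.unitary = permOp s * tensorOp fun q => (rot q : Matrix (Fin 2) (Fin 2) ℂ))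
      (hL : IsTransport L π) : IsTransport (ℓ :: L) (π * s)

/-- `IsCQC τ k L S o`: the layers `L` form a compound quantum compressor with `k` cycles, whose input
qubits are `S` and whose output is found at the qubit `o`. In each cycle the current qubits are
arranged in trios `t (j, ·)`, all of these are compressed, and the outputs `t (j, 0)` are
transported to the places where the next cycle expects them. The target `τ` stays in its place. -/
inductive IsCQC {Adj : Q → Q → Prop} (τ : Q) : ℕ → List (Layer Adj) → Finset Q → Q → Prop
  | done (o : Q) : IsCQC τ 0 [] {o} o
  | cycle (n k : ℕ) (t : Fin n × Fin 3 ↪ Q) (compress move rest : List (Layer Adj))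
      (π : Equiv.Perm Q) (o : Q)
      (hcompress : idealUnitary compress = embedOp t (compressorOp n))
      (hmove : IsTransport move π)
      (hfix : π τ = τ)
      (hrest : IsCQC τ k rest (Finset.univ.image fun j => π (t (j, 0))) o) :
      IsCQC τ (k + 1) (compress ++ move ++ rest) (Finset.univ.image t) o

/-- A RESET of the qubit `τ`; all the other qubits of the register are the ancillas. After a first
layer of random gates that makes the ancillas maximally mixed, it consists of a settling stage of
single-qubit gates, a compound quantum compressor whose inputs are all the ancillas, and the
exchange of its output with the target. -/
structure ResetCircuit (Adj : Q → Q → Prop) (τ : Q) where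
  settling : List (Layer Adj)
  settling_arity : ∀ ℓ ∈ settling, ∀ g ∈ ℓ.gates, g.arity = 1
  cycles : ℕ
  compression : List (Layer Adj)
  output : Q
  isCQC : IsCQC τ cycles compression (Finset.univ.erase τ) output
  exchange : List (Layer Adj)
  isExchange : IsTransport exchange (Equiv.swap output τ)

/-- The depth, with the layer of random gates. -/
def ResetCircuit.depth {Adj : Q → Q → Prop} {τ : Q} (C : ResetCircuit Adj τ) : ℕ :=
  1 + C.settling.length + C.compression.length + C.exchange.length

/-- The noisy evolution of the whole register. -/
noncomputable def ResetCircuit.run {Adj : Q → Q → Prop} {τ : Q} (C : ResetCircuit Adj τ)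
    (N : SuperOp) (ρ : RegOp Q) : RegOp Q :=
  noisyRun N (C.settling ++ C.compression ++ C.exchange) (noiseLayer N (randomize τ ρ))

end Register

/-- Nearest neighbours among the sites `Λ` of the lattice `ℤ^d`. -/
def latticeAdj {d : ℕ} (Λ : Finset (Fin d → ℤ)) (v w : Λ) : Prop :=
  ∑ i, |v.1 i - w.1 i| = 1

/-- `Λ` lies in a cube with at most `L` sites along each edge. -/
def FitsInCube {d : ℕ} (Λ : Finset (Fin d → ℤ)) (L : ℝ) : Prop :=
  ∃ (v₀ : Fin d → ℤ) (l : ℕ), (l : ℝ) ≤ L ∧ ∀ v ∈ Λ, ∀ i, v₀ i ≤ v i ∧ v i < v₀ i + l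

/-!
The register is a cube with `3 ^ m` sites along each edge, whose `3 ^ (d m)` qubits are the
ancillas, and one more site next to the origin, which holds the target.

Noise acts in the same way on every qubit, and the circuit treats all the qubits that still matter
in the same way. Hence these are independent and in one and the same state `σ` after every cycle
(`ProductOn`). The other qubits, and whatever they are correlated with, can be ignored: the values
of observables on the remaining qubits never depend on them. Random Pauli gates produce such a
situation from any initial state (`productOn_randomize`), so the output does not depend on the
initial state.

An elementary compressor is a product of gates on neighbours of a line of three qubits
(`exists_compressor_gates`). It takes three independent qubits of polarization `u` to a qubit of
polarization `boost u = (3 u - u ^ 3) / 2`. With noise of strength `κ` and `T` further time steps,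
and a rotation that turns the Bloch vector back to the `Z` axis, the new polarization differs from
this by at most a multiple of `κ (T + 1) (u + η)` (`exists_cycle`). The factor `u + η` matters: the
noise hardly changes the maximally mixed state if its fixed state is hardly polarized. The cycles
work along the axes of the cube in any order. Before a cycle, its qubits are brought together in
trios by swaps along one axis (`exists_gather`), which takes at most `3 ^ m` layers
(`exists_isCQC`).

With `w = ε η` we have `κ = ε w ^ (μ / d)`. Settling for about `w ^ (-μ / d)` steps costs `ε` in
units of `1 / κ` and gives a polarization of order `w` (`IsNoise.exists_settle_ge`). Small
polarizations then grow by a factor `lam < 3 / 2` per cycle, so `log (1 / w) / log lam`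
cycles lead to a constant polarization; after boundedly many more cycles the distance to `1` is
squared in every cycle, and about `log₂ log (1 / ε)` cycles bring it down to the error of a single
cycle (`abs_one_sub_le_of_boost`). These numbers of cycles give the bound on the number of ancillas.
As `μ > log 3 / log (3 / 2)`, the whole compression takes a time that is small compared to
`w ^ (-μ / d)`, so its errors are a small fraction of `ε` (`exists_edge`). A final rotation
deliberately misses the `Z` axis, which lowers the polarization by `ε`; this dominates all other
errors, whence both the lower and the upper bound on `1 - z` (`exists_reset`).
-/

set_option linter.unusedSectionVars false

/-! ### Operators on registers -/

section RegisterAlgebra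

variable {Q : Type} [Fintype Q] [DecidableEq Q]

theorem tensorOp_apply (A : Q → Matrix (Fin 2) (Fin 2) ℂ) (x y : Q → Fin 2) :
    tensorOp A x y = ∏ q, A q (x q) (y q) := rfl

theorem tensorOp_mul (A B : Q → Matrix (Fin 2) (Fin 2) ℂ) :
    tensorOp A * tensorOp B = tensorOp fun q => A q * B q := by
  ext x y
  simp only [Matrix.mul_apply, tensorOp_apply, ← Finset.prod_mul_distrib, Finset.prod_univ_sum,
    Fintype.piFinset_univ]

theorem tensorOp_one : tensorOp (fun _ : Q => (1 : Matrix (Fin 2) (Fin 2) ℂ)) = 1 := by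
  ext x y
  by_cases h : x = y
  · subst h
    rw [tensorOp_apply, Matrix.one_apply_eq]
    exact Finset.prod_eq_one fun q _ => Matrix.one_apply_eq _
  · obtain ⟨q, hq⟩ := Function.ne_iff.mp h
    rw [Matrix.one_apply_ne h, tensorOp_apply]
    exact Finset.prod_eq_zero (Finset.mem_univ q) (by simp [hq])

theorem conjTranspose_tensorOp (A : Q → Matrix (Fin 2) (Fin 2) ℂ) :
    (tensorOp A).conjTranspose = tensorOp fun q => (A q).conjTranspose := by
  ext x y
  simp [tensorOp_apply, Matrix.conjTranspose_apply]

theorem trace_tensorOp (A : Q → Matrix (Fin 2) (Fin 2) ℂ) :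
    (tensorOp A).trace = ∏ q, (A q).trace := by
  simp only [Matrix.trace, Matrix.diag_apply, tensorOp_apply, Finset.prod_univ_sum,
    Fintype.piFinset_univ]

theorem single_eq_tensorOp (a b : Q → Fin 2) :
    (Matrix.single a b 1 : RegOp Q) = tensorOp fun q => Matrix.single (a q) (b q) 1 := by
  ext x y
  rw [tensorOp_apply]
  by_cases h : a = x ∧ b = y
  · obtain ⟨rfl, rfl⟩ := h
    simp
  · rw [Matrix.single_apply_of_ne _ _ _ _ _ h]
    have : ∃ q, ¬ (a q = x q ∧ b q = y q) := by
      by_contra! hc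
      exact h ⟨funext fun q => (hc q).1, funext fun q => (hc q).2⟩
    obtain ⟨q, hq⟩ := this
    exact (Finset.prod_eq_zero (Finset.mem_univ q)
      (Matrix.single_apply_of_ne (a q) (b q) (1 : ℂ) (x q) (y q) hq)).symm

/-- Product operators span the operators of a register. -/
theorem linearMap_ext_tensorOp {M : Type*} [AddCommMonoid M] [Module ℂ M] {f g : RegOp Q →ₗ[ℂ] M}
    (h : ∀ A, f (tensorOp A) = g (tensorOp A)) : f = g := by
  refine Matrix.ext_linearMap ℂ fun a b => LinearMap.ext_ring ?_
  simpa [single_eq_tensorOp] using h fun q => Matrix.single (a q) (b q) 1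

/-- Two operators with the same expectation values of all product observables agree. -/
theorem eq_of_trace_tensorOp_mul {X Y : RegOp Q}
    (h : ∀ A, (tensorOp A * X).trace = (tensorOp A * Y).trace) : X = Y := by
  refine Matrix.ext_iff_trace_mul_left.mpr fun B => ?_
  have : (Matrix.traceLinearMap (Q → Fin 2) ℂ ℂ) ∘ₗ (LinearMap.mulRight ℂ X) =
      (Matrix.traceLinearMap (Q → Fin 2) ℂ ℂ) ∘ₗ (LinearMap.mulRight ℂ Y) :=
    linearMap_ext_tensorOp fun A => by simpa using h A
  simpa using LinearMap.congr_fun this B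

/-! ### Embedded operators -/

variable {ι : Type} [Fintype ι] [DecidableEq ι]

theorem embedOp_apply (w : ι ↪ Q) (u : RegOp ι) (x y : Q → Fin 2) :
    embedOp w u x y =
      if ∀ q, (∀ i, w i ≠ q) → x q = y q then u (fun i => x (w i)) (fun i => y (w i)) else 0 := by
  simp only [embedOp, Matrix.of_apply]

/-- `embedOp` as a linear map. -/
def embedLin (w : ι ↪ Q) : RegOp ι →ₗ[ℂ] RegOp Q where
  toFun := embedOp w
  map_add' u v := by
    ext x y
    simp only [embedOp_apply, Matrix.add_apply]
    split_ifs <;> simp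
  map_smul' c u := by
    ext x y
    simp only [embedOp_apply, Matrix.smul_apply, RingHom.id_apply]
    split_ifs <;> simp

theorem embedLin_apply (w : ι ↪ Q) (u : RegOp ι) : embedLin w u = embedOp w u := rfl

theorem embedOp_tensorOp (w : ι ↪ Q) (A : ι → Matrix (Fin 2) (Fin 2) ℂ) :
    embedOp w (tensorOp A) = tensorOp (Function.extend w A fun _ => 1) := by
  ext x y
  rw [embedOp_apply, tensorOp_apply]
  have hsplit : ∏ q, (Function.extend w A (fun _ => 1)) q (x q) (y q) =
      (∏ i, A i (x (w i)) (y (w i))) *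
        ∏ q ∈ Finset.univ.filter (fun q => q ∉ Finset.univ.map w),
          (1 : Matrix (Fin 2) (Fin 2) ℂ) (x q) (y q) := by
    rw [← Finset.prod_filter_mul_prod_filter_not Finset.univ (fun q => q ∈ Finset.univ.map w)]
    congr 1
    · rw [Finset.filter_mem_eq_inter, Finset.univ_inter, Finset.prod_map]
      exact Finset.prod_congr rfl fun i _ => by rw [w.injective.extend_apply]
    · refine Finset.prod_congr rfl fun q hq => ?_
      rw [Function.extend_apply']
      simpa using hq
  rw [tensorOp_apply, hsplit]
  split_ifs with h
  · refine (mul_one _).symm.trans (congrArg _ (Finset.prod_eq_one ?_).symm)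
    intro q hq
    rw [h q (by simpa using hq), Matrix.one_apply_eq]
  · push Not at h
    obtain ⟨q, hq, hne⟩ := h
    rw [Finset.prod_eq_zero (i := q), mul_zero]
    · simpa using hq
    · exact Matrix.one_apply_ne hne

theorem embedOp_mul (w : ι ↪ Q) (u v : RegOp ι) :
    embedOp w (u * v) = embedOp w u * embedOp w v := by
  have : (LinearMap.mul ℂ (RegOp ι)).compr₂ (embedLin w) =
      (LinearMap.mul ℂ (RegOp Q)).compl₁₂ (embedLin w) (embedLin w) := by
    refine linearMap_ext_tensorOp fun A => linearMap_ext_tensorOp fun B => ?_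
    simp only [LinearMap.compr₂_apply, LinearMap.mul_apply', LinearMap.compl₁₂_apply,
      embedLin_apply, embedOp_tensorOp, tensorOp_mul]
    congr 1
    funext q
    by_cases hq : ∃ i, w i = q
    · obtain ⟨i, rfl⟩ := hq
      simp [w.injective.extend_apply]
    · simp [Function.extend_apply' _ _ _ hq]
  simpa [embedLin_apply] using LinearMap.congr_fun (LinearMap.congr_fun this u) v

theorem embedOp_one (w : ι ↪ Q) : embedOp w (1 : RegOp ι) = 1 := by
  rw [← tensorOp_one, embedOp_tensorOp, ← tensorOp_one]
  congr 1
  funext q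
  by_cases hq : ∃ i, w i = q
  · obtain ⟨i, rfl⟩ := hq
    simp [w.injective.extend_apply]
  · simp [Function.extend_apply' _ _ _ hq]

theorem embedOp_conjTranspose (w : ι ↪ Q) (u : RegOp ι) :
    embedOp w u.conjTranspose = (embedOp w u).conjTranspose := by
  ext x y
  simp only [embedOp_apply, Matrix.conjTranspose_apply]
  simp only [eq_comm (a := y _)]
  split_ifs <;> simp

theorem embedOp_trans {κ : Type} [Fintype κ] [DecidableEq κ] (v : κ ↪ ι) (w : ι ↪ Q)
    (u : RegOp κ) : embedOp w (embedOp v u) = embedOp (v.trans w) u := by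
  have : embedLin w ∘ₗ embedLin v = embedLin (v.trans w) := by
    refine linearMap_ext_tensorOp fun A => ?_
    simp only [LinearMap.comp_apply, embedLin_apply, embedOp_tensorOp]
    congr 1
    funext q
    by_cases hq : ∃ i, w i = q
    · obtain ⟨i, rfl⟩ := hq
      rw [w.injective.extend_apply]
      by_cases hi : ∃ k, v k = i
      · obtain ⟨k, rfl⟩ := hi
        rw [v.injective.extend_apply]
        exact ((v.trans w).injective.extend_apply A _ k).symm
      · rw [Function.extend_apply' _ _ _ hi, Function.extend_apply']
        rintro ⟨k, hk⟩
        exact hi ⟨k, w.injective hk⟩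
    · rw [Function.extend_apply' _ _ _ hq, Function.extend_apply']
      rintro ⟨k, hk⟩
      exact hq ⟨v k, hk⟩
  exact LinearMap.congr_fun this u

/-! ### Permutations of qubits -/

theorem permOp_apply (π : Equiv.Perm Q) (x y : Q → Fin 2) :
    permOp π x y = if x ∘ π = y then 1 else 0 := by
  simp only [permOp, Matrix.of_apply, funext_iff, Function.comp_apply]

theorem permOp_one : permOp (1 : Equiv.Perm Q) = 1 := by
  ext x y
  simp [permOp_apply, Matrix.one_apply]

theorem permOp_mul (s π : Equiv.Perm Q) : permOp (s * π) = permOp s * permOp π := by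
  ext x y
  simp only [Matrix.mul_apply, permOp_apply, ite_mul, one_mul, zero_mul, Finset.sum_ite_eq,
    Finset.mem_univ, if_true]
  rfl

theorem permOp_conjTranspose (π : Equiv.Perm Q) : (permOp π).conjTranspose = permOp π⁻¹ := by
  ext x y
  rw [Matrix.conjTranspose_apply, permOp_apply, permOp_apply]
  have : y ∘ π = x ↔ x ∘ ⇑π⁻¹ = y := by
    constructor
    · rintro rfl
      funext q
      simp
    · rintro rfl
      funext q
      simp
  simp only [this]
  split_ifs <;> simp

theorem permOp_conj_tensorOp (π : Equiv.Perm Q) (A : Q → Matrix (Fin 2) (Fin 2) ℂ) :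
    (permOp π).conjTranspose * tensorOp A * permOp π = tensorOp fun q => A (π q) := by
  have : tensorOp A * permOp π = permOp π * tensorOp fun q => A (π q) := by
    ext x y
    have h : ∀ z : Q → Fin 2, z ∘ π = y ↔ z = y ∘ ⇑π⁻¹ := by
      intro z
      constructor
      · rintro rfl
        funext q
        simp
      · rintro rfl
        funext q
        simp
    simp only [Matrix.mul_apply, permOp_apply, ite_mul, one_mul, zero_mul, mul_ite, mul_one,
      mul_zero, Finset.sum_ite_eq, Finset.mem_univ, if_true, h, Finset.sum_ite_eq']
    rw [tensorOp_apply, tensorOp_apply]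
    exact (Fintype.prod_equiv π _ _ fun q => by simp).symm
  rw [Matrix.mul_assoc, this, ← Matrix.mul_assoc, permOp_conjTranspose, ← permOp_mul]
  simp [permOp_one]

theorem embedOp_swap {q r : Q} (w : Fin 2 ↪ Q) (h0 : w 0 = q) (h1 : w 1 = r) :
    embedOp w (permOp (Equiv.swap 0 1)) = permOp (Equiv.swap q r) := by
  ext x y
  rw [embedOp_apply, permOp_apply, permOp_apply]
  have hqr : q ≠ r := by
    rw [← h0, ← h1]
    exact w.injective.ne (by decide)
  have key : (∀ s, (∀ i, w i ≠ s) → x s = y s) ∧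
      (fun i => x (w i)) ∘ (Equiv.swap (0 : Fin 2) 1) = (fun i => y (w i)) ↔
      x ∘ Equiv.swap q r = y := by
    simp only [funext_iff, Fin.forall_fin_two, Function.comp_apply, Equiv.swap_apply_left,
      Equiv.swap_apply_right, h0, h1]
    constructor
    · rintro ⟨h, hr, hq⟩ s
      rcases eq_or_ne s q with rfl | hsq
      · rw [Equiv.swap_apply_left, hr]
      rcases eq_or_ne s r with rfl | hsr
      · rw [Equiv.swap_apply_right, hq]
      rw [Equiv.swap_apply_of_ne_of_ne hsq hsr]
      exact h s ⟨hsq.symm, hsr.symm⟩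
    · intro h
      refine ⟨fun s hs => ?_, ?_, ?_⟩
      · rw [← h s, Equiv.swap_apply_of_ne_of_ne hs.1.symm hs.2.symm]
      · rw [← h q, Equiv.swap_apply_left]
      · rw [← h r, Equiv.swap_apply_right]
  rw [← ite_and]
  simp only [key]

/-! ### Block products -/

variable {κ : Type} [Fintype κ] [DecidableEq κ]

/-- The product operator `⨂_j V j` on the register `ι × κ`, which consists of the blocks
`{j} × κ`. -/
def blockTensor (V : ι → RegOp κ) : RegOp (ι × κ) :=
  Matrix.of fun x y => ∏ j, V j (fun i => x (j, i)) (fun i => y (j, i))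

theorem blockTensor_apply (V : ι → RegOp κ) (x y : ι × κ → Fin 2) :
    blockTensor V x y = ∏ j, V j (fun i => x (j, i)) (fun i => y (j, i)) := rfl

/-- A sum over the basis states of all blocks is a product of sums over basis states of blocks. -/
theorem sum_prod_blocks (F : ι → (κ → Fin 2) → ℂ) :
    ∑ x : ι × κ → Fin 2, ∏ j, F j (fun i => x (j, i)) = ∏ j, ∑ s, F j s := by
  rw [Finset.prod_univ_sum, Fintype.piFinset_univ]
  exact Fintype.sum_equiv (Equiv.curry ι κ (Fin 2)) _ _ fun x => rfl

theorem blockTensor_mul (V W : ι → RegOp κ) :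
    blockTensor V * blockTensor W = blockTensor fun j => V j * W j := by
  ext x y
  simp only [Matrix.mul_apply, blockTensor_apply, ← Finset.prod_mul_distrib]
  exact sum_prod_blocks fun j s => V j (fun i => x (j, i)) s * W j s fun i => y (j, i)

theorem trace_blockTensor (V : ι → RegOp κ) : (blockTensor V).trace = ∏ j, (V j).trace := by
  simp only [Matrix.trace, Matrix.diag_apply, blockTensor_apply]
  exact sum_prod_blocks fun j s => V j s s

theorem blockTensor_conjTranspose (V : ι → RegOp κ) :
    (blockTensor V).conjTranspose = blockTensor fun j => (V j).conjTranspose := by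
  ext x y
  simp [blockTensor_apply, Matrix.conjTranspose_apply]

theorem tensorOp_eq_blockTensor (A : ι × κ → Matrix (Fin 2) (Fin 2) ℂ) :
    tensorOp A = blockTensor fun j => tensorOp fun i => A (j, i) := by
  ext x y
  simp only [tensorOp_apply, blockTensor_apply, Fintype.prod_prod_type]

theorem blockTensor_one : blockTensor (fun _ : ι => (1 : RegOp κ)) = 1 := by
  have := tensorOp_eq_blockTensor (fun _ : ι × κ => (1 : Matrix (Fin 2) (Fin 2) ℂ))
  simpa [tensorOp_one] using this.symm

/-- The block `{j} × κ`. -/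
def blockWire (κ : Type) (j : ι) : κ ↪ ι × κ :=
  ⟨fun i => (j, i), fun _ _ h => (Prod.ext_iff.mp h).2⟩

theorem blockWire_apply (j : ι) (i : κ) : blockWire κ j i = (j, i) := rfl

theorem embedOp_blockWire (j : ι) (u : RegOp κ) :
    embedOp (blockWire κ j) u = blockTensor (Function.update (fun _ => 1) j u) := by
  ext x y
  rw [embedOp_apply, blockTensor_apply, ← Finset.mul_prod_erase _ _ (Finset.mem_univ j)]
  simp only [Function.update_self]
  have h1 : ∀ j' ∈ Finset.univ.erase j,
      (Function.update (fun _ => 1) j u : ι → RegOp κ) j' (fun i => x (j', i)) (fun i => y (j', i))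
        = (1 : RegOp κ) (fun i => x (j', i)) (fun i => y (j', i)) := by
    intro j' hj'
    rw [Function.update_of_ne (Finset.ne_of_mem_erase hj')]
  rw [Finset.prod_congr rfl h1]
  split_ifs with h
  · rw [Finset.prod_eq_one, mul_one]
    · rfl
    intro j' hj'
    have : (fun i => x (j', i)) = fun i => y (j', i) := by
      funext i
      refine h _ fun i' hi' => Finset.ne_of_mem_erase hj' ?_
      rw [blockWire_apply] at hi'
      exact (Prod.ext_iff.mp hi').1.symm
    rw [this, Matrix.one_apply_eq]
  · push Not at h
    obtain ⟨⟨j', i⟩, hq, hne⟩ := h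
    rw [Finset.prod_eq_zero (i := j'), mul_zero]
    · rw [Finset.mem_erase]
      refine ⟨?_, Finset.mem_univ _⟩
      rintro rfl
      exact hq i rfl
    · exact Matrix.one_apply_ne fun hc => hne (congrFun hc i)

theorem prod_embedOp_blockWire (u : ι → RegOp κ) (l : List ι) (hl : l.Nodup) :
    (l.map fun j => embedOp (blockWire κ j) (u j)).prod =
      blockTensor fun j => if j ∈ l then u j else 1 := by
  induction l with
  | nil => simp [blockTensor_one]
  | cons a l ih =>
    rw [List.map_cons, List.prod_cons, ih (List.nodup_cons.mp hl).2, embedOp_blockWire,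
      blockTensor_mul]
    congr 1
    funext j
    rcases eq_or_ne j a with rfl | hj
    · simp [(List.nodup_cons.mp hl).1]
    · simp [hj]

theorem compressorOp_eq_blockTensor (n : ℕ) :
    compressorOp n = blockTensor fun _ : Fin n =>
      (Matrix.of fun x y => if x = compressorMap y then 1 else 0 : RegOp (Fin 3)) := by
  ext x y
  simp only [compressorOp, Matrix.of_apply, blockTensor_apply]
  by_cases h : ∀ j, (fun i => x (j, i)) = compressorMap (fun i => y (j, i))
  · rw [if_pos h, Finset.prod_eq_one]
    intro j _
    rw [if_pos (h j)]
  · rw [if_neg h]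
    push Not at h
    obtain ⟨j, hj⟩ := h
    exact (Finset.prod_eq_zero (Finset.mem_univ j) (if_neg hj)).symm

end RegisterAlgebra

/-! ### Noise on a register -/

section Noise

variable {Q : Type} [Fintype Q] [DecidableEq Q]

/-- `noiseLayer N` as a linear map. -/
noncomputable def noiseLin (N : SuperOp) : RegOp Q →ₗ[ℂ] RegOp Q where
  toFun := noiseLayer N
  map_add' ρ σ := by
    simp only [noiseLayer, Matrix.add_apply, add_smul, Finset.sum_add_distrib]
  map_smul' c ρ := by
    simp only [noiseLayer, Matrix.smul_apply, smul_eq_mul, mul_smul, Finset.smul_sum,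
      RingHom.id_apply]

theorem noiseLin_apply (N : SuperOp) (ρ : RegOp Q) : noiseLin N ρ = noiseLayer N ρ := rfl

theorem superOp_apply_eq_sum (N : SuperOp) (X : Matrix (Fin 2) (Fin 2) ℂ) :
    N X = ∑ i, ∑ j, X i j • N (Matrix.single i j 1) := by
  conv_lhs => rw [Matrix.matrix_eq_sum_single X]
  simp only [map_sum]
  refine Finset.sum_congr rfl fun i _ => Finset.sum_congr rfl fun j _ => ?_
  rw [← map_smul, Matrix.smul_single, smul_eq_mul, mul_one]

theorem noiseLayer_tensorOp (N : SuperOp) (A : Q → Matrix (Fin 2) (Fin 2) ℂ) :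
    noiseLayer N (tensorOp A) = tensorOp fun q => N (A q) := by
  ext x y
  simp only [noiseLayer, Matrix.sum_apply, Matrix.smul_apply, tensorOp_apply, smul_eq_mul,
    ← Finset.prod_mul_distrib]
  have h1 : ∀ a : Q → Fin 2, ∑ b : Q → Fin 2, ∏ q, (A q (a q) (b q) *
      N (Matrix.single (a q) (b q) 1) (x q) (y q)) =
      ∏ q, ∑ j, A q (a q) j * N (Matrix.single (a q) j 1) (x q) (y q) := by
    intro a
    rw [Finset.prod_univ_sum, Fintype.piFinset_univ]
  simp only [h1]
  have h2 : ∑ a : Q → Fin 2, ∏ q, ∑ j, A q (a q) j * N (Matrix.single (a q) j 1) (x q) (y q) =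
      ∏ q, ∑ i, ∑ j, A q i j * N (Matrix.single i j 1) (x q) (y q) := by
    rw [Finset.prod_univ_sum, Fintype.piFinset_univ]
  rw [h2]
  refine Finset.prod_congr rfl fun q _ => ?_
  rw [superOp_apply_eq_sum N (A q)]
  simp only [Matrix.sum_apply, Matrix.smul_apply, smul_eq_mul]

/-- The adjoint of a map of one-qubit operators for the pairing `(A, X) ↦ Tr (A X)`. -/
def SuperOp.dual (N : SuperOp) (A : Matrix (Fin 2) (Fin 2) ℂ) : Matrix (Fin 2) (Fin 2) ℂ :=
  Matrix.of fun i j => (A * N (Matrix.single j i 1)).trace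

theorem SuperOp.trace_dual_mul (N : SuperOp) (A X : Matrix (Fin 2) (Fin 2) ℂ) :
    (N.dual A * X).trace = (A * N X).trace := by
  rw [superOp_apply_eq_sum N X, Matrix.trace]
  simp only [Matrix.diag_apply, Matrix.mul_apply, SuperOp.dual, Matrix.of_apply, Finset.mul_sum,
    Matrix.trace_sum, Matrix.mul_smul, Matrix.trace_smul, smul_eq_mul]
  rw [Finset.sum_comm]
  exact Finset.sum_congr rfl fun i _ => Finset.sum_congr rfl fun j _ => mul_comm _ _

theorem SuperOp.dual_one {N : SuperOp} (hN : ∀ X, (N X).trace = X.trace) : N.dual 1 = 1 := by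
  refine Matrix.ext_iff_trace_mul_right.mpr fun X => ?_
  rw [SuperOp.trace_dual_mul, one_mul, one_mul, hN]

theorem trace_tensorOp_mul_noiseLayer (N : SuperOp) (A : Q → Matrix (Fin 2) (Fin 2) ℂ)
    (ρ : RegOp Q) :
    (tensorOp A * noiseLayer N ρ).trace = (tensorOp (fun q => N.dual (A q)) * ρ).trace := by
  have : Matrix.traceLinearMap (Q → Fin 2) ℂ ℂ ∘ₗ LinearMap.mulLeft ℂ (tensorOp A) ∘ₗ noiseLin N =
      Matrix.traceLinearMap (Q → Fin 2) ℂ ℂ ∘ₗ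
        LinearMap.mulLeft ℂ (tensorOp fun q => N.dual (A q)) := by
    refine linearMap_ext_tensorOp fun B => ?_
    simp only [LinearMap.comp_apply, LinearMap.mulLeft_apply, Matrix.traceLinearMap_apply,
      noiseLin_apply, noiseLayer_tensorOp, tensorOp_mul, trace_tensorOp, SuperOp.trace_dual_mul]
  exact LinearMap.congr_fun this ρ

variable {ι : Type} [Fintype ι] [DecidableEq ι]
variable {κ : Type} [Fintype κ] [DecidableEq κ]

theorem noiseLayer_blockTensor (N : SuperOp) (β : ι → RegOp κ) :
    noiseLayer N (blockTensor β) = blockTensor fun j => noiseLayer N (β j) := by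
  ext x y
  simp only [noiseLayer, Matrix.sum_apply, Matrix.smul_apply, tensorOp_apply, smul_eq_mul,
    blockTensor_apply, Fintype.prod_prod_type, ← Finset.prod_mul_distrib]
  have h1 : ∀ a : ι × κ → Fin 2, ∑ b : ι × κ → Fin 2, ∏ j, (β j (fun i => a (j, i))
      (fun i => b (j, i)) * ∏ i, N (Matrix.single (a (j, i)) (b (j, i)) 1) (x (j, i)) (y (j, i))) =
      ∏ j, ∑ t : κ → Fin 2, β j (fun i => a (j, i)) t *
        ∏ i, N (Matrix.single (a (j, i)) (t i) 1) (x (j, i)) (y (j, i)) := fun a =>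
    sum_prod_blocks fun j t => β j (fun i => a (j, i)) t *
        ∏ i, N (Matrix.single (a (j, i)) (t i) 1) (x (j, i)) (y (j, i))
  simp only [h1]
  exact sum_prod_blocks fun j s => ∑ t : κ → Fin 2, β j s t *
        ∏ i, N (Matrix.single (s i) (t i) 1) (x (j, i)) (y (j, i))

/-! ### Reduced states -/

/-- The reduced operator of `ρ` on the qubits `t i`, as the representative of the functional
`X ↦ Tr (embedOp t X * ρ)`. -/
def reduced (t : ι ↪ Q) (ρ : RegOp Q) : RegOp ι :=
  Matrix.of fun x y => (embedOp t (Matrix.single y x 1) * ρ).trace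

theorem trace_mul_reduced (t : ι ↪ Q) (X : RegOp ι) (ρ : RegOp Q) :
    (X * reduced t ρ).trace = (embedOp t X * ρ).trace := by
  have hX : embedOp t X = ∑ x, ∑ y, X x y • embedOp t (Matrix.single x y 1) := by
    conv_lhs => rw [← embedLin_apply, Matrix.matrix_eq_sum_single X]
    simp only [map_sum]
    refine Finset.sum_congr rfl fun i _ => Finset.sum_congr rfl fun j _ => ?_
    rw [← embedLin_apply, ← map_smul, Matrix.smul_single, smul_eq_mul, mul_one]
  rw [hX]
  simp only [Finset.sum_mul, Matrix.trace_sum, Matrix.smul_mul, Matrix.trace_smul, smul_eq_mul]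
  rw [Matrix.trace]
  simp only [Matrix.diag_apply, Matrix.mul_apply (M := X), reduced, Matrix.of_apply]

theorem reduced_noiseLayer {N : SuperOp} (hN : ∀ X, (N X).trace = X.trace) (t : ι ↪ Q)
    (ρ : RegOp Q) : reduced t (noiseLayer N ρ) = noiseLayer N (reduced t ρ) := by
  refine eq_of_trace_tensorOp_mul fun A => ?_
  rw [trace_mul_reduced, embedOp_tensorOp, trace_tensorOp_mul_noiseLayer,
    trace_tensorOp_mul_noiseLayer, trace_mul_reduced, embedOp_tensorOp]
  congr 3
  funext q
  by_cases hq : ∃ i, t i = q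
  · obtain ⟨i, rfl⟩ := hq
    simp [t.injective.extend_apply]
  · simp [Function.extend_apply' _ _ _ hq, SuperOp.dual_one hN]

theorem reduced_conj_embedOp (t : ι ↪ Q) (U : RegOp ι) (ρ : RegOp Q) :
    reduced t (embedOp t U * ρ * (embedOp t U).conjTranspose) =
      U * reduced t ρ * U.conjTranspose := by
  refine Matrix.ext_iff_trace_mul_left.mpr fun X => ?_
  rw [trace_mul_reduced, ← embedOp_conjTranspose, ← Matrix.mul_assoc, ← Matrix.mul_assoc,
    Matrix.trace_mul_comm, ← Matrix.mul_assoc, ← Matrix.mul_assoc, ← embedOp_mul, ← embedOp_mul,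
    ← trace_mul_reduced, ← Matrix.mul_assoc, ← Matrix.mul_assoc,
    Matrix.trace_mul_comm _ U.conjTranspose,
    ← Matrix.mul_assoc, ← Matrix.mul_assoc]

/-! ### Registers with independent identical qubits -/

/-- The qubits of `S` are independent and each of them is in the state `σ`; the state of the other
qubits, and their correlations with `S`, are arbitrary. -/
def ProductOn (S : Finset Q) (σ : Matrix (Fin 2) (Fin 2) ℂ) (ρ : RegOp Q) : Prop :=
  ∀ A : Q → Matrix (Fin 2) (Fin 2) ℂ, (∀ q ∉ S, A q = 1) →
    (tensorOp A * ρ).trace = ∏ q ∈ S, (A q * σ).trace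

theorem ProductOn.noiseLayer {N : SuperOp} (hN : ∀ X, (N X).trace = X.trace) {S : Finset Q}
    {σ : Matrix (Fin 2) (Fin 2) ℂ} {ρ : RegOp Q} (h : ProductOn S σ ρ) :
    ProductOn S (N σ) (noiseLayer N ρ) := by
  intro A hA
  rw [trace_tensorOp_mul_noiseLayer, h _ fun q hq => by rw [hA q hq, SuperOp.dual_one hN]]
  exact Finset.prod_congr rfl fun q _ => SuperOp.trace_dual_mul _ _ _

theorem ProductOn.rotate {S : Finset Q} {σ : Matrix (Fin 2) (Fin 2) ℂ} {ρ : RegOp Q}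
    (h : ProductOn S σ ρ) {V : Matrix (Fin 2) (Fin 2) ℂ}
    (hV : V ∈ Matrix.unitaryGroup (Fin 2) ℂ) :
    ProductOn S (V * σ * V.conjTranspose)
      (tensorOp (fun _ => V) * ρ * (tensorOp fun _ => V).conjTranspose) := by
  intro A hA
  rw [conjTranspose_tensorOp, ← Matrix.mul_assoc, ← Matrix.mul_assoc, Matrix.trace_mul_comm,
    ← Matrix.mul_assoc, ← Matrix.mul_assoc, tensorOp_mul, tensorOp_mul, h]
  · refine Finset.prod_congr rfl fun q _ => ?_
    rw [← Matrix.mul_assoc, ← Matrix.mul_assoc, Matrix.trace_mul_comm _ V.conjTranspose,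
      ← Matrix.mul_assoc, ← Matrix.mul_assoc]
  · intro q hq
    rw [hA q hq, mul_one]
    exact Matrix.mem_unitaryGroup_iff'.mp hV

theorem ProductOn.permute {S : Finset Q} {σ : Matrix (Fin 2) (Fin 2) ℂ} {ρ : RegOp Q}
    (h : ProductOn S σ ρ) (π : Equiv.Perm Q) :
    ProductOn (S.image π) σ (permOp π * ρ * (permOp π).conjTranspose) := by
  intro A hA
  rw [← Matrix.mul_assoc, ← Matrix.mul_assoc, Matrix.trace_mul_comm, ← Matrix.mul_assoc,
    ← Matrix.mul_assoc, permOp_conj_tensorOp, h, Finset.prod_image fun _ _ _ _ h => π.injective h]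
  intro q hq
  refine hA _ fun hc => hq ?_
  obtain ⟨r, hr, hrq⟩ := Finset.mem_image.mp hc
  exact π.injective hrq ▸ hr

theorem ProductOn.reduced {t : ι ↪ Q} {σ : Matrix (Fin 2) (Fin 2) ℂ} {ρ : RegOp Q}
    (h : ProductOn (Finset.univ.image t) σ ρ) : reduced t ρ = tensorOp fun _ => σ := by
  refine eq_of_trace_tensorOp_mul fun A => ?_
  rw [trace_mul_reduced, embedOp_tensorOp, h, Finset.prod_image fun _ _ _ _ h => t.injective h,
    tensorOp_mul, trace_tensorOp]
  · exact Finset.prod_congr rfl fun i _ => by rw [t.injective.extend_apply]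
  · intro q hq
    exact Function.extend_apply' _ _ _ (by simpa using hq)

/-- The state of the first qubit of a block. -/
def headState (β : RegOp (Fin 3)) : Matrix (Fin 2) (Fin 2) ℂ :=
  Matrix.of fun i j => (tensorOp (Function.update 1 0 (Matrix.single j i 1)) * β).trace

theorem tensorOp_update_eq_sum (i₀ : ι) (A : Matrix (Fin 2) (Fin 2) ℂ) :
    tensorOp (Function.update 1 i₀ A) =
      ∑ i, ∑ j, A i j • tensorOp (Function.update (1 : ι → Matrix (Fin 2) (Fin 2) ℂ) i₀
        (Matrix.single i j 1)) := by
  ext x y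
  simp only [Matrix.sum_apply, Matrix.smul_apply, tensorOp_apply, smul_eq_mul]
  simp only [← Finset.mul_prod_erase _ _ (Finset.mem_univ i₀), Function.update_self]
  have h : ∀ B : Matrix (Fin 2) (Fin 2) ℂ, ∏ q ∈ Finset.univ.erase i₀,
      (Function.update (1 : ι → Matrix (Fin 2) (Fin 2) ℂ) i₀ B) q (x q) (y q) =
      ∏ q ∈ Finset.univ.erase i₀, (1 : Matrix (Fin 2) (Fin 2) ℂ) (x q) (y q) := fun B =>
    Finset.prod_congr rfl fun q hq => by
      rw [Function.update_of_ne (Finset.ne_of_mem_erase hq), Pi.one_apply]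
  simp only [h, ← mul_assoc, ← Finset.sum_mul]
  congr 1
  conv_lhs => rw [Matrix.matrix_eq_sum_single A]
  simp only [Matrix.sum_apply, Matrix.single_apply, mul_ite, mul_one, mul_zero]

theorem trace_mul_headState (A : Matrix (Fin 2) (Fin 2) ℂ) (β : RegOp (Fin 3)) :
    (A * headState β).trace = (tensorOp (Function.update 1 0 A) * β).trace := by
  rw [tensorOp_update_eq_sum]
  simp only [Finset.sum_mul, Matrix.trace_sum, Matrix.smul_mul, Matrix.trace_smul, smul_eq_mul]
  rw [Matrix.trace]
  simp only [Matrix.diag_apply, Matrix.mul_apply (M := A), headState, Matrix.of_apply]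

/-- The noisy evolution of one block under the unitaries `Vs`; the head of the list acts first. -/
noncomputable def blockRun (N : SuperOp) (Vs : List (RegOp κ)) (β : RegOp κ) : RegOp κ :=
  Vs.foldl (fun β V => noiseLayer N (V * β * V.conjTranspose)) β

/-- Independent blocks evolve independently when every layer acts blockwise, and their first qubits
are independent afterwards. -/
theorem ProductOn.noisyRun_blocks {N : SuperOp} (hN : ∀ X, (N X).trace = X.trace)
    {Adj : Q → Q → Prop} {t : ι × Fin 3 ↪ Q} {σ : Matrix (Fin 2) (Fin 2) ℂ} {ρ : RegOp Q}
    (h : ProductOn (Finset.univ.image t) σ ρ) {L : List (Layer Adj)} {Vs : List (RegOp (Fin 3))}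
    (hL : List.Forall₂ (fun (ℓ : Layer Adj) V => ℓ.unitary = embedOp t (blockTensor fun _ => V))
      L Vs) :
    ProductOn (Finset.univ.image fun j => t (j, 0))
      (headState (blockRun N Vs (tensorOp fun _ => σ))) (noisyRun N L ρ) := by
  have key : ∀ (L : List (Layer Adj)) (Vs : List (RegOp (Fin 3))),
      List.Forall₂ (fun (ℓ : Layer Adj) V => ℓ.unitary = embedOp t (blockTensor fun _ => V)) L Vs →
      ∀ (ρ : RegOp Q) (β : RegOp (Fin 3)), _root_.reduced t ρ = (blockTensor fun _ => β) →
        _root_.reduced t (noisyRun N L ρ) = blockTensor fun _ => blockRun N Vs β := by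
    intro L Vs hL
    induction hL with
    | nil => intro ρ β h; exact h
    | @cons ℓ V L Vs hℓ _ ih =>
      intro ρ β h
      refine ih _ _ ?_
      rw [reduced_noiseLayer hN, hℓ, reduced_conj_embedOp, h, blockTensor_conjTranspose,
        blockTensor_mul, blockTensor_mul, noiseLayer_blockTensor]
  have h1 := key L Vs hL ρ (tensorOp fun _ => σ) (by
    rw [h.reduced, tensorOp_eq_blockTensor])
  intro A hA
  have h2 : tensorOp A = embedOp t (tensorOp fun p => if p.2 = 0 then A (t p) else 1) := by
    rw [embedOp_tensorOp]
    congr 1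
    funext q
    by_cases hq : ∃ p, t p = q
    · obtain ⟨⟨j, i⟩, rfl⟩ := hq
      rw [t.injective.extend_apply]
      split_ifs with hi
      · rfl
      · refine hA _ fun hc => hi ?_
        obtain ⟨j', _, hj'⟩ := Finset.mem_image.mp hc
        exact (Prod.ext_iff.mp (t.injective hj')).2.symm
    · rw [Function.extend_apply' _ _ _ hq]
      refine hA _ fun hc => hq ?_
      obtain ⟨j', _, hj'⟩ := Finset.mem_image.mp hc
      exact ⟨_, hj'⟩
  rw [h2, ← trace_mul_reduced, h1, tensorOp_eq_blockTensor, blockTensor_mul, trace_blockTensor,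
    Finset.prod_image]
  · refine Finset.prod_congr rfl fun j _ => ?_
    rw [trace_mul_headState]
    congr 3
    funext i
    rcases eq_or_ne i 0 with rfl | hi
    · simp
    · simp [hi]
  · intro j _ j' _ hj
    exact (Prod.ext_iff.mp (t.injective hj)).1

/-! ### Random Pauli gates -/

theorem sum_pauli_conj (B : Matrix (Fin 2) (Fin 2) ℂ) :
    ∑ p, pauli p * B * (pauli p).conjTranspose =
      (2 * B.trace) • (1 : Matrix (Fin 2) (Fin 2) ℂ) := by
  ext i j
  fin_cases i <;> fin_cases j <;>
    simp [Fin.sum_univ_four, pauli, Matrix.mul_apply, Matrix.trace, Fin.sum_univ_two,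
      Matrix.conjTranspose_apply, Matrix.vecMul, Matrix.vecHead, Matrix.vecTail] <;> ring_nf <;>
    simp <;> ring

/-- Random Pauli gates make the qubits other than `τ` maximally mixed and decouple them from `τ`. -/
theorem productOn_randomize (τ : Q) {ρ : RegOp Q} (hρ : ρ.trace = 1) :
    ProductOn (Finset.univ.erase τ) ((1 / 2 : ℂ) • 1) (randomize τ ρ) := by
  intro A hA
  have hτ : A τ = 1 := hA τ (by simp)
  let P' : ({q : Q // q ≠ τ} → Fin 4) → Q → Matrix (Fin 2) (Fin 2) ℂ := fun P q =>
    if h : q ≠ τ then pauli (P ⟨q, h⟩) else 1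
  let c : ℂ := ((4 : ℂ) ^ (Fintype.card Q - 1))⁻¹
  let R : RegOp Q →ₗ[ℂ] ℂ := c • ∑ P, Matrix.traceLinearMap (Q → Fin 2) ℂ ℂ ∘ₗ
    LinearMap.mulLeft ℂ (tensorOp A) ∘ₗ LinearMap.mulRight ℂ (tensorOp (P' P)).conjTranspose ∘ₗ
      LinearMap.mulLeft ℂ (tensorOp (P' P))
  have hR : ∀ ρ, (tensorOp A * randomize τ ρ).trace = R ρ := by
    intro ρ
    simp only [R, randomize, Matrix.mul_smul, Matrix.trace_smul, LinearMap.smul_apply, c,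
      Matrix.mul_sum, Matrix.trace_sum, LinearMap.sum_apply, LinearMap.comp_apply,
      LinearMap.mulLeft_apply, LinearMap.mulRight_apply, Matrix.traceLinearMap_apply, P']
  have hlin : R = (∏ q ∈ Finset.univ.erase τ, (A q * ((1 / 2 : ℂ) • 1)).trace) •
      Matrix.traceLinearMap (Q → Fin 2) ℂ ℂ := by
    refine linearMap_ext_tensorOp fun B => ?_
    simp only [R, LinearMap.smul_apply, LinearMap.sum_apply, LinearMap.comp_apply,
      LinearMap.mulLeft_apply, LinearMap.mulRight_apply, Matrix.traceLinearMap_apply,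
      conjTranspose_tensorOp, tensorOp_mul, trace_tensorOp, smul_eq_mul]
    have h1 : ∀ P, ∏ q, (A q * (P' P q * B q * (P' P q).conjTranspose)).trace =
        (B τ).trace * ∏ q : {q : Q // q ≠ τ},
          (A q * (pauli (P q) * B q * (pauli (P q)).conjTranspose)).trace := by
      intro P
      rw [← Finset.mul_prod_erase _ _ (Finset.mem_univ τ)]
      congr 1
      · simp [P', hτ]
      · rw [Finset.prod_subtype (p := fun q => q ≠ τ) _ (by simp)]
        refine Finset.prod_congr rfl fun q _ => ?_
        simp only [P', dif_pos q.2]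
    simp only [h1, ← Finset.mul_sum]
    have h2 : ∑ P : {q : Q // q ≠ τ} → Fin 4, ∏ q : {q : Q // q ≠ τ},
        (A q * (pauli (P q) * B q * (pauli (P q)).conjTranspose)).trace =
        ∏ q : {q : Q // q ≠ τ}, (4 * ((A q * ((1 / 2 : ℂ) • 1)).trace * (B q).trace)) := by
      have h4 := (Finset.prod_univ_sum (fun _ : {q : Q // q ≠ τ} => (Finset.univ : Finset (Fin 4)))
        fun q p => (A q * (pauli p * B q * (pauli p).conjTranspose)).trace).symm
      rw [Fintype.piFinset_univ] at h4
      refine h4.trans ?_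
      refine Finset.prod_congr rfl fun q _ => ?_
      rw [← Matrix.trace_sum, ← Matrix.mul_sum, sum_pauli_conj]
      simp only [Matrix.mul_smul, Matrix.trace_smul, smul_eq_mul, mul_one]
      ring
    have h3 : c * ∏ _q : {q : Q // q ≠ τ}, (4 : ℂ) = 1 := by
      have hcard : Fintype.card {q : Q // q ≠ τ} = Fintype.card Q - 1 := by
        simp [Fintype.card_subtype_compl]
      rw [Finset.prod_const, Finset.card_univ, hcard]
      exact inv_mul_cancel₀ (pow_ne_zero _ (by norm_num))
    rw [h2, Finset.prod_mul_distrib, Finset.prod_mul_distrib,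
      ← Finset.mul_prod_erase _ (fun q => (B q).trace) (Finset.mem_univ τ),
      Finset.prod_subtype (p := fun q => q ≠ τ) (Finset.univ.erase τ) (by simp)
        (fun q => (A q * ((1 / 2 : ℂ) • 1)).trace),
      Finset.prod_subtype (p := fun q => q ≠ τ) (Finset.univ.erase τ) (by simp)
        (fun q => (B q).trace)]
    linear_combination ((B τ).trace * (∏ q : {q : Q // q ≠ τ}, (A q * ((1 / 2 : ℂ) • 1)).trace) *
      ∏ q : {q : Q // q ≠ τ}, (B q).trace) * h3
  rw [hR, hlin]
  simp [hρ]

theorem ProductOn.polarization {q : Q} {σ : Matrix (Fin 2) (Fin 2) ℂ} {ρ : RegOp Q}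
    (h : ProductOn {q} σ ρ) : polarization q ρ = (pauli 3 * σ).trace.re := by
  rw [_root_.polarization, h _ fun q' hq' => if_neg (by simpa using hq')]
  simp

end Noise

/-! ### Layers of gates -/

section Layers

variable {Q : Type} [Fintype Q] [DecidableEq Q] {Adj : Q → Q → Prop}

theorem tensorOp_mem_unitaryGroup {V : Q → Matrix (Fin 2) (Fin 2) ℂ}
    (hV : ∀ q, V q ∈ Matrix.unitaryGroup (Fin 2) ℂ) :
    tensorOp V ∈ Matrix.unitaryGroup (Q → Fin 2) ℂ := by
  rw [Matrix.mem_unitaryGroup_iff, Matrix.star_eq_conjTranspose, conjTranspose_tensorOp,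
    tensorOp_mul, ← tensorOp_one]
  congr 1
  funext q
  exact Matrix.mem_unitaryGroup_iff.mp (hV q)

theorem permOp_mem_unitaryGroup (π : Equiv.Perm Q) :
    permOp π ∈ Matrix.unitaryGroup (Q → Fin 2) ℂ := by
  rw [Matrix.mem_unitaryGroup_iff, Matrix.star_eq_conjTranspose, permOp_conjTranspose, ← permOp_mul,
    mul_inv_cancel, permOp_one]

/-- The layer without gates. -/
def idleLayer (Adj : Q → Q → Prop) : Layer Adj := ⟨[], List.Pairwise.nil⟩

theorem idleLayer_unitary : (idleLayer Adj).unitary = 1 := rfl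

/-- The rotation `V` of the qubit `q`. -/
def rotationGate (Adj : Q → Q → Prop) {V : Matrix (Fin 2) (Fin 2) ℂ}
    (hV : V ∈ Matrix.unitaryGroup (Fin 2) ℂ) (q : Q) : Gate Adj where
  arity := 1
  one_le_arity := le_rfl
  arity_le_two := one_le_two
  wires := ⟨fun _ => q, fun _ _ _ => Subsingleton.elim _ _⟩
  adjacent i j h := (h (Subsingleton.elim i j)).elim
  mat := tensorOp fun _ => V
  mat_unitary := tensorOp_mem_unitaryGroup fun _ => hV

/-- The layer that applies the rotation `V` to every qubit. -/
noncomputable def rotationLayer (Adj : Q → Q → Prop) {V : Matrix (Fin 2) (Fin 2) ℂ}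
    (hV : V ∈ Matrix.unitaryGroup (Fin 2) ℂ) : Layer Adj where
  gates := Finset.univ.toList.map (rotationGate Adj hV)
  disjoint := by
    rw [List.pairwise_map]
    exact (Finset.nodup_toList _).imp fun h _ _ => h

theorem rotationLayer_arity {V : Matrix (Fin 2) (Fin 2) ℂ}
    (hV : V ∈ Matrix.unitaryGroup (Fin 2) ℂ) :
    ∀ g ∈ (rotationLayer Adj hV).gates, g.arity = 1 := by
  intro g hg
  obtain ⟨q, _, rfl⟩ := List.mem_map.mp hg
  rfl

theorem rotationLayer_unitary {V : Matrix (Fin 2) (Fin 2) ℂ}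
    (hV : V ∈ Matrix.unitaryGroup (Fin 2) ℂ) :
    (rotationLayer Adj hV).unitary = tensorOp fun _ => V := by
  have h1 : ∀ q, embedOp (rotationGate Adj hV q).wires (rotationGate Adj hV q).mat =
      tensorOp (Function.update 1 q V) := by
    intro q
    refine (embedOp_tensorOp (rotationGate Adj hV q).wires fun _ => V).trans ?_
    congr 1
    funext r
    rcases eq_or_ne r q with rfl | hr
    · rw [Function.update_self]
      exact (rotationGate Adj hV r).wires.injective.extend_apply _ _ (0 : Fin 1)
    · rw [Function.update_of_ne hr, Function.extend_apply']
      · rfl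
      · rintro ⟨_, hi⟩
        exact hr hi.symm
  have h2 : ∀ l : List Q, l.Nodup → (l.map fun q => tensorOp (Function.update 1 q V)).prod =
      tensorOp fun q => if q ∈ l then V else 1 := by
    intro l hl
    induction l with
    | nil => simp [tensorOp_one]
    | cons a l ih =>
      rw [List.map_cons, List.prod_cons, ih (List.nodup_cons.mp hl).2, tensorOp_mul]
      congr 1
      funext q
      rcases eq_or_ne q a with rfl | hq
      · simp [(List.nodup_cons.mp hl).1]
      · simp [hq]
  rw [Layer.unitary, rotationLayer, List.map_map]
  have h3 := h2 Finset.univ.toList (Finset.nodup_toList _)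
  simp only [Finset.mem_toList, Finset.mem_univ, if_true] at h3
  rw [← h3]
  exact congrArg List.prod (List.map_congr_left fun q _ => h1 q)

theorem ProductOn.rotationLayer {N : SuperOp} (hN : ∀ X, (N X).trace = X.trace) {S : Finset Q}
    {σ V : Matrix (Fin 2) (Fin 2) ℂ} {ρ : RegOp Q} (h : ProductOn S σ ρ)
    (hV : V ∈ Matrix.unitaryGroup (Fin 2) ℂ) :
    ProductOn S (N (V * σ * V.conjTranspose)) (noisyRun N [rotationLayer Adj hV] ρ) := by
  have := (h.rotate hV).noiseLayer hN
  rwa [← rotationLayer_unitary (Adj := Adj) hV] at this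

theorem noisyRun_append (N : SuperOp) (L L' : List (Layer Adj)) (ρ : RegOp Q) :
    noisyRun N (L ++ L') ρ = noisyRun N L' (noisyRun N L ρ) :=
  List.foldl_append

theorem ProductOn.idle {N : SuperOp} (hN : ∀ X, (N X).trace = X.trace) {S : Finset Q}
    {σ : Matrix (Fin 2) (Fin 2) ℂ} {ρ : RegOp Q} (h : ProductOn S σ ρ) (n : ℕ) :
    ProductOn S (N^[n] σ) (noisyRun N (List.replicate n (idleLayer Adj)) ρ) := by
  induction n generalizing σ ρ with
  | zero => exact h
  | succ n ih =>
    refine ih (σ := N σ) (ρ := _root_.noiseLayer N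
      ((idleLayer Adj).unitary * ρ * (idleLayer Adj).unitary.conjTranspose)) ?_
    rw [idleLayer_unitary]
    simpa using h.noiseLayer hN

/-- Parallel swaps of the disjoint neighbouring pairs `a i`, `b i`. -/
theorem exists_swapLayer {ι : Type} [Fintype ι] (a b : ι → Q)
    (hab : ∀ i, Adj (a i) (b i)) (hba : ∀ i, Adj (b i) (a i)) (ha : Function.Injective a)
    (hb : Function.Injective b) (hne : ∀ i j, a i ≠ b j) :
    ∃ (ℓ : Layer Adj) (s : Equiv.Perm Q), ℓ.unitary = permOp s ∧ (∀ i, s (a i) = b i) ∧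
      (∀ i, s (b i) = a i) ∧ ∀ x, (∀ i, x ≠ a i) → (∀ i, x ≠ b i) → s x = x := by
  have hinj : ∀ i, Function.Injective ![a i, b i] := by
    intro i j k hjk
    fin_cases j <;> fin_cases k <;> simp_all
    exact (hne _ _ hjk.symm).elim
  let gate : ι → Gate Adj := fun i =>
    { arity := 2
      one_le_arity := one_le_two
      arity_le_two := le_rfl
      wires := ⟨![a i, b i], hinj i⟩
      adjacent := by
        intro j k hjk
        fin_cases j <;> fin_cases k <;> simp_all
      mat := permOp (Equiv.swap 0 1)
      mat_unitary := permOp_mem_unitaryGroup _ }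
  have hdisj : (Finset.univ.toList.map gate).Pairwise fun g h => ∀ i j, g.wires i ≠ h.wires j := by
    rw [List.pairwise_map]
    refine (Finset.nodup_toList _).imp ?_
    intro i j hij (k : Fin 2) (l : Fin 2)
    change ![a i, b i] k ≠ ![a j, b j] l
    fin_cases k <;> fin_cases l
    · exact fun h => hij (ha h)
    · exact hne i j
    · exact (hne j i).symm
    · exact fun h => hij (hb h)
  let s : List ι → Equiv.Perm Q := fun l => (l.map fun i => Equiv.swap (a i) (b i)).prod
  have hs_fix : ∀ l x, (∀ i ∈ l, x ≠ a i) → (∀ i ∈ l, x ≠ b i) → s l x = x := by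
    intro l x h1 h2
    induction l with
    | nil => rfl
    | cons i l ih =>
      have : s (i :: l) x = Equiv.swap (a i) (b i) (s l x) := rfl
      rw [this, ih (fun j hj => h1 j (List.mem_cons_of_mem _ hj))
        (fun j hj => h2 j (List.mem_cons_of_mem _ hj))]
      exact Equiv.swap_apply_of_ne_of_ne (h1 i List.mem_cons_self) (h2 i List.mem_cons_self)
  have hs : ∀ l : List ι, l.Nodup → ∀ i ∈ l, s l (a i) = b i ∧ s l (b i) = a i := by
    intro l hl
    induction l with
    | nil => simp
    | cons j l ih =>
      obtain ⟨hj, hl⟩ := List.nodup_cons.mp hl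
      have hcons : ∀ x, s (j :: l) x = Equiv.swap (a j) (b j) (s l x) := fun x => rfl
      intro i hi
      rcases List.mem_cons.mp hi with rfl | hi
      · have h1 : s l (a i) = a i := hs_fix l _
          (fun k hk h => hj (ha h ▸ hk)) (fun k _ => hne i k)
        have h2 : s l (b i) = b i := hs_fix l _
          (fun k _ => (hne k i).symm) (fun k hk h => hj (hb h ▸ hk))
        rw [hcons, hcons, h1, h2]
        simp
      · have hij : i ≠ j := fun h => hj (h ▸ hi)
        rw [hcons, hcons, (ih hl i hi).1, (ih hl i hi).2]
        exact ⟨Equiv.swap_apply_of_ne_of_ne (hne j i).symm (fun h => hij (hb h)),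
          Equiv.swap_apply_of_ne_of_ne (fun h => hij (ha h)) (hne i j)⟩
  refine ⟨⟨_, hdisj⟩, s Finset.univ.toList, ?_,
    fun i => (hs _ (Finset.nodup_toList _) i (by simp)).1,
    fun i => (hs _ (Finset.nodup_toList _) i (by simp)).2,
    fun x h1 h2 => hs_fix _ _ (fun i _ => h1 i) fun i _ => h2 i⟩
  have hperm : ∀ l : List ι, ((l.map gate).map fun g => embedOp g.wires g.mat).prod =
      permOp (s l) := by
    intro l
    induction l with
    | nil => exact permOp_one.symm
    | cons i l ih =>
      rw [List.map_cons, List.map_cons, List.prod_cons, ih]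
      have : s (i :: l) = Equiv.swap (a i) (b i) * s l := rfl
      rw [this, permOp_mul]
      congr 1
      exact embedOp_swap ⟨![a i, b i], hinj i⟩ rfl rfl
  exact hperm _

/-- Every layer of the circuit permutes the qubits, by `π` in total. -/
inductive IsPermRun : List (Layer Adj) → Equiv.Perm Q → Prop
  | nil : IsPermRun [] 1
  | cons (ℓ : Layer Adj) (L : List (Layer Adj)) (s π : Equiv.Perm Q)
      (hℓ : ℓ.unitary = permOp s) (hL : IsPermRun L π) : IsPermRun (ℓ :: L) (π * s)

theorem IsPermRun.append {L L' : List (Layer Adj)} {π π' : Equiv.Perm Q} (h : IsPermRun L π)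
    (h' : IsPermRun L' π') : IsPermRun (L ++ L') (π' * π) := by
  induction h with
  | nil => simpa using h'
  | cons ℓ L s π hℓ _ ih =>
    rw [← mul_assoc]
    exact .cons ℓ _ s _ hℓ ih

theorem IsPermRun.append_rotation {L : List (Layer Adj)} {π : Equiv.Perm Q} (h : IsPermRun L π)
    {V : Matrix (Fin 2) (Fin 2) ℂ} (hV : V ∈ Matrix.unitaryGroup (Fin 2) ℂ) :
    IsTransport (L ++ [rotationLayer Adj hV]) π := by
  induction h with
  | nil =>
    have := IsTransport.cons (rotationLayer Adj hV) [] 1 1 (fun _ => ⟨V, hV⟩)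
      (by rw [rotationLayer_unitary, permOp_one, one_mul]) .nil
    simpa using this
  | cons ℓ L s π hℓ _ ih =>
    refine .cons ℓ _ s π (fun _ => 1) ?_ ih
    rw [hℓ]
    simp [tensorOp_one]

theorem ProductOn.permRun {N : SuperOp} (hN : ∀ X, (N X).trace = X.trace) {S : Finset Q}
    {σ : Matrix (Fin 2) (Fin 2) ℂ} {ρ : RegOp Q} (h : ProductOn S σ ρ) {L : List (Layer Adj)}
    {π : Equiv.Perm Q} (hL : IsPermRun L π) :
    ProductOn (S.image π) (N^[L.length] σ) (noisyRun N L ρ) := by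
  induction hL generalizing S σ ρ with
  | nil => simpa [noisyRun] using h
  | cons ℓ L s π hℓ _ ih =>
    have h1 := (h.permute s).noiseLayer hN
    rw [← hℓ] at h1
    have h2 := ih h1
    rw [Finset.image_image] at h2
    exact h2

/-- The gate `u`, acting on the qubits `w i` of every trio. -/
theorem exists_blockLayer {n a : ℕ} (t : Fin n × Fin 3 ↪ Q) (h1 : 1 ≤ a) (h2 : a ≤ 2)
    (w : Fin a ↪ Fin 3) (u : RegOp (Fin a)) (hu : u ∈ Matrix.unitaryGroup (Fin a → Fin 2) ℂ)
    (hadj : ∀ j i i', i ≠ i' → Adj (t (j, w i)) (t (j, w i'))) :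
    ∃ ℓ : Layer Adj, ℓ.unitary = embedOp t (blockTensor fun _ => embedOp w u) := by
  let gate : Fin n → Gate Adj := fun j =>
    { arity := a
      one_le_arity := h1
      arity_le_two := h2
      wires := w.trans ((blockWire (Fin 3) j).trans t)
      adjacent := fun i i' h => hadj j i i' h
      mat := u
      mat_unitary := hu }
  have hdisj : ((List.finRange n).map gate).Pairwise fun g h =>
      ∀ i j, g.wires i ≠ h.wires j := by
    rw [List.pairwise_map]
    refine (List.nodup_finRange n).imp fun {j k} hjk i i' hc => hjk ?_
    exact (Prod.ext_iff.mp (t.injective hc)).1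
  refine ⟨⟨_, hdisj⟩, ?_⟩
  have h3 := prod_embedOp_blockWire (fun _ : Fin n => embedOp w u) (List.finRange n)
    (List.nodup_finRange n)
  simp only [List.mem_finRange, if_true] at h3
  rw [← h3, Layer.unitary]
  clear h3
  simp only
  clear hdisj
  induction List.finRange n with
  | nil => exact (embedOp_one t).symm
  | cons j l ih =>
    rw [List.map_cons, List.map_cons, List.prod_cons, ih, List.map_cons, List.prod_cons,
      embedOp_mul, embedOp_trans, embedOp_trans]

theorem idealUnitary_blocks {n : ℕ} {t : Fin n × Fin 3 ↪ Q} {L : List (Layer Adj)}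
    {Vs : List (RegOp (Fin 3))}
    (hL : List.Forall₂ (fun (ℓ : Layer Adj) V => ℓ.unitary = embedOp t (blockTensor fun _ => V))
      L Vs) :
    idealUnitary L = embedOp t (blockTensor fun _ => Vs.foldl (fun W V => V * W) 1) := by
  have key : ∀ W : RegOp (Fin 3), L.foldl (fun V ℓ => ℓ.unitary * V)
      (embedOp t (blockTensor fun _ => W)) =
      embedOp t (blockTensor fun _ => Vs.foldl (fun W V => V * W) W) := by
    induction hL with
    | nil => intro W; rfl
    | @cons ℓ V L Vs hℓ _ ih =>
      intro W
      rw [List.foldl_cons, List.foldl_cons, hℓ, ← embedOp_mul, blockTensor_mul, ih]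
  have := key 1
  rwa [blockTensor_one, embedOp_one] at this

end Layers

/-! ### The elementary compressor from neighbouring gates -/

section Compressor

variable {κ : Type} [Fintype κ] [DecidableEq κ]

/-- The monomial operator that sends the basis state `y` to `I ^ φ y` times the basis state
`g y`. -/
noncomputable def monomialOp (g : (κ → Fin 2) → κ → Fin 2) (φ : (κ → Fin 2) → ℕ) : RegOp κ :=
  Matrix.of fun x y => if x = g y then Complex.I ^ φ y else 0

theorem monomialOp_apply (g : (κ → Fin 2) → κ → Fin 2) (φ : (κ → Fin 2) → ℕ) (x y : κ → Fin 2) :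
    monomialOp g φ x y = if x = g y then Complex.I ^ φ y else 0 := rfl

theorem monomialOp_mul (g g' : (κ → Fin 2) → κ → Fin 2) (φ φ' : (κ → Fin 2) → ℕ) :
    monomialOp g φ * monomialOp g' φ' =
      monomialOp (fun y => g (g' y)) fun y => φ (g' y) + φ' y := by
  ext x y
  simp only [Matrix.mul_apply, monomialOp_apply, mul_ite, ite_mul, zero_mul, mul_zero,
    Finset.sum_ite_eq', Finset.mem_univ, if_true]
  rw [pow_add]

theorem monomialOp_congr {g g' : (κ → Fin 2) → κ → Fin 2} {φ φ' : (κ → Fin 2) → ℕ}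
    (hg : ∀ y, g y = g' y) (hφ : ∀ y, φ y % 4 = φ' y % 4) : monomialOp g φ = monomialOp g' φ' := by
  ext x y
  rw [monomialOp_apply, monomialOp_apply, hg, Complex.I_pow_eq_pow_mod (φ y), hφ,
    ← Complex.I_pow_eq_pow_mod]

theorem monomialOp_mem_unitaryGroup {g : (κ → Fin 2) → κ → Fin 2} (hg : Function.Injective g)
    (φ : (κ → Fin 2) → ℕ) : monomialOp g φ ∈ Matrix.unitaryGroup (κ → Fin 2) ℂ := by
  rw [Matrix.mem_unitaryGroup_iff', Matrix.star_eq_conjTranspose]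
  ext x y
  simp only [Matrix.mul_apply, Matrix.conjTranspose_apply, monomialOp_apply, mul_ite, mul_zero,
    Finset.sum_ite_eq', Finset.mem_univ, if_true]
  by_cases h : x = y
  · subst h
    rw [if_pos rfl, Matrix.one_apply_eq]
    simp [← mul_pow]
  · rw [if_neg fun hc => h (hg hc).symm, Matrix.one_apply_ne h]
    simp

/-- A map of the bits at the positions `w 0` and `w 1`, as a map of three bits. -/
def liftBits (w : Fin 2 ↪ Fin 3) (g : (Fin 2 → Fin 2) → Fin 2 → Fin 2) (y : Fin 3 → Fin 2) :
    Fin 3 → Fin 2 :=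
  fun q => if q = w 0 then g (y ∘ w) 0 else if q = w 1 then g (y ∘ w) 1 else y q

theorem embedOp_monomialOp (w : Fin 2 ↪ Fin 3) (g : (Fin 2 → Fin 2) → Fin 2 → Fin 2)
    (φ : (Fin 2 → Fin 2) → ℕ) :
    embedOp w (monomialOp g φ) = monomialOp (liftBits w g) fun y => φ (y ∘ w) := by
  have hne : w 1 ≠ w 0 := w.injective.ne (by decide)
  ext x y
  rw [embedOp_apply, monomialOp_apply, monomialOp_apply, ← ite_and]
  have key : (∀ q, (∀ i, w i ≠ q) → x q = y q) ∧ (fun i => x (w i)) = g (fun i => y (w i)) ↔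
      x = liftBits w g y := by
    simp only [Fin.forall_fin_two]
    constructor
    · rintro ⟨h, h'⟩
      funext q
      simp only [liftBits]
      split_ifs with h0 h1
      · rw [h0]
        exact congrFun h' 0
      · rw [h1]
        exact congrFun h' 1
      · exact h q ⟨Ne.symm h0, Ne.symm h1⟩
    · rintro rfl
      refine ⟨fun q hq => ?_, ?_⟩
      · simp only [liftBits, if_neg hq.1.symm, if_neg hq.2.symm]
      · funext i
        fin_cases i
        · simp [liftBits, Function.comp_def]
        · simp [liftBits, Function.comp_def, hne]
  simp only [key]
  rfl

/-- A gate on one qubit, or on two neighbouring qubits, of a line of three qubits. -/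
def IsLineGate (V : RegOp (Fin 3)) : Prop :=
  ∃ (a : ℕ) (w : Fin a ↪ Fin 3) (u : RegOp (Fin a)), 1 ≤ a ∧ a ≤ 2 ∧
    u ∈ Matrix.unitaryGroup (Fin a → Fin 2) ℂ ∧
    (∀ i j, i ≠ j → (w i : ℕ) + 1 = w j ∨ (w j : ℕ) + 1 = w i) ∧ V = embedOp w u

/-- The qubits `0` and `1`. -/
def wire01 : Fin 2 ↪ Fin 3 := ⟨![0, 1], by decide⟩

/-- The qubits `1` and `2`. -/
def wire12 : Fin 2 ↪ Fin 3 := ⟨![1, 2], by decide⟩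

theorem isLineGate_monomialOp {w : Fin 2 ↪ Fin 3} (hw : w = wire01 ∨ w = wire12)
    {g : (Fin 2 → Fin 2) → Fin 2 → Fin 2} (hg : Function.Injective g) (φ : (Fin 2 → Fin 2) → ℕ) :
    IsLineGate (monomialOp (liftBits w g) fun y => φ (y ∘ w)) := by
  refine ⟨2, w, monomialOp g φ, one_le_two, le_rfl, monomialOp_mem_unitaryGroup hg φ, ?_,
    (embedOp_monomialOp w g φ).symm⟩
  rcases hw with rfl | rfl <;> decide

/-- The Hadamard matrix. -/
noncomputable def hadamard : Matrix (Fin 2) (Fin 2) ℂ :=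
  ((√2 : ℝ) : ℂ)⁻¹ • !![1, 1; 1, -1]

theorem inv_sqrt_two_mul_self : ((√2 : ℝ) : ℂ)⁻¹ * ((√2 : ℝ) : ℂ)⁻¹ = 1 / 2 := by
  rw [← mul_inv, ← Complex.ofReal_mul, Real.mul_self_sqrt (by norm_num)]
  norm_num

theorem hadamard_mul_mul (A : Matrix (Fin 2) (Fin 2) ℂ) :
    hadamard * A * hadamard = (1 / 2 : ℂ) • (!![1, 1; 1, -1] * A * !![1, 1; 1, -1]) := by
  simp only [hadamard, Matrix.smul_mul, Matrix.mul_smul, smul_smul, inv_sqrt_two_mul_self]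

theorem hadamard_mul_self : hadamard * hadamard = 1 := by
  have := hadamard_mul_mul 1
  rw [mul_one, mul_one] at this
  rw [this]
  ext i j
  fin_cases i <;> fin_cases j <;> simp <;> norm_num

theorem hadamard_mem_unitaryGroup : hadamard ∈ Matrix.unitaryGroup (Fin 2) ℂ := by
  have : star hadamard = hadamard := by
    rw [hadamard, star_smul]
    congr 1
    · simp
    · ext i j
      fin_cases i <;> fin_cases j <;> simp
  rw [Matrix.mem_unitaryGroup_iff, this, hadamard_mul_self]

/-- The Hadamard gate on the last of three qubits. -/
noncomputable def hadamardLast : RegOp (Fin 3) := tensorOp (Function.update 1 2 hadamard)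

theorem isLineGate_hadamardLast : IsLineGate hadamardLast := by
  refine ⟨1, ⟨fun _ => 2, fun _ _ _ => Subsingleton.elim _ _⟩, tensorOp fun _ => hadamard, le_rfl,
    one_le_two, tensorOp_mem_unitaryGroup fun _ => hadamard_mem_unitaryGroup,
    fun i j h => (h (Subsingleton.elim i j)).elim, ?_⟩
  rw [embedOp_tensorOp, hadamardLast]
  congr 1
  funext q
  rcases eq_or_ne q 2 with rfl | hq
  · rw [Function.update_self]
    exact ((Function.Injective.extend_apply
      (fun _ _ _ => Subsingleton.elim _ _ : Function.Injective fun _ : Fin 1 => (2 : Fin 3))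
      (fun _ => hadamard) (fun _ => 1) 0).symm :)
  · rw [Function.update_of_ne hq, Function.extend_apply']
    · rfl
    · rintro ⟨_, hi⟩
      exact hq hi.symm

/-- Hadamard gates turn the phase `(-1) ^ (y₀ (1 - y₁) y₂)` into a NOT of the last bit that is
controlled by the first two. -/
theorem hadamardLast_conj_phase :
    hadamardLast * (monomialOp id (fun y => 2 * ((y 0).val * (1 - (y 1).val) * (y 2).val)) *
      hadamardLast) = monomialOp (fun y => ![y 0, y 1, y 2 + y 0 * (1 - y 1)]) 0 := by
  have h1 : (monomialOp id fun y => 2 * ((y 0).val * (1 - (y 1).val) * (y 2).val) : RegOp (Fin 3)) =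
      tensorOp ![!![1, 0; 0, 1], !![1, 0; 0, 1], !![1, 0; 0, 1]] -
        (2 : ℂ) • tensorOp ![!![0, 0; 0, 1], !![1, 0; 0, 0], !![0, 0; 0, 1]] := by
    ext x y
    rw [monomialOp_apply, Matrix.sub_apply, Matrix.smul_apply, tensorOp_apply, tensorOp_apply,
      Fin.prod_univ_three, Fin.prod_univ_three]
    obtain ⟨x0, x1, x2, rfl⟩ : ∃ x0 x1 x2, x = ![x0, x1, x2] :=
      ⟨x 0, x 1, x 2, by ext i; fin_cases i <;> rfl⟩
    obtain ⟨y0, y1, y2, rfl⟩ : ∃ y0 y1 y2, y = ![y0, y1, y2] :=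
      ⟨y 0, y 1, y 2, by ext i; fin_cases i <;> rfl⟩
    fin_cases x0 <;> fin_cases x1 <;> fin_cases x2 <;> fin_cases y0 <;> fin_cases y1 <;>
      fin_cases y2 <;> simp
    norm_num
  have h2 : (monomialOp (fun y => ![y 0, y 1, y 2 + y 0 * (1 - y 1)]) 0 : RegOp (Fin 3)) =
      tensorOp ![!![1, 0; 0, 1], !![1, 0; 0, 1], !![1, 0; 0, 1]] -
        tensorOp ![!![0, 0; 0, 1], !![1, 0; 0, 0], !![1, -1; -1, 1]] := by
    ext x y
    rw [monomialOp_apply, Matrix.sub_apply, tensorOp_apply, tensorOp_apply,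
      Fin.prod_univ_three, Fin.prod_univ_three]
    obtain ⟨x0, x1, x2, rfl⟩ : ∃ x0 x1 x2, x = ![x0, x1, x2] :=
      ⟨x 0, x 1, x 2, by ext i; fin_cases i <;> rfl⟩
    obtain ⟨y0, y1, y2, rfl⟩ : ∃ y0 y1 y2, y = ![y0, y1, y2] :=
      ⟨y 0, y 1, y 2, by ext i; fin_cases i <;> rfl⟩
    fin_cases x0 <;> fin_cases x1 <;> fin_cases x2 <;> fin_cases y0 <;> fin_cases y1 <;>
      fin_cases y2 <;> simp
  have h3 : (2 : ℂ) •
        tensorOp ![!![0, 0; 0, 1], !![1, 0; 0, 0], hadamard * !![0, 0; 0, 1] * hadamard]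
      = tensorOp ![!![0, 0; 0, 1], !![1, 0; 0, 0], !![1, -1; -1, 1]] := by
    have : hadamard * !![0, 0; 0, 1] * hadamard = (1 / 2 : ℂ) • !![1, -1; -1, 1] := by
      rw [hadamard_mul_mul]
      congr 1
      ext i j
      fin_cases i <;> fin_cases j <;> simp
    rw [this]
    ext x y
    rw [Matrix.smul_apply, tensorOp_apply, tensorOp_apply, Fin.prod_univ_three,
      Fin.prod_univ_three]
    simp only [Matrix.cons_val, Matrix.smul_apply, smul_eq_mul]
    ring
  rw [← Matrix.one_fin_two] at h1 h2
  rw [h1, h2, ← h3, hadamardLast, sub_mul, mul_sub, Matrix.smul_mul, Matrix.mul_smul, tensorOp_mul,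
    tensorOp_mul, tensorOp_mul, tensorOp_mul]
  congr 2
  · funext q
    fin_cases q <;> simp [hadamard_mul_self]
  · congr 1
    funext q
    fin_cases q
    · simp
    · simp
    · exact (mul_assoc _ _ _).symm

/-- The elementary compressor is a product of gates on neighbouring qubits of a line: a controlled
swap is a doubly controlled NOT between two CNOTs, which is a doubly controlled phase between two
Hadamard gates, and `2abx = ax + bx - x (a ⊕ b)` reduces that phase to gates on two qubits. -/
theorem exists_compressor_gates : ∃ Vs : List (RegOp (Fin 3)), (∀ V ∈ Vs, IsLineGate V) ∧
    Vs.foldl (fun W V => V * W) 1 =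
      (Matrix.of fun x y => if x = compressorMap y then 1 else 0 : RegOp (Fin 3)) := by
  let cnot10 : RegOp (Fin 3) :=
    monomialOp (liftBits wire01 fun s => ![s 0 + s 1, s 1]) fun y => (fun _ => 0) (y ∘ wire01)
  let cnot01 : RegOp (Fin 3) :=
    monomialOp (liftBits wire01 fun s => ![s 0, s 0 + s 1]) fun y => (fun _ => 0) (y ∘ wire01)
  let cnot21 : RegOp (Fin 3) :=
    monomialOp (liftBits wire12 fun s => ![s 0 + s 1, s 1]) fun y => (fun _ => 0) (y ∘ wire12)
  let swap12 : RegOp (Fin 3) :=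
    monomialOp (liftBits wire12 fun s => ![s 1, s 0]) fun y => (fun _ => 0) (y ∘ wire12)
  let phase01 : RegOp (Fin 3) := monomialOp (liftBits wire01 id)
    fun y => (fun s => (s 0).val * (1 - (s 1).val)) (y ∘ wire01)
  let phase12 : RegOp (Fin 3) := monomialOp (liftBits wire12 id)
    fun y => (fun s => (1 - (s 0).val) * (s 1).val) (y ∘ wire12)
  let phase12' : RegOp (Fin 3) := monomialOp (liftBits wire12 id)
    fun y => (fun s => 3 * ((s 0).val * (1 - (s 1).val))) (y ∘ wire12)
  have h1 : swap12 * (cnot10 * (swap12 * (cnot21))) =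
      monomialOp (fun y => ![y 0 + y 2, y 1 + y 2, y 2]) 0 := by
    simp only [swap12, cnot10, cnot21, monomialOp_mul]
    exact monomialOp_congr (by decide) (by decide)
  have h2 : swap12 * (cnot01 * (phase12' * (cnot01 * (swap12 * (phase12 * phase01))))) =
      monomialOp id fun y => 2 * ((y 0).val * (1 - (y 1).val) * (y 2).val) := by
    simp only [swap12, cnot01, phase12', phase12, phase01, monomialOp_mul]
    exact monomialOp_congr (by decide) (by decide)
  have h3 : swap12 * (cnot10 * swap12) = monomialOp (fun y => ![y 0 + y 2, y 1, y 2]) 0 := by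
    simp only [swap12, cnot10, monomialOp_mul]
    exact monomialOp_congr (by decide) (by decide)
  refine ⟨[cnot21, swap12, cnot10, swap12, hadamardLast, phase01, phase12, swap12, cnot01, phase12',
    cnot01, swap12, hadamardLast, swap12, cnot10, swap12], ?_, ?_⟩
  · simp only [List.forall_mem_cons]
    have i1 : Function.Injective fun s : Fin 2 → Fin 2 => ![s 0 + s 1, s 1] := by decide
    have i2 : Function.Injective fun s : Fin 2 → Fin 2 => ![s 0, s 0 + s 1] := by decide
    have i3 : Function.Injective fun s : Fin 2 → Fin 2 => ![s 1, s 0] := by decide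
    have g1 : IsLineGate cnot21 := isLineGate_monomialOp (Or.inr rfl) i1 fun _ => 0
    have g2 : IsLineGate swap12 := isLineGate_monomialOp (Or.inr rfl) i3 fun _ => 0
    have g3 : IsLineGate cnot10 := isLineGate_monomialOp (Or.inl rfl) i1 fun _ => 0
    have g4 : IsLineGate cnot01 := isLineGate_monomialOp (Or.inl rfl) i2 fun _ => 0
    have g5 : IsLineGate phase01 := isLineGate_monomialOp (Or.inl rfl) Function.injective_id
      fun s => (s 0).val * (1 - (s 1).val)
    have g6 : IsLineGate phase12 := isLineGate_monomialOp (Or.inr rfl) Function.injective_id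
      fun s => (1 - (s 0).val) * (s 1).val
    have g7 : IsLineGate phase12' := isLineGate_monomialOp (Or.inr rfl) Function.injective_id
      fun s => 3 * ((s 0).val * (1 - (s 1).val))
    have g8 := isLineGate_hadamardLast
    exact ⟨g1, g2, g3, g2, g8, g5, g6, g2, g4, g7, g4, g2, g8, g2, g3, g2, by simp⟩
  · simp only [List.foldl_cons, List.foldl_nil, mul_one]
    have hassoc : swap12 * (cnot10 * (swap12 * (hadamardLast * (swap12 * (cnot01 * (phase12' *
        (cnot01 * (swap12 * (phase12 * (phase01 * (hadamardLast * (swap12 * (cnot10 *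
          (swap12 * cnot21)))))))))))))) =
        (swap12 * (cnot10 * swap12)) * ((hadamardLast * ((swap12 * (cnot01 * (phase12' * (cnot01 *
          (swap12 * (phase12 * phase01)))))) * hadamardLast)) * (swap12 * (cnot10 *
            (swap12 * cnot21)))) := by
      simp only [mul_assoc]
    rw [hassoc, h1, h2, h3, hadamardLast_conj_phase, monomialOp_mul, monomialOp_mul]
    have h4 : (Matrix.of fun x y => if x = compressorMap y then 1 else 0 : RegOp (Fin 3)) =
        monomialOp compressorMap 0 := by
      ext x y
      simp [monomialOp_apply]
    rw [h4]
    exact monomialOp_congr (by decide) (by decide)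

end Compressor

/-! ### Trace norm and Frobenius norm -/

section OneQubit

open scoped Matrix.Norms.Frobenius

theorem frobenius_norm_sq {n : Type*} [Fintype n] (A : Matrix n n ℂ) :
    ‖A‖ ^ 2 = ∑ i, ∑ j, ‖A i j‖ ^ 2 := by
  rw [Matrix.frobenius_norm_def, ← Real.sqrt_eq_rpow, Real.sq_sqrt]
  · simp only [Real.rpow_two]
  · exact Finset.sum_nonneg fun i _ => Finset.sum_nonneg fun j _ => by positivity

theorem norm_entry_le_frobenius_norm {n : Type*} [Fintype n] (A : Matrix n n ℂ) (i j : n) :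
    ‖A i j‖ ≤ ‖A‖ := by
  refine (sq_le_sq₀ (norm_nonneg _) (norm_nonneg _)).mp ?_
  rw [frobenius_norm_sq]
  exact (Finset.single_le_sum (f := fun j => ‖A i j‖ ^ 2) (fun _ _ => by positivity)
    (Finset.mem_univ j)).trans (Finset.single_le_sum (f := fun i => ∑ j, ‖A i j‖ ^ 2)
      (fun _ _ => Finset.sum_nonneg fun _ _ => by positivity) (Finset.mem_univ i))

theorem frobenius_norm_sq_eq_trace {n : Type*} [Fintype n] (A : Matrix n n ℂ) :
    ((‖A‖ ^ 2 : ℝ) : ℂ) = (A.conjTranspose * A).trace := by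
  rw [frobenius_norm_sq, Matrix.trace, Finset.sum_comm]
  push_cast
  refine Finset.sum_congr rfl fun j _ => ?_
  rw [Matrix.diag_apply, Matrix.mul_apply]
  refine Finset.sum_congr rfl fun i _ => ?_
  rw [Matrix.conjTranspose_apply, Complex.star_def, Complex.conj_mul']

theorem frobenius_norm_conj {n : Type*} [Fintype n] [DecidableEq n] {V : Matrix n n ℂ}
    (hV : V ∈ Matrix.unitaryGroup n ℂ) (A : Matrix n n ℂ) : ‖V * A * V.conjTranspose‖ = ‖A‖ := by
  have hV' : V.conjTranspose * V = 1 := Matrix.mem_unitaryGroup_iff'.mp hV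
  have h : ((‖V * A * V.conjTranspose‖ ^ 2 : ℝ) : ℂ) = ((‖A‖ ^ 2 : ℝ) : ℂ) := by
    rw [frobenius_norm_sq_eq_trace, frobenius_norm_sq_eq_trace]
    simp only [Matrix.conjTranspose_mul, Matrix.conjTranspose_conjTranspose]
    rw [Matrix.trace_mul_comm]
    simp only [Matrix.mul_assoc]
    rw [Matrix.trace_mul_comm]
    simp only [Matrix.mul_assoc, hV', Matrix.mul_one]
    rw [← Matrix.mul_assoc V.conjTranspose V, hV', Matrix.one_mul, Matrix.trace_mul_comm]
  exact (sq_eq_sq₀ (norm_nonneg _) (norm_nonneg _)).mp (by exact_mod_cast h)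

section TraceNorm

variable {n : Type*} [Fintype n] [DecidableEq n] (A : Matrix n n ℂ)

theorem sum_eigenvalues_eq_frobenius_norm_sq :
    ∑ i, (Matrix.isHermitian_conjTranspose_mul_self A).eigenvalues i = ‖A‖ ^ 2 := by
  have h := (Matrix.isHermitian_conjTranspose_mul_self A).trace_eq_sum_eigenvalues
  rw [← frobenius_norm_sq_eq_trace] at h
  apply Complex.ofReal_injective
  rw [h]
  push_cast
  rfl

theorem eigenvalues_conjTranspose_mul_self_nonneg (i : n) :
    0 ≤ (Matrix.isHermitian_conjTranspose_mul_self A).eigenvalues i :=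
  (Matrix.posSemidef_conjTranspose_mul_self A).eigenvalues_nonneg i

theorem traceNorm_nonneg : 0 ≤ traceNorm A := Finset.sum_nonneg fun _ _ => Real.sqrt_nonneg _

theorem frobenius_norm_le_traceNorm : ‖A‖ ≤ traceNorm A := by
  refine (sq_le_sq₀ (norm_nonneg A) (traceNorm_nonneg A)).mp ?_
  rw [← sum_eigenvalues_eq_frobenius_norm_sq]
  refine le_trans (le_of_eq ?_)
    (Finset.sum_sq_le_sq_sum_of_nonneg fun i _ => Real.sqrt_nonneg _)
  exact Finset.sum_congr rfl fun i _ =>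
    (Real.sq_sqrt (eigenvalues_conjTranspose_mul_self_nonneg A i)).symm

theorem traceNorm_le : traceNorm A ≤ √(Fintype.card n) * ‖A‖ := by
  refine (sq_le_sq₀ (traceNorm_nonneg A) (by positivity)).mp ?_
  rw [mul_pow, Real.sq_sqrt (Nat.cast_nonneg _), ← sum_eigenvalues_eq_frobenius_norm_sq]
  refine (sq_sum_le_card_mul_sum_sq (s := Finset.univ)).trans (le_of_eq ?_)
  rw [Finset.card_univ]
  congr 1
  exact Finset.sum_congr rfl fun i _ =>
    Real.sq_sqrt (eigenvalues_conjTranspose_mul_self_nonneg A i)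

end TraceNorm

/-! ### One-qubit channels -/

/-- Traceless Hermitian operators of one qubit; a state of Bloch vector `r` is `1/2 + X` with
`X = (r · σ) / 2`, so that `√2 * ‖X‖ = |r|` for the Frobenius norm. -/
def IsBloch (X : Matrix (Fin 2) (Fin 2) ℂ) : Prop := X.IsHermitian ∧ X.trace = 0

theorem IsBloch.sub {X Y : Matrix (Fin 2) (Fin 2) ℂ} (hX : IsBloch X) (hY : IsBloch Y) :
    IsBloch (X - Y) :=
  ⟨hX.1.sub hY.1, by rw [Matrix.trace_sub, hX.2, hY.2, sub_zero]⟩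

theorem isBloch_smul_pauli (u : ℝ) : IsBloch ((u : ℂ) • pauli 3) := by
  constructor
  · ext i j
    fin_cases i <;> fin_cases j <;> simp [pauli]
  · simp [pauli, Matrix.trace_fin_two]

theorem norm_pauli : ‖pauli 3‖ = √2 := by
  rw [eq_comm, Real.sqrt_eq_iff_mul_self_eq (by norm_num) (norm_nonneg _), ← sq, frobenius_norm_sq]
  simp [pauli, Fin.sum_univ_two]
  norm_num

theorem pauli_one_mem_unitaryGroup : pauli 1 ∈ Matrix.unitaryGroup (Fin 2) ℂ := by
  rw [Matrix.mem_unitaryGroup_iff, Matrix.star_eq_conjTranspose]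
  ext i j
  fin_cases i <;> fin_cases j <;> simp [pauli, Matrix.mul_apply, Fin.sum_univ_two]

/-- A rotation that turns the Bloch vector to the north pole. -/
theorem IsBloch.exists_align {X : Matrix (Fin 2) (Fin 2) ℂ} (hX : IsBloch X) :
    ∃ V ∈ Matrix.unitaryGroup (Fin 2) ℂ,
      V * X * V.conjTranspose = ((√2 * ‖X‖ / 2 : ℝ) : ℂ) • pauli 3 := by
  have hdiag := hX.1.conjStarAlgAut_star_eigenvectorUnitary
  rw [Unitary.conjStarAlgAut_apply] at hdiag
  set U : Matrix (Fin 2) (Fin 2) ℂ :=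
    ((star hX.1.eigenvectorUnitary : Matrix.unitaryGroup (Fin 2) ℂ) : Matrix (Fin 2) (Fin 2) ℂ)
  have hUmem : U ∈ Matrix.unitaryGroup (Fin 2) ℂ := (star hX.1.eigenvectorUnitary).2
  have hdiag' : U * X * U.conjTranspose = Matrix.diagonal (RCLike.ofReal ∘ hX.1.eigenvalues) := by
    rw [← hdiag]
    rfl
  have htr := hX.2.symm.trans hX.1.trace_eq_sum_eigenvalues
  rw [Fin.sum_univ_two] at htr
  have hsum : hX.1.eigenvalues 0 + hX.1.eigenvalues 1 = 0 := by
    apply Complex.ofReal_injective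
    push_cast
    exact htr.symm
  set l := hX.1.eigenvalues 0
  have h1 : hX.1.eigenvalues 1 = -l := by linarith
  have hZ : U * X * U.conjTranspose = (l : ℂ) • pauli 3 := by
    rw [hdiag']
    ext i j
    fin_cases i <;> fin_cases j <;> simp [pauli, l, h1]
  have hnorm : |l| * √2 = ‖X‖ := by
    rw [← frobenius_norm_conj hUmem X, hZ, norm_smul, norm_pauli, Complex.norm_real,
      Real.norm_eq_abs]
  have hl : √2 * ‖X‖ / 2 = |l| := by
    rw [← hnorm]
    have := Real.mul_self_sqrt (show (0 : ℝ) ≤ 2 by norm_num)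
    linear_combination |l| / 2 * this
  rw [hl]
  rcases le_or_gt 0 l with h | h
  · exact ⟨U, hUmem, by rw [hZ, abs_of_nonneg h]⟩
  · refine ⟨pauli 1 * U, mul_mem pauli_one_mem_unitaryGroup hUmem, ?_⟩
    have : pauli 1 * U * X * (pauli 1 * U).conjTranspose =
        pauli 1 * (U * X * U.conjTranspose) * (pauli 1).conjTranspose := by
      rw [Matrix.conjTranspose_mul]
      simp only [Matrix.mul_assoc]
    rw [this, hZ, abs_of_neg h]
    ext i j
    fin_cases i <;> fin_cases j <;> simp [pauli, Matrix.mul_apply, Fin.sum_univ_two]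

theorem IsBloch.traceNorm {X : Matrix (Fin 2) (Fin 2) ℂ} (hX : IsBloch X) :
    traceNorm X = √2 * ‖X‖ := by
  have hH := Matrix.isHermitian_conjTranspose_mul_self X
  obtain ⟨V, hV, hVX⟩ := hX.exists_align
  obtain ⟨s, hs⟩ : ∃ s, s = √2 * ‖X‖ / 2 := ⟨_, rfl⟩
  rw [← hs] at hVX
  have hV' : V.conjTranspose * V = 1 := Matrix.mem_unitaryGroup_iff'.mp hV
  have hVV : V * V.conjTranspose = 1 := Matrix.mem_unitaryGroup_iff.mp hV
  have hXV : X = V.conjTranspose * ((s : ℂ) • pauli 3) * V := by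
    rw [← hVX]
    simp only [Matrix.mul_assoc]
    rw [hV', Matrix.mul_one, ← Matrix.mul_assoc, hV', Matrix.one_mul]
  have hZ : pauli 3 * pauli 3 = 1 := by
    ext i j
    fin_cases i <;> fin_cases j <;> simp [pauli]
  have hsq : X.conjTranspose * X = ((s ^ 2 : ℝ) : ℂ) • 1 := by
    rw [hX.1]
    calc X * X = V.conjTranspose * ((s : ℂ) • pauli 3) * V *
          (V.conjTranspose * ((s : ℂ) • pauli 3) * V) := by rw [← hXV]
      _ = V.conjTranspose * ((s : ℂ) • pauli 3) * (V * V.conjTranspose) *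
          ((s : ℂ) • pauli 3) * V := by simp only [Matrix.mul_assoc]
      _ = ((s ^ 2 : ℝ) : ℂ) • (V.conjTranspose * (pauli 3 * pauli 3) * V) := by
          rw [hVV]
          simp only [Matrix.mul_one, Matrix.mul_smul, Matrix.smul_mul, smul_smul, Matrix.mul_assoc]
          congr 1
          push_cast
          ring
      _ = _ := by rw [hZ, Matrix.mul_one, hV']
  -- trace and determinant of `X² = s² • 1` show that both eigenvalues are `s²`
  have htr := (congrArg Matrix.trace hsq).symm.trans hH.trace_eq_sum_eigenvalues
  have hdet := (congrArg Matrix.det hsq).symm.trans hH.det_eq_prod_eigenvalues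
  rw [Fin.sum_univ_two, Matrix.trace_smul, Matrix.trace_one] at htr
  rw [Fin.prod_univ_two, Matrix.det_smul, Matrix.det_one, mul_one, Fintype.card_fin] at hdet
  have hs0 : 0 ≤ s := by rw [hs]; positivity
  have e1 : s ^ 2 * 2 = hH.eigenvalues 0 + hH.eigenvalues 1 := by
    apply Complex.ofReal_injective
    push_cast
    simpa using htr
  have e2 : (s ^ 2) ^ 2 = hH.eigenvalues 0 * hH.eigenvalues 1 := by
    apply Complex.ofReal_injective
    push_cast
    simpa using hdet
  have e3 : (hH.eigenvalues 0 - hH.eigenvalues 1) ^ 2 = 0 := by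
    linear_combination (-(hH.eigenvalues 0 + hH.eigenvalues 1) - 2 * s ^ 2) * e1 + 4 * e2
  have e4 : hH.eigenvalues 0 = hH.eigenvalues 1 :=
    sub_eq_zero.mp (pow_eq_zero_iff two_ne_zero |>.mp e3)
  have e5 : hH.eigenvalues 1 = s ^ 2 := by linarith
  have : _root_.traceNorm X = √(hH.eigenvalues 0) + √(hH.eigenvalues 1) := Fin.sum_univ_two _
  rw [this, e4, e5, Real.sqrt_sq hs0, hs]
  ring

/-- Linear maps on matrices are bounded. -/
theorem exists_norm_apply_le {n E : Type*} [Fintype n] [DecidableEq n] [NormedAddCommGroup E]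
    [NormedSpace ℂ E] (f : Matrix n n ℂ →ₗ[ℂ] E) : ∃ C, 0 ≤ C ∧ ∀ X, ‖f X‖ ≤ C * ‖X‖ := by
  refine ⟨∑ i, ∑ j, ‖f (Matrix.single i j 1)‖, Finset.sum_nonneg fun i _ =>
    Finset.sum_nonneg fun j _ => norm_nonneg _, fun X => ?_⟩
  have hX : f X = ∑ i, ∑ j, X i j • f (Matrix.single i j 1) := by
    conv_lhs => rw [Matrix.matrix_eq_sum_single X]
    simp only [map_sum]
    refine Finset.sum_congr rfl fun i _ => Finset.sum_congr rfl fun j _ => ?_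
    rw [← map_smul, Matrix.smul_single, smul_eq_mul, mul_one]
  rw [hX, Finset.sum_mul]
  refine norm_sum_le_of_le _ fun i _ => ?_
  rw [Finset.sum_mul]
  refine norm_sum_le_of_le _ fun j _ => ?_
  rw [norm_smul, mul_comm]
  exact mul_le_mul_of_nonneg_left (norm_entry_le_frobenius_norm X i j) (norm_nonneg _)

/-- The noise strength bounds the distance of a channel from the identity, also in the Frobenius
norm: an operator of one qubit is embedded as `X ⊗ |0⟩⟨0|`. -/
theorem norm_apply_sub_le (N : SuperOp) (X : Matrix (Fin 2) (Fin 2) ℂ) :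
    ‖N X - X‖ ≤ 2 * noiseStrength N * ‖X‖ := by
  set D : SuperOp := N - LinearMap.id with hD
  have hbdd : BddAbove {r | ∃ X : Matrix (Fin 2 × Fin 2) (Fin 2 × Fin 2) ℂ,
      traceNorm X ≤ 1 ∧ r = traceNorm (ampliation D 2 X)} := by
    let F : Matrix (Fin 2 × Fin 2) (Fin 2 × Fin 2) ℂ →ₗ[ℂ]
        Matrix (Fin 2 × Fin 2) (Fin 2 × Fin 2) ℂ :=
      { toFun := ampliation D 2
        map_add' := by
          intro X Y
          ext x y
          simp only [ampliation, Matrix.of_apply, Matrix.add_apply]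
          rw [← Matrix.add_apply, ← map_add]
          rfl
        map_smul' := by
          intro c X
          ext x y
          simp only [ampliation, Matrix.of_apply, Matrix.smul_apply, RingHom.id_apply]
          rw [← Matrix.smul_apply, ← map_smul]
          rfl }
    obtain ⟨C, hC, hF⟩ := exists_norm_apply_le F
    refine ⟨√(Fintype.card (Fin 2 × Fin 2)) * C, ?_⟩
    rintro r ⟨X, hX, rfl⟩
    refine (traceNorm_le _).trans ?_
    refine mul_le_mul_of_nonneg_left ((hF X).trans ?_) (Real.sqrt_nonneg _)
    exact mul_le_of_le_one_right hC ((frobenius_norm_le_traceNorm X).trans hX)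
  let E : Matrix (Fin 2) (Fin 2) ℂ → Matrix (Fin 2 × Fin 2) (Fin 2 × Fin 2) ℂ := fun X =>
    Matrix.of fun x y => if x.2 = 0 ∧ y.2 = 0 then X x.1 y.1 else 0
  have hE : ∀ X, ‖E X‖ = ‖X‖ := by
    intro X
    refine (sq_eq_sq₀ (norm_nonneg _) (norm_nonneg _)).mp ?_
    rw [frobenius_norm_sq, frobenius_norm_sq]
    simp [E, Fintype.sum_prod_type, Fin.sum_univ_two]
  have hED : ∀ X, ampliation D 2 (E X) = E (D X) := by
    intro X
    ext x y
    simp only [ampliation, E, Matrix.of_apply]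
    split_ifs with h
    · rfl
    · have : (Matrix.of fun _ _ => (0 : ℂ) : Matrix (Fin 2) (Fin 2) ℂ) = 0 := rfl
      rw [this, map_zero]
      rfl
  have hcard : √(Fintype.card (Fin 2 × Fin 2) : ℝ) = 2 := by
    rw [Fintype.card_prod, Fintype.card_fin]
    rw [show ((2 * 2 : ℕ) : ℝ) = 2 ^ 2 by norm_num]
    exact Real.sqrt_sq (by norm_num)
  have hunit : ∀ X : Matrix (Fin 2) (Fin 2) ℂ, ‖X‖ ≤ 1 / 2 → ‖D X‖ ≤ noiseStrength N := by
    intro X hX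
    rw [← hE, ← hED]
    refine (frobenius_norm_le_traceNorm _).trans (le_csSup hbdd ⟨E X, ?_, rfl⟩)
    refine (traceNorm_le _).trans ?_
    rw [hcard, hE]
    linarith
  rcases eq_or_ne X 0 with rfl | hX0
  · simp
  have hpos : 0 < ‖X‖ := norm_pos_iff.mpr hX0
  have h := hunit (((2 * ‖X‖)⁻¹ : ℝ) • X) (by
    rw [norm_smul, Real.norm_of_nonneg (by positivity), mul_inv, mul_assoc,
      inv_mul_cancel₀ hpos.ne']
    norm_num)
  have h2 : D (((2 * ‖X‖)⁻¹ : ℝ) • X) = ((2 * ‖X‖)⁻¹ : ℝ) • D X := by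
    rw [← Complex.coe_smul, map_smul, Complex.coe_smul]
  rw [h2, norm_smul, Real.norm_of_nonneg (by positivity), inv_mul_le_iff₀ (by positivity)] at h
  calc ‖N X - X‖ = ‖D X‖ := rfl
    _ ≤ _ := by linarith

theorem noiseStrength_nonneg (N : SuperOp) : 0 ≤ noiseStrength N := by
  have h := norm_apply_sub_le N 1
  have h1 : (0 : ℝ) < ‖(1 : Matrix (Fin 2) (Fin 2) ℂ)‖ := norm_pos_iff.mpr one_ne_zero
  have h2 := (norm_nonneg _).trans h
  by_contra! hc
  nlinarith [mul_pos_of_neg_of_neg hc (neg_neg_of_pos h1)]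

theorem posSemidef_apply {N : SuperOp} (hN : IsCPTP N) {X : Matrix (Fin 2) (Fin 2) ℂ}
    (hX : X.PosSemidef) : (N X).PosSemidef := by
  have h := (hN.1 1 (X.submatrix Prod.fst Prod.fst) (hX.submatrix _)).submatrix
    (fun i : Fin 2 => (i, (0 : Fin 1)))
  exact h

/-- Positive maps commute with the adjoint. -/
theorem apply_conjTranspose {N : SuperOp} (hN : IsCPTP N) (X : Matrix (Fin 2) (Fin 2) ℂ) :
    N X.conjTranspose = (N X).conjTranspose := by
  let P : (Fin 2 → ℂ) → Matrix (Fin 2) (Fin 2) ℂ := fun v => Matrix.vecMulVec v (star v)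
  have hP : ∀ v, (N (P v)).conjTranspose = N (P v) := fun v =>
    (posSemidef_apply hN (Matrix.posSemidef_vecMulVec_self_star v)).1
  have hP' : ∀ v, (P v).conjTranspose = P v := fun v =>
    (Matrix.posSemidef_vecMulVec_self_star v).1
  -- the states on the axes of the Bloch sphere span all operators
  let c := (X 0 1 + X 1 0) / 2
  let e := Complex.I * (X 0 1 - X 1 0) / 2
  have hX : X = (X 0 0 - c - e) • P ![1, 0] + (X 1 1 - c - e) • P ![0, 1] + c • P ![1, 1] +
      e • P ![1, Complex.I] := by
    have hI := Complex.I_mul_I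
    ext i j
    simp only [P, c, e, Matrix.vecMulVec_apply, Matrix.add_apply, Matrix.smul_apply]
    fin_cases i <;> fin_cases j <;> simp
    · ring
    · linear_combination ((X 0 1 - X 1 0) / 2) * hI
    · linear_combination (-(X 0 1 - X 1 0) / 2) * hI
    · ring
  generalize X 0 0 - c - e = a at hX
  generalize X 1 1 - c - e = b at hX
  rw [hX]
  simp only [Matrix.conjTranspose_add, Matrix.conjTranspose_smul, map_add, map_smul, hP, hP']

theorem IsBloch.apply {N : SuperOp} (hN : IsCPTP N) {X : Matrix (Fin 2) (Fin 2) ℂ}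
    (hX : IsBloch X) : IsBloch (N X) := by
  refine ⟨?_, by rw [hN.2, hX.2]⟩
  rw [Matrix.IsHermitian, ← apply_conjTranspose hN, hX.1]

theorem IsBloch.iterate {N : SuperOp} (hN : IsCPTP N) {X : Matrix (Fin 2) (Fin 2) ℂ}
    (hX : IsBloch X) (n : ℕ) : IsBloch (N^[n] X) := by
  induction n with
  | zero => exact hX
  | succ n ih =>
    rw [Function.iterate_succ_apply']
    exact ih.apply hN

/-- Contraction of the distance of states is contraction of all Bloch vectors. -/
theorem IsContracting.norm_apply_le {N : SuperOp} (hN : IsCPTP N) {Δ : ℝ} (hΔ : IsContracting Δ N)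
    {X : Matrix (Fin 2) (Fin 2) ℂ} (hX : IsBloch X) :
    ‖N X‖ ≤ (1 - Δ * noiseStrength N) * ‖X‖ := by
  obtain ⟨V, hV, hVX⟩ := hX.exists_align
  have hV' : V.conjTranspose * V = 1 := Matrix.mem_unitaryGroup_iff'.mp hV
  have hVV : V * V.conjTranspose = 1 := Matrix.mem_unitaryGroup_iff.mp hV
  -- `X` is a multiple of the difference of two orthogonal pure states
  let ρ : Fin 2 → Matrix (Fin 2) (Fin 2) ℂ := fun i =>
    V.conjTranspose * Matrix.single i i 1 * V
  have hρ : ∀ i, IsDensity (ρ i) := by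
    intro i
    constructor
    · have h1 : (Matrix.single i i (1 : ℂ)).PosSemidef := by
        have := Matrix.posSemidef_vecMulVec_self_star (Pi.single i (1 : ℂ) : Fin 2 → ℂ)
        convert this using 1
        ext j k
        fin_cases i <;> fin_cases j <;> fin_cases k <;> simp [Matrix.vecMulVec_apply]
      exact h1.conjTranspose_mul_mul_same V
    · simp only [ρ]
      rw [Matrix.trace_mul_comm, ← Matrix.mul_assoc, hVV, Matrix.one_mul]
      simp
  have hdiff : X = ((√2 * ‖X‖ / 2 : ℝ) : ℂ) • (ρ 0 - ρ 1) := by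
    have h1 : ρ 0 - ρ 1 = V.conjTranspose * pauli 3 * V := by
      simp only [ρ]
      rw [← Matrix.sub_mul, ← Matrix.mul_sub]
      congr 2
      ext i j
      fin_cases i <;> fin_cases j <;> simp [pauli]
    rw [h1, ← Matrix.smul_mul, ← Matrix.mul_smul, ← hVX]
    simp only [Matrix.mul_assoc]
    rw [hV', Matrix.mul_one, ← Matrix.mul_assoc, hV', Matrix.one_mul]
  have hb : IsBloch (ρ 0 - ρ 1) :=
    ⟨(hρ 0).1.1.sub (hρ 1).1.1, by rw [Matrix.trace_sub, (hρ 0).2, (hρ 1).2, sub_self]⟩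
  have h := hΔ _ _ (hρ 0) (hρ 1)
  rw [hb.traceNorm, (hb.apply hN).traceNorm] at h
  have h2 : ‖N (ρ 0 - ρ 1)‖ ≤ (1 - Δ * noiseStrength N) * ‖ρ 0 - ρ 1‖ := by
    have hpos : (0 : ℝ) < √2 := by positivity
    refine le_of_mul_le_mul_left ?_ hpos
    linarith
  generalize √2 * ‖X‖ / 2 = s at hdiff
  rw [hdiff, map_smul, norm_smul, norm_smul]
  calc _ ≤ ‖(s : ℂ)‖ * ((1 - Δ * noiseStrength N) * ‖ρ 0 - ρ 1‖) := by gcongr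
    _ = _ := by ring

end OneQubit

/-! ### Noise on a trio of qubits -/

section BlockNoise

open scoped Matrix.Norms.Frobenius

theorem frobenius_norm_le_of_entries {n : Type*} [Fintype n] (A : Matrix n n ℂ) {M : ℝ}
    (hM : 0 ≤ M) (h : ∀ i j, ‖A i j‖ ≤ M) : ‖A‖ ≤ Fintype.card n * M := by
  refine (sq_le_sq₀ (norm_nonneg _) (by positivity)).mp ?_
  rw [frobenius_norm_sq]
  calc ∑ i, ∑ j, ‖A i j‖ ^ 2 ≤ ∑ _i : n, ∑ _j : n, M ^ 2 := by
        gcongr with i _ j _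
        exact h i j
    _ = _ := by simp only [Finset.sum_const, Finset.card_univ, nsmul_eq_mul]; ring

/-- The constant is `7 = 2 * 2 + 2 + 1`, from a telescoping sum in which `‖a i‖ ≤ 2`. -/
theorem norm_mul_three_sub_le {a b : Fin 3 → ℂ} {δ : ℝ} (hδ : δ ≤ 1) (hb : ∀ i, ‖b i‖ ≤ 1)
    (hab : ∀ i, ‖a i - b i‖ ≤ δ) : ‖a 0 * a 1 * a 2 - b 0 * b 1 * b 2‖ ≤ 7 * δ := by
  have hδ0 : 0 ≤ δ := (norm_nonneg _).trans (hab 0)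
  have ha : ∀ i, ‖a i‖ ≤ 2 := fun i => by
    calc ‖a i‖ = ‖(a i - b i) + b i‖ := by rw [sub_add_cancel]
      _ ≤ ‖a i - b i‖ + ‖b i‖ := norm_add_le _ _
      _ ≤ 2 := by linarith [hab i, hb i]
  have h : a 0 * a 1 * a 2 - b 0 * b 1 * b 2 =
      (a 0 - b 0) * a 1 * a 2 + b 0 * (a 1 - b 1) * a 2 + b 0 * b 1 * (a 2 - b 2) := by ring
  rw [h]
  refine (norm_add₃_le).trans ?_
  simp only [norm_mul]
  have h1 : ‖a 0 - b 0‖ * ‖a 1‖ * ‖a 2‖ ≤ δ * 2 * 2 := by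
    gcongr
    exacts [hab 0, ha 1, ha 2]
  have h2 : ‖b 0‖ * ‖a 1 - b 1‖ * ‖a 2‖ ≤ 1 * δ * 2 := by
    gcongr
    exacts [hb 0, hab 1, ha 2]
  have h3 : ‖b 0‖ * ‖b 1‖ * ‖a 2 - b 2‖ ≤ 1 * 1 * δ := by
    gcongr
    exacts [hb 0, hb 1, hab 2]
  linarith

theorem card_three_qubits : (Fintype.card (Fin 3 → Fin 2) : ℝ) = 8 := by
  rw [Fintype.card_fun, Fintype.card_fin, Fintype.card_fin]
  norm_num

/-- Product operators on three qubits depend continuously on their factors: a bound on all `8 * 8`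
entries, each of which is a product of three numbers. -/
theorem norm_tensorOp_sub_le {A B : Fin 3 → Matrix (Fin 2) (Fin 2) ℂ} {δ : ℝ} (hδ : δ ≤ 1)
    (hB : ∀ q i j, ‖B q i j‖ ≤ 1) (hAB : ∀ q, ‖A q - B q‖ ≤ δ) :
    ‖tensorOp A - tensorOp B‖ ≤ 56 * δ := by
  have hδ0 : 0 ≤ δ := (norm_nonneg _).trans (hAB 0)
  refine (frobenius_norm_le_of_entries (M := 7 * δ) _ (by positivity) fun x y => ?_).trans ?_
  · rw [Matrix.sub_apply, tensorOp_apply, tensorOp_apply, Fin.prod_univ_three, Fin.prod_univ_three]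
    exact norm_mul_three_sub_le (a := fun q => A q (x q) (y q)) (b := fun q => B q (x q) (y q)) hδ
      (fun q => hB q _ _) fun q => (norm_entry_le_frobenius_norm (A q - B q) _ _).trans (hAB q)
  · rw [card_three_qubits]
    linarith

theorem norm_noiseLayer_sub_le {N : SuperOp} (hκ : noiseStrength N ≤ 1 / 2) (X : RegOp (Fin 3)) :
    ‖noiseLayer N X - X‖ ≤ 7168 * noiseStrength N * ‖X‖ := by
  have hsingle : ∀ i j : Fin 2, ‖(Matrix.single i j 1 : Matrix (Fin 2) (Fin 2) ℂ)‖ = 1 := by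
    intro i j
    have h : ‖(Matrix.single i j 1 : Matrix (Fin 2) (Fin 2) ℂ)‖ ^ 2 = 1 := by
      rw [frobenius_norm_sq]
      fin_cases i <;> fin_cases j <;> simp [Fin.sum_univ_two, Matrix.single_apply]
    exact (pow_eq_one_iff_of_nonneg (norm_nonneg _) two_ne_zero).mp h
  have h : noiseLayer N X - X = ∑ a, ∑ b, X a b •
      ((tensorOp fun q => N (Matrix.single (a q) (b q) 1)) -
        tensorOp fun q => Matrix.single (a q) (b q) 1) := by
    simp only [smul_sub, Finset.sum_sub_distrib]
    congr 1
    conv_lhs => rw [Matrix.matrix_eq_sum_single X]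
    refine Finset.sum_congr rfl fun a _ => Finset.sum_congr rfl fun b _ => ?_
    rw [← single_eq_tensorOp, Matrix.smul_single, smul_eq_mul, mul_one]
  have hterm : ∀ a b, ‖X a b • ((tensorOp fun q => N (Matrix.single (a q) (b q) 1)) -
      tensorOp fun q => Matrix.single (a q) (b q) 1)‖ ≤ ‖X‖ * (56 * (2 * noiseStrength N)) := by
    intro a b
    rw [norm_smul]
    refine mul_le_mul (norm_entry_le_frobenius_norm X a b) ?_ (norm_nonneg _) (norm_nonneg _)
    refine norm_tensorOp_sub_le (by linarith) (fun q i j => ?_) fun q => ?_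
    · exact (norm_entry_le_frobenius_norm _ i j).trans (hsingle _ _).le
    · refine (norm_apply_sub_le N _).trans ?_
      rw [hsingle, mul_one]
  rw [h]
  calc _ ≤ ∑ _a : Fin 3 → Fin 2, ∑ _b : Fin 3 → Fin 2, ‖X‖ * (56 * (2 * noiseStrength N)) :=
        norm_sum_le_of_le _ fun a _ => norm_sum_le_of_le _ fun b _ => hterm a b
    _ = _ := by
        simp only [Finset.sum_const, Finset.card_univ, nsmul_eq_mul, card_three_qubits]
        ring

/-- The effect of the noise on the maximally mixed state is of the order of its non-unital part. -/
theorem norm_noiseLayer_one_sub_le {N : SuperOp} (h : ‖N 1 - 1‖ ≤ 1) :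
    ‖noiseLayer N (1 : RegOp (Fin 3)) - 1‖ ≤ 56 * ‖N 1 - 1‖ := by
  rw [← tensorOp_one, noiseLayer_tensorOp]
  refine norm_tensorOp_sub_le h (fun q i j => ?_) fun q => le_rfl
  fin_cases i <;> fin_cases j <;> simp

theorem foldl_mul_eq (Vs : List (RegOp (Fin 3))) (W : RegOp (Fin 3)) :
    Vs.foldl (fun W V => V * W) W = Vs.foldl (fun W V => V * W) 1 * W := by
  induction Vs generalizing W with
  | nil => simp
  | cons V Vs ih => rw [List.foldl_cons, List.foldl_cons, ih, ih (V * 1), mul_one, mul_assoc]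

theorem foldl_mul_mem_unitaryGroup {Vs : List (RegOp (Fin 3))}
    (hVs : ∀ V ∈ Vs, V ∈ Matrix.unitaryGroup (Fin 3 → Fin 2) ℂ) :
    Vs.foldl (fun W V => V * W) 1 ∈ Matrix.unitaryGroup (Fin 3 → Fin 2) ℂ := by
  induction Vs with
  | nil => exact one_mem _
  | cons V Vs ih =>
    rw [List.foldl_cons, foldl_mul_eq, mul_one]
    exact mul_mem (ih fun V hV => hVs V (List.mem_cons_of_mem _ hV)) (hVs V List.mem_cons_self)

/-- Noise changes the result of a circuit only a little. The effect of the unital part of the noise,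
of relative size `a`, is proportional to the deviation `X` from the maximally mixed state, and the
effect of the rest is at most `b` in each layer. -/
theorem norm_blockRun_sub_le {N : SuperOp} {a b : ℝ} (ha0 : 0 ≤ a) (ha : a ≤ 1)
    (h1 : ∀ X : RegOp (Fin 3), ‖noiseLayer N X - X‖ ≤ a * ‖X‖)
    (h2 : ‖noiseLayer N (1 : RegOp (Fin 3)) - 1‖ ≤ b) (Vs : List (RegOp (Fin 3)))
    (hVs : ∀ V ∈ Vs, V ∈ Matrix.unitaryGroup (Fin 3 → Fin 2) ℂ) (X : RegOp (Fin 3)) :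
    ‖blockRun N Vs ((1 / 8 : ℂ) • 1 + X) - Vs.foldl (fun W V => V * W) 1 * ((1 / 8 : ℂ) • 1 + X) *
      (Vs.foldl (fun W V => V * W) 1).conjTranspose‖ ≤ (2 ^ Vs.length - 1) * (a * ‖X‖ + b) := by
  have hb : 0 ≤ b := (norm_nonneg _).trans h2
  induction Vs generalizing X with
  | nil =>
    simp only [blockRun, List.foldl_nil, Matrix.conjTranspose_one, Matrix.one_mul, Matrix.mul_one,
      sub_self, norm_zero, List.length_nil, pow_zero, zero_mul, le_refl]
  | cons V Vs ih =>
    have hV := hVs V List.mem_cons_self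
    have hVs' : ∀ V ∈ Vs, V ∈ Matrix.unitaryGroup (Fin 3 → Fin 2) ℂ :=
      fun V hV => hVs V (List.mem_cons_of_mem _ hV)
    have hU := foldl_mul_mem_unitaryGroup hVs'
    rw [List.foldl_cons, foldl_mul_eq, mul_one]
    set U := Vs.foldl (fun W V => V * W) 1
    set Y := V * X * V.conjTranspose with hY
    have hVV : V * V.conjTranspose = 1 := Matrix.mem_unitaryGroup_iff.mp hV
    have hYn : ‖Y‖ = ‖X‖ := frobenius_norm_conj hV X
    set R := (1 / 8 : ℂ) • (noiseLayer N (1 : RegOp (Fin 3)) - 1) + (noiseLayer N Y - Y) with hR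
    have hRn : ‖R‖ ≤ a * ‖X‖ + b := by
      refine (norm_add_le _ _).trans ?_
      rw [norm_smul]
      have h3 : ‖(1 / 8 : ℂ)‖ ≤ 1 := by norm_num
      have h4 := h1 Y
      rw [hYn] at h4
      have h5 := mul_le_mul h3 h2 (norm_nonneg _) zero_le_one
      linarith
    have hconj : V * ((1 / 8 : ℂ) • 1 + X) * V.conjTranspose = (1 / 8 : ℂ) • 1 + Y := by
      rw [Matrix.mul_add, Matrix.add_mul, Matrix.mul_smul, Matrix.smul_mul, Matrix.mul_one, hVV]
    have hstep : blockRun N (V :: Vs) ((1 / 8 : ℂ) • 1 + X) =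
        blockRun N Vs ((1 / 8 : ℂ) • 1 + (Y + R)) := by
      change blockRun N Vs (noiseLayer N (V * ((1 / 8 : ℂ) • 1 + X) * V.conjTranspose)) = _
      rw [hconj, ← noiseLin_apply, map_add, map_smul, noiseLin_apply, noiseLin_apply, hR, smul_sub]
      congr 1
      abel
    have hsplit : blockRun N Vs ((1 / 8 : ℂ) • 1 + (Y + R)) -
        U * V * ((1 / 8 : ℂ) • 1 + X) * (U * V).conjTranspose =
        (blockRun N Vs ((1 / 8 : ℂ) • 1 + (Y + R)) -
          U * ((1 / 8 : ℂ) • 1 + (Y + R)) * U.conjTranspose) + U * R * U.conjTranspose := by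
      have : U * V * ((1 / 8 : ℂ) • 1 + X) * (U * V).conjTranspose =
          U * (V * ((1 / 8 : ℂ) • 1 + X) * V.conjTranspose) * U.conjTranspose := by
        rw [Matrix.conjTranspose_mul]
        simp only [Matrix.mul_assoc]
      rw [this, hconj, ← add_assoc, Matrix.mul_add U _ R, Matrix.add_mul]
      abel
    rw [hstep, hsplit]
    refine (norm_add_le _ _).trans ?_
    rw [frobenius_norm_conj hU]
    have h3 := ih hVs' (Y + R)
    have h4 : ‖Y + R‖ ≤ ‖X‖ + (a * ‖X‖ + b) :=
      (norm_add_le _ _).trans (by rw [hYn]; linarith)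
    have h5 : a * ‖Y + R‖ + b ≤ 2 * (a * ‖X‖ + b) := by
      have h6 := mul_le_mul_of_nonneg_left h4 ha0
      have h7 : a * (a * ‖X‖ + b) ≤ 1 * (a * ‖X‖ + b) :=
        mul_le_mul_of_nonneg_right ha (by positivity)
      linarith
    have h8 : (0 : ℝ) ≤ 2 ^ Vs.length - 1 := sub_nonneg.mpr (one_le_pow₀ one_le_two)
    have h9 := mul_le_mul_of_nonneg_left h5 h8
    rw [List.length_cons, pow_succ]
    linarith

end BlockNoise

/-! ### One cycle of the compressor -/

section Cycle

open scoped Matrix.Norms.Frobenius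

/-- The state `1/2 + (u/2) Z`, of polarization `u`. -/
noncomputable def zState (u : ℝ) : Matrix (Fin 2) (Fin 2) ℂ :=
  (1 / 2 : ℂ) • 1 + ((u / 2 : ℝ) : ℂ) • pauli 3

/-- The polarization of the majority of three independent bits of polarization `u`. -/
noncomputable def boost (u : ℝ) : ℝ := (3 * u - u ^ 3) / 2

/-- `headState` as a linear map. -/
def headLin : RegOp (Fin 3) →ₗ[ℂ] Matrix (Fin 2) (Fin 2) ℂ where
  toFun := headState
  map_add' β γ := by
    ext i j
    simp only [headState, Matrix.of_apply, Matrix.add_apply, Matrix.mul_add, Matrix.trace_add]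
  map_smul' c β := by
    ext i j
    simp only [headState, Matrix.of_apply, Matrix.smul_apply, Matrix.mul_smul, Matrix.trace_smul,
      RingHom.id_apply]

theorem headLin_apply (β : RegOp (Fin 3)) : headLin β = headState β := rfl

/-- The elementary compressor as an operator on three qubits. -/
def trioOp : RegOp (Fin 3) := Matrix.of fun x y => if x = compressorMap y then 1 else 0

theorem sum_three_bits (F : (Fin 3 → Fin 2) → ℂ) :
    ∑ x, F x = ∑ a, ∑ b, ∑ c, F ![a, b, c] := by
  rw [← (Fin.consEquiv fun _ => Fin 2).sum_comp, Fintype.sum_prod_type]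
  refine Finset.sum_congr rfl fun a _ => ?_
  rw [← (Fin.consEquiv fun _ => Fin 2).sum_comp, Fintype.sum_prod_type]
  refine Finset.sum_congr rfl fun b _ => ?_
  rw [← (Fin.consEquiv fun _ => Fin 2).sum_comp, Fintype.sum_prod_type]
  refine Finset.sum_congr rfl fun c _ => ?_
  rw [Fintype.sum_unique]
  congr 1

/-- The first output bit of the compressor is the majority of its input bits. -/
theorem headState_trioOp (u : ℝ) :
    headState (trioOp * (tensorOp fun _ => zState u) * trioOp.conjTranspose) =
      zState (boost u) := by
  have hinj : Function.Injective compressorMap := by decide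
  let p : Fin 2 → ℂ := ![(1 + u) / 2, (1 - u) / 2]
  have hz : zState u = Matrix.diagonal p := by
    ext i j
    fin_cases i <;> fin_cases j <;> simp [zState, pauli, p] <;> ring
  have hσ : (tensorOp fun _ : Fin 3 => zState u) = Matrix.diagonal fun x => ∏ q, p (x q) := by
    ext x y
    rw [tensorOp_apply, hz]
    by_cases h : x = y
    · subst h
      simp
    · obtain ⟨q, hq⟩ := Function.ne_iff.mp h
      rw [Matrix.diagonal_apply_ne _ h]
      exact Finset.prod_eq_zero (Finset.mem_univ q) (Matrix.diagonal_apply_ne _ hq)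
  refine Matrix.ext_iff_trace_mul_left.mpr fun A => ?_
  rw [trace_mul_headState, ← Matrix.mul_assoc, ← Matrix.mul_assoc, Matrix.trace_mul_comm,
    ← Matrix.mul_assoc, ← Matrix.mul_assoc, hσ]
  have hconj : ∀ x, (trioOp.conjTranspose * tensorOp (Function.update 1 0 A) * trioOp : RegOp _)
      x x =
      A (compressorMap x 0) (compressorMap x 0) := by
    intro x
    simp only [Matrix.mul_apply, trioOp, Matrix.conjTranspose_apply, Matrix.of_apply, mul_ite,
      mul_one, mul_zero, Finset.sum_ite_eq', Finset.mem_univ, if_true, apply_ite star, star_one,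
      star_zero, ite_mul, one_mul, zero_mul]
    rw [tensorOp_apply, Fin.prod_univ_three]
    simp
  rw [Matrix.trace]
  simp only [Matrix.diag_apply, Matrix.mul_diagonal]
  simp only [hconj]
  rw [sum_three_bits]
  simp only [Fin.sum_univ_two, Fin.prod_univ_three, compressorMap, p, zState, boost, pauli,
    Matrix.trace_fin_two, Matrix.mul_apply]
  simp
  ring

/-- A channel that does not lengthen Bloch vectors and fixes the state `1/2 + S`. -/
structure IsNoise (N : SuperOp) (S : Matrix (Fin 2) (Fin 2) ℂ) : Prop where
  cptp : IsCPTP N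
  norm_le : ∀ X, IsBloch X → ‖N X‖ ≤ ‖X‖
  bloch : IsBloch S
  fixed : N ((1 / 2 : ℂ) • 1 + S) = (1 / 2 : ℂ) • 1 + S

theorem IsBloch.add {X Y : Matrix (Fin 2) (Fin 2) ℂ} (hX : IsBloch X) (hY : IsBloch Y) :
    IsBloch (X + Y) :=
  ⟨hX.1.add hY.1, by rw [Matrix.trace_add, hX.2, hY.2, add_zero]⟩

variable {N : SuperOp} {S : Matrix (Fin 2) (Fin 2) ℂ}

/-- The noise acts linearly on the deviation of the Bloch vector from that of the fixed state. -/
theorem IsNoise.iterate_apply (h : IsNoise N S) (X : Matrix (Fin 2) (Fin 2) ℂ) (n : ℕ) :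
    N^[n] ((1 / 2 : ℂ) • 1 + X) = (1 / 2 : ℂ) • 1 + (S + N^[n] (X - S)) := by
  have h1 : (1 / 2 : ℂ) • (1 : Matrix (Fin 2) (Fin 2) ℂ) + X = ((1 / 2 : ℂ) • 1 + S) + (X - S) := by
    abel
  rw [h1, iterate_map_add, Function.iterate_fixed h.fixed, add_assoc]

theorem IsNoise.norm_iterate_sub_le (h : IsNoise N S) {X : Matrix (Fin 2) (Fin 2) ℂ}
    (hX : IsBloch X) (n : ℕ) : ‖N^[n] X - X‖ ≤ n * (2 * noiseStrength N * ‖X‖) := by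
  induction n with
  | zero => simp
  | succ n ih =>
    have h1 : ‖N^[n] (N X - X)‖ ≤ ‖N X - X‖ := by
      have hB : IsBloch (N X - X) := (hX.apply h.cptp).sub hX
      clear ih
      induction n with
      | zero => exact le_rfl
      | succ n ih =>
        rw [Function.iterate_succ_apply']
        exact (h.norm_le _ (hB.iterate h.cptp n)).trans ih
    have h2 : N^[n + 1] X - X = N^[n] (N X - X) + (N^[n] X - X) := by
      rw [iterate_map_sub, Function.iterate_succ_apply]
      abel
    rw [h2]
    refine (norm_add_le _ _).trans ?_
    have h3 := norm_apply_sub_le N X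
    push_cast
    linarith

/-- The noise is unital up to a defect proportional to the Bloch vector of its fixed state. -/
theorem IsNoise.norm_apply_one_sub_le (h : IsNoise N S) :
    ‖N 1 - 1‖ ≤ 4 * noiseStrength N * ‖S‖ := by
  have h1 : N 1 - 1 = (-2 : ℂ) • (N S - S) := by
    have h2 := h.fixed
    rw [map_add, map_smul] at h2
    have h3 : (1 / 2 : ℂ) • N 1 = (1 / 2 : ℂ) • 1 + S - N S := eq_sub_of_add_eq h2
    have h4 : N 1 = (2 : ℂ) • ((1 / 2 : ℂ) • N 1) := by
      rw [smul_smul]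
      norm_num
    rw [h4, h3, smul_sub, smul_add, smul_smul]
    norm_num [smul_sub]
    module
  rw [h1, norm_smul]
  have h2 := norm_apply_sub_le N S
  have h3 : ‖(-2 : ℂ)‖ = 2 := by simp
  rw [h3]
  linarith

theorem headState_sub (β γ : RegOp (Fin 3)) : headState (β - γ) = headState β - headState γ :=
  map_sub headLin β γ

theorem trace_headState (β : RegOp (Fin 3)) : (headState β).trace = β.trace := by
  have h := trace_mul_headState 1 β
  rwa [Matrix.one_mul, ← Pi.one_apply (M := fun _ : Fin 3 => Matrix (Fin 2) (Fin 2) ℂ) 0,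
    Function.update_eq_self, show (tensorOp (1 : Fin 3 → Matrix (Fin 2) (Fin 2) ℂ)) = 1 from
      tensorOp_one, Matrix.one_mul] at h

theorem trace_noiseLayer (hN : ∀ X, (N X).trace = X.trace) {κ : Type} [Fintype κ] [DecidableEq κ]
    (β : RegOp κ) : (noiseLayer N β).trace = β.trace := by
  have h := trace_tensorOp_mul_noiseLayer N (fun _ => 1) β
  simpa [SuperOp.dual_one hN, tensorOp_one] using h

theorem noiseLayer_conjTranspose (hN : IsCPTP N) {κ : Type} [Fintype κ] [DecidableEq κ]
    (β : RegOp κ) : noiseLayer N β.conjTranspose = (noiseLayer N β).conjTranspose := by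
  simp only [noiseLayer, Matrix.conjTranspose_sum, Matrix.conjTranspose_smul,
    conjTranspose_tensorOp, ← apply_conjTranspose hN, Matrix.conjTranspose_single, star_one,
    Matrix.conjTranspose_apply]
  exact Finset.sum_comm

theorem isHermitian_headState {β : RegOp (Fin 3)} (hβ : β.IsHermitian) :
    (headState β).IsHermitian := by
  ext i j
  rw [Matrix.conjTranspose_apply]
  simp only [headState, Matrix.of_apply]
  rw [← Matrix.trace_conjTranspose, Matrix.conjTranspose_mul, hβ, conjTranspose_tensorOp,
    Matrix.trace_mul_comm]
  congr 3
  funext q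
  rcases eq_or_ne q 0 with rfl | hq
  · simp
  · simp [hq]

theorem blockRun_isHermitian (hN : IsCPTP N) (Vs : List (RegOp (Fin 3))) {β : RegOp (Fin 3)}
    (hβ : β.IsHermitian) : (blockRun N Vs β).IsHermitian := by
  induction Vs generalizing β with
  | nil => exact hβ
  | cons V Vs ih =>
    refine ih (β := noiseLayer N (V * β * V.conjTranspose)) ?_
    rw [Matrix.IsHermitian, ← noiseLayer_conjTranspose hN]
    congr 1
    exact Matrix.isHermitian_mul_mul_conjTranspose V hβ

theorem trace_blockRun (hN : ∀ X, (N X).trace = X.trace) {Vs : List (RegOp (Fin 3))}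
    (hVs : ∀ V ∈ Vs, V ∈ Matrix.unitaryGroup (Fin 3 → Fin 2) ℂ) (β : RegOp (Fin 3)) :
    (blockRun N Vs β).trace = β.trace := by
  induction Vs generalizing β with
  | nil => rfl
  | cons V Vs ih =>
    refine (ih (fun V hV => hVs V (List.mem_cons_of_mem _ hV)) _).trans ?_
    have hV : V.conjTranspose * V = 1 := Matrix.mem_unitaryGroup_iff'.mp (hVs V List.mem_cons_self)
    rw [trace_noiseLayer hN, Matrix.trace_mul_comm, ← Matrix.mul_assoc, hV, Matrix.one_mul]

theorem isBloch_of_state {ρ : Matrix (Fin 2) (Fin 2) ℂ} (h : ρ.IsHermitian) (htr : ρ.trace = 1) :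
    IsBloch (ρ - (1 / 2 : ℂ) • 1) := by
  constructor
  · refine h.sub ?_
    rw [Matrix.IsHermitian, Matrix.conjTranspose_smul, Matrix.conjTranspose_one]
    simp
  · rw [Matrix.trace_sub, htr, Matrix.trace_smul, Matrix.trace_one]
    simp

theorem zState_isHermitian (u : ℝ) : (zState u).IsHermitian := by
  ext i j
  fin_cases i <;> fin_cases j <;> simp [zState, pauli]

theorem trace_zState (u : ℝ) : (zState u).trace = 1 := by
  simp [zState, pauli, Matrix.trace_fin_two]

theorem norm_smul_pauli (u : ℝ) : √2 * ‖((u / 2 : ℝ) : ℂ) • pauli 3‖ = |u| := by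
  rw [norm_smul, norm_pauli, Complex.norm_real, Real.norm_eq_abs, abs_div, abs_two]
  have := Real.mul_self_sqrt (show (0 : ℝ) ≤ 2 by norm_num)
  linear_combination |u| / 2 * this

theorem sqrt_two_bounds : 1 ≤ √2 ∧ √2 ≤ 2 :=
  ⟨Real.one_le_sqrt.mpr one_le_two, Real.sqrt_le_iff.mpr ⟨by norm_num, by norm_num⟩⟩

/-- Every state can be rotated to one that is polarized along `Z`, with the length of its Bloch
vector as the polarization. -/
theorem exists_rotation_to_zState {X : Matrix (Fin 2) (Fin 2) ℂ} (hX : IsBloch X) :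
    ∃ V ∈ Matrix.unitaryGroup (Fin 2) ℂ,
      V * ((1 / 2 : ℂ) • 1 + X) * V.conjTranspose = zState (√2 * ‖X‖) := by
  obtain ⟨V, hV, hVX⟩ := hX.exists_align
  refine ⟨V, hV, ?_⟩
  rw [Matrix.mul_add, Matrix.add_mul, hVX, Matrix.mul_smul, Matrix.smul_mul, Matrix.mul_one,
    show V * V.conjTranspose = 1 from Matrix.mem_unitaryGroup_iff.mp hV, zState]

/-- The factor `5 / 6 > 1 / √2` makes the right-hand side at most `1` for `u ≤ 6 / 5`. -/
theorem norm_smul_pauli_le {u : ℝ} (hu : 0 ≤ u) : ‖((u / 2 : ℝ) : ℂ) • pauli 3‖ ≤ 5 / 6 * u := by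
  have h1 := norm_smul_pauli u
  rw [abs_of_nonneg hu] at h1
  have h2 : 6 / 5 ≤ √2 := Real.le_sqrt_of_sq_le (by norm_num)
  have h3 := mul_le_mul_of_nonneg_right h2 (norm_nonneg (((u / 2 : ℝ) : ℂ) • pauli 3))
  linarith

theorem abs_sqrt_two_mul_norm_sub_le {X : Matrix (Fin 2) (Fin 2) ℂ} {u : ℝ} (hu : 0 ≤ u) :
    |√2 * ‖X‖ - u| ≤ 2 * ‖X - ((u / 2 : ℝ) : ℂ) • pauli 3‖ := by
  have h1 := norm_smul_pauli u
  rw [abs_of_nonneg hu] at h1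
  have h2 : √2 * ‖X‖ - u = √2 * (‖X‖ - ‖((u / 2 : ℝ) : ℂ) • pauli 3‖) := by linarith
  rw [h2, abs_mul, abs_of_nonneg (Real.sqrt_nonneg _)]
  exact mul_le_mul sqrt_two_bounds.2 (abs_norm_sub_norm_le _ _) (abs_nonneg _) (by norm_num)

/-- A noisy elementary compressor, acting on three independent qubits of polarization `u` along `Z`,
boosts the polarization up to an error proportional to the noise. -/
theorem exists_norm_headState_sub_le {Vs : List (RegOp (Fin 3))}
    (hVs : ∀ V ∈ Vs, V ∈ Matrix.unitaryGroup (Fin 3 → Fin 2) ℂ)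
    (hU : Vs.foldl (fun W V => V * W) 1 = trioOp) :
    ∃ C, 0 < C ∧ ∀ (N : SuperOp) (S : Matrix (Fin 2) (Fin 2) ℂ), IsNoise N S → ‖S‖ ≤ 1 →
      7168 * noiseStrength N ≤ 1 → ∀ u : ℝ, 0 ≤ u → u ≤ 6 / 5 →
        ‖headState (blockRun N Vs (tensorOp fun _ => N (zState u))) - zState (boost u)‖ ≤
          C * (noiseStrength N * (u + ‖S‖)) := by
  obtain ⟨C, hC, hCb⟩ := exists_norm_apply_le headLin
  refine ⟨C * (2 ^ (Vs.length + 1) * (7168 * 112)) + 1, by positivity, ?_⟩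
  intro N S h hS hκ u hu hu2
  have hκ0 := noiseStrength_nonneg N
  have hone : ‖N 1 - 1‖ ≤ 1 := by
    refine h.norm_apply_one_sub_le.trans ?_
    nlinarith [norm_nonneg S]
  set X : RegOp (Fin 3) := (tensorOp fun _ => zState u) - (1 / 8 : ℂ) • 1 with hX
  have hXn : ‖X‖ ≤ 112 * u := by
    have h8 : (1 / 8 : ℂ) • (1 : RegOp (Fin 3)) =
        tensorOp fun _ : Fin 3 => (1 / 2 : ℂ) • (1 : Matrix (Fin 2) (Fin 2) ℂ) := by
      rw [← tensorOp_one]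
      ext x y
      rw [Matrix.smul_apply, tensorOp_apply, tensorOp_apply, Fin.prod_univ_three,
        Fin.prod_univ_three]
      simp only [Matrix.smul_apply, smul_eq_mul]
      ring
    rw [hX, h8]
    have h1 := norm_smul_pauli_le hu
    refine (norm_tensorOp_sub_le (δ := 5 / 6 * u) (by linarith) (fun q i j => ?_)
      fun q => ?_).trans (by linarith)
    · fin_cases i <;> fin_cases j <;> norm_num
    · rw [zState, add_sub_cancel_left]
      exact h1
  -- the noise on the input is that of an additional idle layer
  have hrun : blockRun N Vs (tensorOp fun _ => N (zState u)) =
      blockRun N (1 :: Vs) ((1 / 8 : ℂ) • 1 + X) := by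
    have h1 : (1 / 8 : ℂ) • 1 + X = tensorOp fun _ => zState u := by
      rw [hX]
      abel
    rw [h1, ← noiseLayer_tensorOp]
    simp [blockRun]
  have hVs1 : ∀ V ∈ (1 :: Vs), V ∈ Matrix.unitaryGroup (Fin 3 → Fin 2) ℂ := by
    intro V hV
    rcases List.mem_cons.mp hV with rfl | hV
    · exact one_mem _
    · exact hVs V hV
  have hmain := norm_blockRun_sub_le (N := N) (a := 7168 * noiseStrength N)
    (b := 56 * (4 * noiseStrength N * ‖S‖)) (by positivity) hκ
    (norm_noiseLayer_sub_le (by linarith))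
    ((norm_noiseLayer_one_sub_le hone).trans (by gcongr; exact h.norm_apply_one_sub_le))
    (1 :: Vs) hVs1 X
  rw [List.foldl_cons, mul_one, hU, ← hrun, List.length_cons] at hmain
  have hid : headState (trioOp * ((1 / 8 : ℂ) • 1 + X) * trioOp.conjTranspose) =
      zState (boost u) := by
    rw [← headState_trioOp, hX]
    congr 3
    abel
  rw [← hid, ← headState_sub, ← headLin_apply]
  refine (hCb _).trans ?_
  have h3 : (2 ^ (Vs.length + 1) - 1 : ℝ) * (7168 * noiseStrength N * ‖X‖ +
      56 * (4 * noiseStrength N * ‖S‖)) ≤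
      2 ^ (Vs.length + 1) * (7168 * 112) * (noiseStrength N * (u + ‖S‖)) := by
    refine (mul_le_mul (show (2 : ℝ) ^ (Vs.length + 1) - 1 ≤ 2 ^ (Vs.length + 1) by linarith)
      (?_ : _ ≤ 7168 * 112 * (noiseStrength N * (u + ‖S‖))) (by positivity)
      (by positivity)).trans (le_of_eq (by ring))
    have h4 := mul_le_mul_of_nonneg_left hXn (show 0 ≤ 7168 * noiseStrength N by positivity)
    have h5 : 0 ≤ noiseStrength N * ‖S‖ := by positivity
    linarith
  have h6 : 0 ≤ noiseStrength N * (u + ‖S‖) := by positivity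
  have h7 := mul_le_mul_of_nonneg_left (hmain.trans h3) hC
  linarith

theorem IsLineGate.mem_unitaryGroup {V : RegOp (Fin 3)} (hV : IsLineGate V) :
    V ∈ Matrix.unitaryGroup (Fin 3 → Fin 2) ℂ := by
  obtain ⟨a, w, u, -, -, hu, -, rfl⟩ := hV
  rw [Matrix.mem_unitaryGroup_iff, Matrix.star_eq_conjTranspose, ← embedOp_conjTranspose,
    ← embedOp_mul, ← embedOp_one w]
  congr 1
  exact Matrix.mem_unitaryGroup_iff.mp hu

/-- One cycle for independent qubits of polarization `u`: a noisy compressor, `n` further time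
steps, and a rotation after which the output has the polarization `u'` along `Z`. -/
theorem exists_cycle {Vs : List (RegOp (Fin 3))}
    (hVs : ∀ V ∈ Vs, V ∈ Matrix.unitaryGroup (Fin 3 → Fin 2) ℂ)
    (hU : Vs.foldl (fun W V => V * W) 1 = trioOp) :
    ∃ C, 0 < C ∧ ∀ (N : SuperOp) (S : Matrix (Fin 2) (Fin 2) ℂ), IsNoise N S → ‖S‖ ≤ 1 →
      7168 * noiseStrength N ≤ 1 → ∀ (u : ℝ) (n : ℕ), 0 ≤ u →
      ∃ V ∈ Matrix.unitaryGroup (Fin 2) ℂ, ∃ u' : ℝ, 0 ≤ u' ∧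
        V * N^[n] (headState (blockRun N Vs (tensorOp fun _ => N (zState u)))) * V.conjTranspose =
          zState u' ∧
        (u ≤ 6 / 5 → |u' - boost u| ≤ C * (noiseStrength N * (n + 1) * (u + ‖S‖))) := by
  obtain ⟨C, hC, hCb⟩ := exists_norm_headState_sub_le hVs hU
  refine ⟨2 * C + 4 * (2 + C), by positivity, ?_⟩
  intro N S h hS hκ u n hu
  have hκ0 := noiseStrength_nonneg N
  set ρ := headState (blockRun N Vs (tensorOp fun _ => N (zState u))) with hρ
  have hρH : ρ.IsHermitian := by
    refine isHermitian_headState (blockRun_isHermitian h.cptp Vs ?_)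
    rw [Matrix.IsHermitian, conjTranspose_tensorOp, ← apply_conjTranspose h.cptp,
      zState_isHermitian u]
  have hρtr : ρ.trace = 1 := by
    rw [hρ, trace_headState, trace_blockRun h.cptp.2 hVs, trace_tensorOp]
    simp [h.cptp.2, trace_zState]
  set Y := ρ - (1 / 2 : ℂ) • 1 with hY
  have hYB : IsBloch Y := isBloch_of_state hρH hρtr
  have hYS : IsBloch (Y - S) := hYB.sub h.bloch
  have hρY : ρ = (1 / 2 : ℂ) • 1 + Y := by rw [hY]; abel
  obtain ⟨V, hV, hVX⟩ := exists_rotation_to_zState (h.bloch.add (hYS.iterate h.cptp n))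
  refine ⟨V, hV, √2 * ‖S + N^[n] (Y - S)‖, by positivity, by rw [hρY, h.iterate_apply, hVX],
    fun hu2 => ?_⟩
  have hf0 : 0 ≤ boost u := by
    rw [boost]
    nlinarith [mul_nonneg hu (show (0 : ℝ) ≤ 3 - u ^ 2 by nlinarith)]
  have hfu : boost u ≤ 2 * u := by
    rw [boost]
    nlinarith [pow_nonneg hu 3]
  refine (abs_sqrt_two_mul_norm_sub_le hf0).trans ?_
  have h1 : ‖Y - ((boost u / 2 : ℝ) : ℂ) • pauli 3‖ ≤ C * (noiseStrength N * (u + ‖S‖)) := by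
    have := hCb N S h hS hκ u hu hu2
    rwa [← hρ, zState, ← sub_sub] at this
  have h2 := h.norm_iterate_sub_le hYS n
  have h3 : ‖((boost u / 2 : ℝ) : ℂ) • pauli 3‖ ≤ 2 * u := by
    linarith [norm_smul_pauli_le hf0]
  have h4 : ‖Y - S‖ ≤ (2 + C) * (u + ‖S‖) := by
    have h5 : Y - S = (Y - ((boost u / 2 : ℝ) : ℂ) • pauli 3) +
        (((boost u / 2 : ℝ) : ℂ) • pauli 3 - S) := by abel
    have h6 : ‖Y - S‖ ≤ ‖Y - ((boost u / 2 : ℝ) : ℂ) • pauli 3‖ +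
        (‖((boost u / 2 : ℝ) : ℂ) • pauli 3‖ + ‖S‖) := by
      rw [h5]
      refine (norm_add_le _ _).trans ?_
      gcongr
      exact norm_sub_le _ _
    have h7 : C * (noiseStrength N * (u + ‖S‖)) ≤ C * (1 * (u + ‖S‖)) := by
      gcongr
      linarith
    linarith [norm_nonneg S]
  have h5 : S + N^[n] (Y - S) - ((boost u / 2 : ℝ) : ℂ) • pauli 3 =
      (N^[n] (Y - S) - (Y - S)) + (Y - ((boost u / 2 : ℝ) : ℂ) • pauli 3) := by abel
  have h6 : ‖S + N^[n] (Y - S) - ((boost u / 2 : ℝ) : ℂ) • pauli 3‖ ≤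
      n * (2 * noiseStrength N * ((2 + C) * (u + ‖S‖))) + C * (noiseStrength N * (u + ‖S‖)) := by
    rw [h5]
    refine (norm_add_le _ _).trans (add_le_add (h2.trans ?_) h1)
    gcongr
  have h7 : 0 ≤ noiseStrength N * (u + ‖S‖) := by positivity
  have h8 : 0 ≤ (n : ℝ) * (C * (noiseStrength N * (u + ‖S‖))) := by positivity
  have h9 : 0 ≤ C * (noiseStrength N * (u + ‖S‖)) := by positivity
  nlinarith

/-- Settling: `n` steps of noise polarize maximally mixed qubits, and a rotation makes `Z` the axis
of the polarization. -/
theorem IsNoise.exists_settle (h : IsNoise N S) {Δ : ℝ} (hΔ : IsContracting Δ N)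
    (n : ℕ) :
    ∃ V ∈ Matrix.unitaryGroup (Fin 2) ℂ, ∃ u : ℝ,
      V * N^[n] ((1 / 2 : ℂ) • 1) * V.conjTranspose = zState u ∧
      √2 * ‖S‖ * (1 - (1 - Δ * noiseStrength N) ^ n) ≤ u ∧
      u ≤ √2 * ‖S‖ * (2 * (n * noiseStrength N)) ∧ 0 ≤ u := by
  have hB : IsBloch (0 - S) := by
    refine IsBloch.sub ⟨Matrix.isHermitian_zero, Matrix.trace_zero _ _⟩ h.bloch
  obtain ⟨V, hV, hVX⟩ := exists_rotation_to_zState (h.bloch.add (hB.iterate h.cptp n))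
  have h0 : (1 / 2 : ℂ) • (1 : Matrix (Fin 2) (Fin 2) ℂ) = (1 / 2 : ℂ) • 1 + 0 := by rw [add_zero]
  refine ⟨V, hV, _, by rw [h0, h.iterate_apply, hVX], ?_, ?_, by positivity⟩
  · have h1 : ∀ m : ℕ, ‖N^[m] (0 - S)‖ ≤ (1 - Δ * noiseStrength N) ^ m * ‖S‖ := by
      intro m
      induction m with
      | zero => simp
      | succ m ih =>
        rw [Function.iterate_succ_apply']
        have h2 := hΔ.norm_apply_le h.cptp (hB.iterate h.cptp m)
        rcases eq_or_ne S 0 with hS | hS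
        · have h3 : ∀ m : ℕ, N^[m] (0 - S) = 0 := by
            intro m
            rw [hS, sub_zero]
            exact Function.iterate_fixed (map_zero N) m
          rw [← Function.iterate_succ_apply' (f := N), h3, hS]
          simp
        · have h3 : 0 ≤ 1 - Δ * noiseStrength N := by
            have h4 := (norm_nonneg _).trans (hΔ.norm_apply_le h.cptp h.bloch)
            exact nonneg_of_mul_nonneg_left h4 (norm_pos_iff.mpr hS)
          calc _ ≤ _ := h2
            _ ≤ (1 - Δ * noiseStrength N) * ((1 - Δ * noiseStrength N) ^ m * ‖S‖) := by gcongr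
            _ = _ := by ring
    have h2 := norm_sub_norm_le S (-(N^[n] (0 - S)))
    rw [norm_neg, sub_neg_eq_add] at h2
    have h3 := h1 n
    rw [mul_assoc]
    refine mul_le_mul_of_nonneg_left ?_ (Real.sqrt_nonneg _)
    linarith
  · have h1 := h.norm_iterate_sub_le hB n
    have h2 : N^[n] (0 - S) - (0 - S) = S + N^[n] (0 - S) := by abel
    rw [h2, zero_sub, norm_neg, ← zero_sub] at h1
    rw [mul_assoc]
    refine mul_le_mul_of_nonneg_left ?_ (Real.sqrt_nonneg _)
    linarith

/-- The end of the circuit: two steps of noise, which follow the last rotation of the compressor and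
the swap with the target, then a rotation that leaves the Bloch vector tilted against the `Z` axis by
an angle `θ` with `cos θ = 1 - 2 q`, and a last step of noise. -/
theorem IsNoise.exists_tilt (h : IsNoise N S) (hκ : noiseStrength N ≤ 1) {u : ℝ} (hu : 0 ≤ u)
    {q : ℝ} (hq : 0 ≤ q) (hq1 : q ≤ 1) :
    ∃ W ∈ Matrix.unitaryGroup (Fin 2) ℂ,
      |(pauli 3 * N (W * N (N (zState u)) * W.conjTranspose)).trace.re - u * (1 - 2 * q)| ≤
        60 * (noiseStrength N * (u + ‖S‖)) := by
  have hκ0 := noiseStrength_nonneg N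
  have hZB : IsBloch (((u / 2 : ℝ) : ℂ) • pauli 3) := isBloch_smul_pauli _
  have hB := hZB.sub h.bloch
  obtain ⟨V, hV, hVX⟩ := exists_rotation_to_zState (h.bloch.add (hB.iterate h.cptp 2))
  set v := √2 * ‖S + N^[2] (((u / 2 : ℝ) : ℂ) • pauli 3 - S)‖ with hv
  have hZn : ‖((u / 2 : ℝ) : ℂ) • pauli 3‖ ≤ u := by
    linarith [norm_smul_pauli_le hu]
  have hBn : ‖((u / 2 : ℝ) : ℂ) • pauli 3 - S‖ ≤ u + ‖S‖ := (norm_sub_le _ _).trans (by linarith)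
  have hvu : |v - u| ≤ 8 * (noiseStrength N * (u + ‖S‖)) := by
    refine (abs_sqrt_two_mul_norm_sub_le hu).trans ?_
    have h1 := h.norm_iterate_sub_le hB 2
    have h2 : S + N^[2] (((u / 2 : ℝ) : ℂ) • pauli 3 - S) - ((u / 2 : ℝ) : ℂ) • pauli 3 =
      N^[2] (((u / 2 : ℝ) : ℂ) • pauli 3 - S) - (((u / 2 : ℝ) : ℂ) • pauli 3 - S) := by abel
    rw [h2]
    have h3 := mul_le_mul_of_nonneg_left hBn hκ0
    rw [Nat.cast_ofNat] at h1
    linarith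
  -- the rotation about the `y` axis with `cos (θ / 2) = √(1 - q)`
  let c : ℝ := √(1 - q)
  let s : ℝ := √q
  have hc : c * c = 1 - q := Real.mul_self_sqrt (by linarith)
  have hs : s * s = q := Real.mul_self_sqrt hq
  have hcC : (c : ℂ) * c = 1 - q := by exact_mod_cast congrArg (fun x : ℝ => (x : ℂ)) hc
  have hsC : (s : ℂ) * s = q := by exact_mod_cast congrArg (fun x : ℝ => (x : ℂ)) hs
  let R : Matrix (Fin 2) (Fin 2) ℂ := !![(c : ℂ), -s; s, c]
  have hR : R ∈ Matrix.unitaryGroup (Fin 2) ℂ := by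
    rw [Matrix.mem_unitaryGroup_iff, Matrix.star_eq_conjTranspose]
    ext i j
    fin_cases i <;> fin_cases j <;> simp [R, Matrix.mul_apply, Fin.sum_univ_two]
    · linear_combination hcC + hsC
    · ring
    · ring
    · linear_combination hcC + hsC
  refine ⟨R * V, mul_mem hR hV, ?_⟩
  have hconj : R * V * N (N (zState u)) * (R * V).conjTranspose =
      R * zState v * R.conjTranspose := by
    have h1 : N (N (zState u)) = N^[2] ((1 / 2 : ℂ) • 1 + ((u / 2 : ℝ) : ℂ) • pauli 3) := rfl
    rw [h1, h.iterate_apply, ← hVX, Matrix.conjTranspose_mul]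
    simp only [Matrix.mul_assoc]
  set Y := R * (((v / 2 : ℝ) : ℂ) • pauli 3) * R.conjTranspose with hY
  have hYB : IsBloch Y := by
    refine ⟨Matrix.isHermitian_mul_mul_conjTranspose R (isBloch_smul_pauli _).1, ?_⟩
    rw [hY, Matrix.trace_mul_comm, ← Matrix.mul_assoc,
      show R.conjTranspose * R = 1 from Matrix.mem_unitaryGroup_iff'.mp hR, Matrix.one_mul]
    exact (isBloch_smul_pauli _).2
  have hv0 : 0 ≤ v := by positivity
  have hYn : ‖Y‖ ≤ v := by
    rw [hY, frobenius_norm_conj hR]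
    linarith [norm_smul_pauli_le hv0]
  have hRz : R * zState v * R.conjTranspose = (1 / 2 : ℂ) • 1 + Y := by
    rw [zState, Matrix.mul_add, Matrix.add_mul, Matrix.mul_smul, Matrix.smul_mul, Matrix.mul_one,
      show R * R.conjTranspose = 1 from Matrix.mem_unitaryGroup_iff.mp hR]
  have hstep : N ((1 / 2 : ℂ) • 1 + Y) = (1 / 2 : ℂ) • 1 + Y + (N (Y - S) - (Y - S)) := by
    have h1 := h.iterate_apply Y 1
    rw [Function.iterate_one] at h1
    rw [h1]
    abel
  rw [hconj, hRz, hstep]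
  have hD : ‖N (Y - S) - (Y - S)‖ ≤ 2 * noiseStrength N * (v + ‖S‖) := by
    refine (norm_apply_sub_le N _).trans ?_
    gcongr
    exact (norm_sub_le _ _).trans (by linarith)
  set D := N (Y - S) - (Y - S)
  have htr : (pauli 3 * ((1 / 2 : ℂ) • 1 + Y + D)).trace.re =
      v * (1 - 2 * q) + (D 0 0 - D 1 1).re := by
    have h1 : (pauli 3 * ((1 / 2 : ℂ) • 1 + Y + D)).trace = Y 0 0 - Y 1 1 + (D 0 0 - D 1 1) := by
      rw [Matrix.trace_fin_two, Matrix.mul_apply, Matrix.mul_apply]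
      simp only [Fin.sum_univ_two, Matrix.add_apply, Matrix.smul_apply]
      simp [pauli]
      ring
    have h2 : Y 0 0 - Y 1 1 = ((v * (1 - 2 * q) : ℝ) : ℂ) := by
      rw [hY, Matrix.mul_apply, Matrix.mul_apply]
      simp only [Fin.sum_univ_two, Matrix.mul_apply, Matrix.conjTranspose_apply, Matrix.smul_apply]
      simp [R, pauli]
      linear_combination (v : ℂ) * hcC - (v : ℂ) * hsC
    rw [h1, h2, Complex.add_re, Complex.ofReal_re]
  have hDre : |(D 0 0 - D 1 1).re| ≤ 2 * (2 * noiseStrength N * (v + ‖S‖)) := by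
    refine (Complex.abs_re_le_norm _).trans ((norm_sub_le _ _).trans ?_)
    linarith [norm_entry_le_frobenius_norm D 0 0, norm_entry_le_frobenius_norm D 1 1]
  rw [htr]
  have hvb := (abs_le.mp hvu).2
  have hK : 0 ≤ noiseStrength N * (u + ‖S‖) := by positivity
  have h1 : |v * (1 - 2 * q) - u * (1 - 2 * q)| ≤ 8 * (noiseStrength N * (u + ‖S‖)) := by
    rw [← sub_mul, abs_mul]
    have h2 : |1 - 2 * q| ≤ 1 := abs_le.mpr ⟨by linarith, by linarith⟩
    calc _ ≤ |v - u| * 1 := by gcongr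
      _ ≤ _ := by linarith
  have h2 : noiseStrength N * (v + ‖S‖) ≤ 9 * (noiseStrength N * (u + ‖S‖)) := by
    have h3 : v + ‖S‖ ≤ 9 * (u + ‖S‖) := by
      have h4 : noiseStrength N * (u + ‖S‖) ≤ 1 * (u + ‖S‖) := by gcongr
      linarith [norm_nonneg S]
    nlinarith
  have h3 : v * (1 - 2 * q) + (D 0 0 - D 1 1).re - u * (1 - 2 * q) =
      (v * (1 - 2 * q) - u * (1 - 2 * q)) + (D 0 0 - D 1 1).re := by ring
  rw [h3]
  refine (abs_add_le _ _).trans ?_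
  linarith

end Cycle

/-! ### Transport in the cube -/

section Geometry

variable {d : ℕ}

/-- The cube with `3 ^ m` sites along each edge. -/
noncomputable def cube (d m : ℕ) : Finset (Fin d → ℤ) :=
  Fintype.piFinset fun _ => Finset.Ico 0 (3 ^ m)

theorem mem_cube {m : ℕ} {x : Fin d → ℤ} : x ∈ cube d m ↔ ∀ i, 0 ≤ x i ∧ x i < 3 ^ m := by
  simp [cube]

theorem card_cube (d m : ℕ) : (cube d m).card = 3 ^ (d * m) := by
  rw [cube, Fintype.card_piFinset_const, Int.card_Ico, sub_zero, mul_comm d, pow_mul,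
    show (3 : ℤ) ^ m = ((3 ^ m : ℕ) : ℤ) by push_cast; rfl, Int.toNat_natCast]

/-- The site of the target: next to the origin, outside of the cube. -/
def targetSite (r₀ : Fin d) : Fin d → ℤ := Pi.single r₀ (-1)

theorem targetSite_notMem (r₀ : Fin d) (m : ℕ) : targetSite r₀ ∉ cube d m := by
  intro h
  have := (mem_cube.mp h r₀).1
  simp [targetSite] at this

/-- The sites of the register: those of the cube, which hold the ancillas, and that of the
target. -/
noncomputable def resetSites (r₀ : Fin d) (m : ℕ) : Finset (Fin d → ℤ) :=
  insert (targetSite r₀) (cube d m)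

theorem card_resetSites (r₀ : Fin d) (m : ℕ) : (resetSites r₀ m).card = 3 ^ (d * m) + 1 := by
  rw [resetSites, Finset.card_insert_of_notMem (targetSite_notMem r₀ m), card_cube]

theorem fitsInCube_resetSites (r₀ : Fin d) (m : ℕ) :
    FitsInCube (resetSites r₀ m) (2 * 3 ^ m) := by
  refine ⟨fun _ => -1, 3 ^ m + 1, ?_, fun v hv i => ?_⟩
  · have : (1 : ℝ) ≤ 3 ^ m := one_le_pow₀ (by norm_num)
    push_cast
    linarith
  · have h3 : (1 : ℤ) ≤ 3 ^ m := one_le_pow₀ (by norm_num)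
    push_cast
    rcases Finset.mem_insert.mp hv with rfl | hv
    · rcases eq_or_ne i r₀ with rfl | hi
      · rw [targetSite, Pi.single_eq_same]
        constructor <;> linarith
      · rw [targetSite, Pi.single_eq_of_ne hi]
        constructor <;> linarith
    · have := mem_cube.mp hv i
      constructor <;> linarith

variable {r₀ : Fin d} {m : ℕ}

/-- The target. -/
def target (r₀ : Fin d) (m : ℕ) : resetSites r₀ m :=
  ⟨targetSite r₀, Finset.mem_insert_self _ _⟩

/-- The ancilla at a site of the cube. -/
def ancilla (r₀ : Fin d) {x : Fin d → ℤ} (hx : x ∈ cube d m) : resetSites r₀ m :=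
  ⟨x, Finset.mem_insert_of_mem hx⟩

theorem ne_target {x : resetSites r₀ m} : x ≠ target r₀ m ↔ x.1 ∈ cube d m := by
  constructor
  · intro h
    exact (Finset.mem_insert.mp x.2).resolve_left fun hx => h (Subtype.ext hx)
  · rintro h rfl
    exact targetSite_notMem r₀ m h

theorem update_mem_cube {x : Fin d → ℤ} (hx : x ∈ cube d m) (r : Fin d) {v : ℤ} (h0 : 0 ≤ v)
    (h1 : v < 3 ^ m) : Function.update x r v ∈ cube d m := by
  refine mem_cube.mpr fun i => ?_
  rcases eq_or_ne i r with rfl | hi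
  · rw [Function.update_self]
    exact ⟨h0, h1⟩
  · rw [Function.update_of_ne hi]
    exact mem_cube.mp hx i

/-- The ancilla at the origin, where the output of the compressor appears. -/
def origin (r₀ : Fin d) (m : ℕ) : resetSites r₀ m :=
  ancilla r₀ (x := 0) (mem_cube.mpr fun _ => ⟨le_rfl, by simp⟩)

theorem latticeAdj_symm {Λ : Finset (Fin d → ℤ)} {v w : Λ} (h : latticeAdj Λ v w) :
    latticeAdj Λ w v := by
  rw [latticeAdj] at h ⊢
  rw [← h]
  exact Finset.sum_congr rfl fun i _ => abs_sub_comm _ _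

theorem latticeAdj_of_update {Λ : Finset (Fin d → ℤ)} {v w : Λ} {r : Fin d} {a b : ℤ}
    {x : Fin d → ℤ} (hv : v.1 = Function.update x r a) (hw : w.1 = Function.update x r b)
    (h : |a - b| = 1) : latticeAdj Λ v w := by
  rw [latticeAdj, Finset.sum_eq_single r]
  · rw [hv, hw, Function.update_self, Function.update_self, h]
  · intro i _ hi
    rw [hv, hw, Function.update_of_ne hi, Function.update_of_ne hi]
    simp
  · simp

theorem latticeAdj_origin_target : latticeAdj _ (origin r₀ m) (target r₀ m) :=
  latticeAdj_of_update (x := 0) (r := r₀) (a := 0) (b := -1)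
    (Function.update_eq_self r₀ (0 : Fin d → ℤ)).symm rfl (by norm_num)

/-- A residue below `M - k` leaves room for `k` further sites before the multiple `b` of `M`. -/
theorem add_lt_of_emod {M v k c b : ℤ} (hM : M ∣ b) (hv : v < b) (hk : v % M = c)
    (hc : c + k < M) (hM0 : 0 < M) : v + k < b := by
  obtain ⟨q, rfl⟩ := hM
  have h1 := Int.emod_add_mul_ediv v M
  have h2 : v / M < q := Int.ediv_lt_of_lt_mul hM0 (by linarith)
  have h3 : M * (v / M + 1) ≤ M * q := mul_le_mul_of_nonneg_left h2 hM0.le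
  linarith

theorem add_emod_of_lt {M v k c : ℤ} (hk : v % M = c) (h0 : 0 ≤ c + k) (h1 : c + k < M) :
    (v + k) % M = c + k := by
  have h := (Int.mod_modEq v M).add_right k
  rw [hk] at h
  exact Eq.trans h.symm (Int.emod_eq_of_lt h0 h1)

/-- A layer of swaps of the neighbours, along the axis `r`, whose coordinates have the residues `c`
and `c + 1` modulo `M`. -/
theorem exists_residueSwap (r : Fin d) {M c : ℤ} (hM : M ∣ 3 ^ m) (hc : 0 ≤ c) (hcM : c + 1 < M) :
    ∃ (ℓ : Layer (latticeAdj (resetSites r₀ m))) (s : Equiv.Perm (resetSites r₀ m)),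
      ℓ.unitary = permOp s ∧ s (target r₀ m) = target r₀ m ∧
      (∀ x, x.1 ∈ cube d m → x.1 r % M = c + 1 →
        (s x).1 = Function.update x.1 r (x.1 r - 1)) ∧
      ∀ x, x.1 ∈ cube d m → x.1 r % M ≠ c → x.1 r % M ≠ c + 1 → s x = x := by
  have hM0 : 0 < M := by linarith
  let ι : Type := {x : resetSites r₀ m // x.1 ∈ cube d m ∧ x.1 r % M = c}
  have hmem : ∀ x : ι, Function.update x.1.1 r (x.1.1 r + 1) ∈ cube d m := fun x =>
    update_mem_cube x.2.1 r (by linarith [(mem_cube.mp x.2.1 r).1])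
      (add_lt_of_emod hM (mem_cube.mp x.2.1 r).2 x.2.2 hcM hM0)
  have hres : ∀ x : ι, (x.1.1 r + 1) % M = c + 1 := fun x =>
    add_emod_of_lt x.2.2 (by linarith) hcM
  let a : ι → resetSites r₀ m := fun x => x.1
  let b : ι → resetSites r₀ m := fun x => ancilla r₀ (hmem x)
  have hbr : ∀ x : ι, (b x).1 r = x.1.1 r + 1 := fun x => Function.update_self _ _ _
  have hadj : ∀ x : ι, latticeAdj _ (a x) (b x) := fun x =>
    latticeAdj_of_update (x := x.1.1) (r := r) (a := x.1.1 r) (b := x.1.1 r + 1)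
      (Function.update_eq_self _ _).symm rfl (by simp)
  have hinj : Function.Injective b := by
    intro x y hxy
    have h1 := congrArg Subtype.val hxy
    have h2 : x.1.1 r = y.1.1 r := by
      have := congrFun h1 r
      rw [hbr, hbr] at this
      linarith
    refine Subtype.ext (Subtype.ext (funext fun i => ?_))
    rcases eq_or_ne i r with rfl | hi
    · exact h2
    · have := congrFun h1 i
      change Function.update x.1.1 r _ i = Function.update y.1.1 r _ i at this
      rwa [Function.update_of_ne hi, Function.update_of_ne hi] at this
  obtain ⟨ℓ, s, hℓ, hsa, hsb, hfix⟩ := exists_swapLayer a b hadj (fun x => latticeAdj_symm (hadj x))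
    Subtype.val_injective hinj fun x y hxy => by
      have h1 := x.2.2
      have h2 : x.1.1 r = y.1.1 r + 1 := by rw [← hbr, ← hxy]
      rw [h2, hres] at h1
      linarith
  refine ⟨ℓ, s, hℓ, hfix _ ?_ ?_, ?_, ?_⟩
  · exact fun x h => ne_target.mpr x.2.1 h.symm
  · exact fun x h => (ne_target.mpr (hmem x) : b x ≠ target r₀ m) h.symm
  · intro x hx hxr
    have hx0 := (mem_cube.mp hx r)
    have hx1 : 1 ≤ x.1 r := by
      by_contra h
      have h0 : x.1 r = 0 := by omega
      rw [h0, Int.zero_emod] at hxr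
      omega
    let y : ι := ⟨ancilla r₀ (update_mem_cube hx r (v := x.1 r - 1) (by linarith) (by linarith)), by
      refine ⟨update_mem_cube hx r (by linarith) (by linarith), ?_⟩
      change Function.update x.1 r (x.1 r - 1) r % M = c
      rw [Function.update_self, sub_eq_add_neg, add_emod_of_lt hxr (by linarith) (by linarith)]
      ring⟩
    have hy : b y = x := by
      refine Subtype.ext ?_
      change Function.update (Function.update x.1 r (x.1 r - 1)) r
        (Function.update x.1 r (x.1 r - 1) r + 1) = x.1
      rw [Function.update_self, Function.update_idem, sub_add_cancel, Function.update_eq_self]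
    rw [← hy, hsb, hy]
    rfl
  · intro x hx h1 h2
    refine hfix x (fun y h => h1 ?_) fun y h => h2 ?_
    · rw [h]
      exact y.2.2
    · rw [h, hbr, hres]

/-- Swaps that move the qubits at the residue `b + n` to the residue `b`, on all lines along the
axis `r` in parallel. -/
theorem exists_shift (r : Fin d) {M b : ℤ} (hM : M ∣ 3 ^ m) (hb : 0 ≤ b) (n : ℕ) (hn : b + n < M) :
    ∃ (L : List (Layer (latticeAdj (resetSites r₀ m)))) (π : Equiv.Perm (resetSites r₀ m)),
      L.length = n ∧ IsPermRun L π ∧ π (target r₀ m) = target r₀ m ∧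
      ∀ x, x.1 ∈ cube d m → (x.1 r % M < b ∨ b + n < x.1 r % M → π x = x) ∧
        (x.1 r % M = b + n → (π x).1 = Function.update x.1 r (x.1 r - n)) := by
  induction n with
  | zero =>
    refine ⟨[], 1, rfl, .nil, rfl, fun x _ => ⟨fun _ => rfl, fun _ => ?_⟩⟩
    simp
  | succ n ih =>
    push_cast at hn ⊢
    obtain ⟨L, π, hL, hLπ, hτ, hπ⟩ := ih (by linarith)
    obtain ⟨ℓ, s, hℓ, hsτ, hs, hfix⟩ := exists_residueSwap (r₀ := r₀) r hM
      (show 0 ≤ b + n by positivity) (by linarith)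
    refine ⟨ℓ :: L, π * s, by simp [hL], .cons ℓ L s π hℓ hLπ, ?_,
      fun x hx => ⟨fun h => ?_, fun h => ?_⟩⟩
    · rw [Equiv.Perm.mul_apply, hsτ, hτ]
    · have hn0 : (0 : ℤ) ≤ n := Int.natCast_nonneg n
      rw [Equiv.Perm.mul_apply, hfix x hx (by omega) (by omega)]
      exact (hπ x hx).1 (by omega)
    · have h1 := hs x hx (by rw [h]; ring)
      have hx0 := mem_cube.mp hx r
      have h2 : (s x).1 ∈ cube d m := by
        refine ne_target.mp fun hc => ne_target.mpr hx ?_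
        rw [← hsτ] at hc
        exact s.injective hc
      have h3 : (s x).1 r % M = b + n := by
        rw [h1, Function.update_self, sub_eq_add_neg, add_emod_of_lt h (by linarith) (by linarith)]
        ring
      rw [Equiv.Perm.mul_apply, (hπ _ h2).2 h3, h1, Function.update_self, Function.update_idem]
      congr 1
      ring

/-- The ancillas whose coordinates are multiples of `3 ^ e i`. -/
noncomputable def spread (r₀ : Fin d) (m : ℕ) (e : Fin d → ℕ) : Finset (resetSites r₀ m) :=
  Finset.univ.filter fun x => x.1 ∈ cube d m ∧ ∀ i, (3 : ℤ) ^ e i ∣ x.1 i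

/-- The qubits of `spread r₀ m e`, gathered in trios of neighbours along the axis `r`. -/
noncomputable def gathered (r₀ : Fin d) (m : ℕ) (e : Fin d → ℕ) (r : Fin d) :
    Finset (resetSites r₀ m) :=
  Finset.univ.filter fun x => x.1 ∈ cube d m ∧ (∀ i, i ≠ r → (3 : ℤ) ^ e i ∣ x.1 i) ∧
    x.1 r % 3 ^ (e r + 1) < 3

theorem mem_spread {e : Fin d → ℕ} {x : resetSites r₀ m} :
    x ∈ spread r₀ m e ↔ x.1 ∈ cube d m ∧ ∀ i, (3 : ℤ) ^ e i ∣ x.1 i := by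
  simp [spread]

theorem mem_gathered {e : Fin d → ℕ} {r : Fin d} {x : resetSites r₀ m} :
    x ∈ gathered r₀ m e r ↔ x.1 ∈ cube d m ∧ (∀ i, i ≠ r → (3 : ℤ) ^ e i ∣ x.1 i) ∧
      x.1 r % 3 ^ (e r + 1) < 3 := by
  simp [gathered]

theorem gathered_zero (r : Fin d) : gathered r₀ m 0 r = Finset.univ.erase (target r₀ m) := by
  ext x
  rw [mem_gathered, Finset.mem_erase, ne_target]
  simp only [Pi.zero_apply, pow_zero, one_dvd, implies_true, true_and, zero_add, pow_one,
    Finset.mem_univ, and_true, and_iff_left_iff_imp]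
  exact fun _ => Int.emod_lt_of_pos _ (by norm_num)

theorem spread_const : spread r₀ m (fun _ => m) = {origin r₀ m} := by
  ext x
  rw [mem_spread, Finset.mem_singleton]
  constructor
  · rintro ⟨hx, h⟩
    refine Subtype.ext (funext fun i => ?_)
    exact Int.eq_zero_of_dvd_of_nonneg_of_lt (mem_cube.mp hx i).1 (mem_cube.mp hx i).2 (h i)
  · rintro rfl
    exact ⟨mem_cube.mpr fun _ => ⟨le_rfl, by simp [origin, ancilla]⟩, fun i => dvd_zero _⟩

theorem mem_cube_of_fixes_target {π : Equiv.Perm (resetSites r₀ m)}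
    (hπ : π (target r₀ m) = target r₀ m) {x : resetSites r₀ m} (hx : x.1 ∈ cube d m) :
    (π x).1 ∈ cube d m := by
  refine ne_target.mp fun hc => ne_target.mpr hx ?_
  rw [← hπ] at hc
  exact π.injective hc

/-- The current qubits are brought together in trios by swaps: on every line along the axis `r`,
with `l = 3 ^ e r`, the qubits at the residues `0`, `l` and `2 l` modulo `3 l` go to `0`, `1` and
`2`. -/
theorem exists_gather {e : Fin d → ℕ} {r : Fin d} (he : e r < m) :
    ∃ (L : List (Layer (latticeAdj (resetSites r₀ m)))) (π : Equiv.Perm (resetSites r₀ m)),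
      L.length ≤ 3 ^ m ∧ IsPermRun L π ∧ π (target r₀ m) = target r₀ m ∧
      (spread r₀ m e).image π = gathered r₀ m e r := by
  set l : ℕ := 3 ^ e r with hl
  have hl1 : 1 ≤ l := Nat.one_le_pow _ _ (by norm_num)
  have hl1' : (1 : ℤ) ≤ l := by exact_mod_cast hl1
  have hlZ : (3 : ℤ) ^ e r = l := by rw [hl]; push_cast; rfl
  have hMZ : (3 : ℤ) ^ (e r + 1) = 3 * l := by rw [pow_succ, hlZ]; ring
  have hM : (3 * l : ℤ) ∣ 3 ^ m := hMZ ▸ pow_dvd_pow 3 he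
  have hc1 : ((l - 1 : ℕ) : ℤ) = l - 1 := by push_cast [hl1]; ring
  have hc2 : ((2 * l - 2 : ℕ) : ℤ) = 2 * l - 2 := by omega
  obtain ⟨L₁, π₁, hL₁, hLπ₁, hτ₁, hπ₁⟩ := exists_shift (r₀ := r₀) r hM (zero_le_one' ℤ) (l - 1)
    (by omega)
  obtain ⟨L₂, π₂, hL₂, hLπ₂, hτ₂, hπ₂⟩ := exists_shift (r₀ := r₀) r hM (zero_le_two (α := ℤ))
    (2 * l - 2) (by omega)
  have hτ : (π₂ * π₁) (target r₀ m) = target r₀ m := by rw [Equiv.Perm.mul_apply, hτ₁, hτ₂]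
  have hlen : (L₁ ++ L₂).length ≤ 3 ^ m := by
    have h1 : 3 ^ (e r + 1) ≤ 3 ^ m := Nat.pow_le_pow_right (by norm_num) he
    rw [pow_succ, ← hl] at h1
    rw [List.length_append, hL₁, hL₂]
    omega
  rw [hc1] at hπ₁
  rw [hc2] at hπ₂
  have key : ∀ x, x.1 ∈ cube d m → ∀ i : ℤ, 0 ≤ i → i < 3 → x.1 r % (3 * l) = i * l →
      ((π₂ * π₁) x).1 = Function.update x.1 r (x.1 r - i * (l - 1)) := by
    intro x hx i h0 h3 hi
    rw [Equiv.Perm.mul_apply]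
    interval_cases i
    · rw [(hπ₁ x hx).1 (by omega), (hπ₂ x hx).1 (by omega)]
      simp
    · have h1 := (hπ₁ x hx).2 (by omega)
      have h2 : (π₁ x).1 r % (3 * l) = 1 := by
        rw [h1, Function.update_self, sub_eq_add_neg, add_emod_of_lt hi (by omega) (by omega)]
        ring
      rw [(hπ₂ _ (mem_cube_of_fixes_target hτ₁ hx)).1 (by omega), h1]
      simp
    · rw [(hπ₁ x hx).1 (by omega), (hπ₂ x hx).2 (by omega)]
      congr 1
      ring
  refine ⟨L₁ ++ L₂, π₂ * π₁, hlen, hLπ₁.append hLπ₂, hτ, ?_⟩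
  ext y
  rw [Finset.mem_image, mem_gathered, hMZ]
  constructor
  · rintro ⟨x, hx, rfl⟩
    obtain ⟨hx, hdvd⟩ := mem_spread.mp hx
    have hr := hdvd r
    rw [hlZ] at hr
    obtain ⟨i, hi⟩ : (l : ℤ) ∣ x.1 r % (3 * l) :=
      (EuclideanDomain.dvd_mod_iff (Dvd.intro_left 3 rfl)).mpr hr
    rw [mul_comm (l : ℤ) i] at hi
    have h1 := Int.emod_nonneg (x.1 r) (show (3 * l : ℤ) ≠ 0 by omega)
    have h2 := Int.emod_lt_of_pos (x.1 r) (show (0 : ℤ) < 3 * l by omega)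
    have h3 : 0 ≤ i := by
      rw [hi] at h1
      exact nonneg_of_mul_nonneg_left h1 (by omega)
    have h4 : i < 3 := by
      rw [hi] at h2
      exact lt_of_mul_lt_mul_right h2 (by omega)
    have h5 := key x hx i h3 h4 hi
    refine ⟨mem_cube_of_fixes_target hτ hx, fun j hj => ?_, ?_⟩
    · rw [h5, Function.update_of_ne hj]
      exact hdvd j
    · have h6 : i * l + -(i * (l - 1)) = i := by ring
      rw [h5, Function.update_self, sub_eq_add_neg,
        add_emod_of_lt hi (by rw [h6]; exact h3) (by rw [h6]; omega), h6]
      exact h4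
  · rintro ⟨hy, hdvd, hi⟩
    set i := y.1 r % (3 * l) with hidef
    have h0 : 0 ≤ i := Int.emod_nonneg _ (by omega)
    have hil : 0 ≤ i * (l - 1) := mul_nonneg h0 (by omega)
    have hil2 : i + i * (l - 1) < 3 * l := by nlinarith
    have hcube := update_mem_cube hy r (v := y.1 r + i * (l - 1))
      (add_nonneg (mem_cube.mp hy r).1 hil)
      (add_lt_of_emod hM (mem_cube.mp hy r).2 hidef.symm hil2 (by omega))
    have hxr : (y.1 r + i * (l - 1)) % (3 * l) = i * l := by
      rw [add_emod_of_lt hidef.symm (by omega) hil2]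
      ring
    refine ⟨ancilla r₀ hcube, mem_spread.mpr ⟨hcube, fun j => ?_⟩, Subtype.ext ?_⟩
    · rcases eq_or_ne j r with rfl | hj
      · change _ ∣ Function.update y.1 j _ j
        rw [Function.update_self, hlZ]
        refine (EuclideanDomain.dvd_mod_iff (Dvd.intro_left (3 : ℤ) rfl)).mp ?_
        rw [hxr]
        exact Dvd.intro_left _ rfl
      · change _ ∣ Function.update y.1 r _ j
        rw [Function.update_of_ne hj]
        exact hdvd j hj
    · rw [key (ancilla r₀ hcube) hcube i h0 hi
        ((congrArg (· % (3 * l : ℤ)) (Function.update_self _ _ _)).trans hxr)]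
      change Function.update (Function.update y.1 r _) r (Function.update y.1 r _ r - _) = y.1
      rw [Function.update_idem, Function.update_self, add_sub_cancel_right, Function.update_eq_self]

/-- The trios of one cycle: three consecutive sites along the axis `r`, of which the first stays in
use. -/
theorem exists_trios {e : Fin d → ℕ} {r : Fin d} (he : e r < m) :
    ∃ (n : ℕ) (t : Fin n × Fin 3 ↪ resetSites r₀ m),
      Finset.univ.image t = gathered r₀ m e r ∧
      (Finset.univ.image fun j => t (j, 0)) = spread r₀ m (Function.update e r (e r + 1)) ∧
      ∀ (j : Fin n) (i i' : Fin 3), (i : ℕ) + 1 = i' → latticeAdj _ (t (j, i)) (t (j, i')) := by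
  set M : ℤ := 3 ^ (e r + 1) with hMdef
  have hM : M ∣ 3 ^ m := pow_dvd_pow 3 he
  have hM3 : 3 ≤ M := by
    rw [hMdef, pow_succ]
    have : (1 : ℤ) ≤ 3 ^ e r := one_le_pow₀ (by norm_num)
    linarith
  set P := spread r₀ m (Function.update e r (e r + 1)) with hP
  have hPr : ∀ x ∈ P, x.1 r % M = 0 := by
    intro x hx
    have := (mem_spread.mp hx).2 r
    rw [Function.update_self] at this
    exact Int.emod_eq_zero_of_dvd this
  have hcube : ∀ (x : P) (i : Fin 3), Function.update x.1.1 r (x.1.1 r + (i : ℕ)) ∈ cube d m := by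
    intro x i
    have h1 := (mem_spread.mp x.2).1
    have h2 := mem_cube.mp h1 r
    have h3 := hPr _ x.2
    exact update_mem_cube h1 r (by omega)
      (add_lt_of_emod hM h2.2 h3 (by have := i.2; omega) (by omega))
  let f : P × Fin 3 → resetSites r₀ m := fun p => ancilla r₀ (hcube p.1 p.2)
  have hf : ∀ p, (f p).1 = Function.update p.1.1.1 r (p.1.1.1 r + (p.2 : ℕ)) := fun _ => rfl
  have hmod : ∀ (x : P) (i : Fin 3), (x.1.1 r + (i : ℕ)) % M = (i : ℕ) := by
    intro x i
    have := i.2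
    rw [add_emod_of_lt (hPr _ x.2) (by omega) (by omega), zero_add]
  have hinj : Function.Injective f := by
    rintro ⟨x, i⟩ ⟨y, j⟩ hxy
    have h1 := congrArg Subtype.val hxy
    rw [hf, hf] at h1
    have h2 := congrFun h1 r
    simp only [Function.update_self] at h2
    have h3 : i = j := by
      have := congrArg (· % M) h2
      simp only [hmod] at this
      exact Fin.ext (by exact_mod_cast this)
    subst h3
    refine Prod.ext (Subtype.ext (Subtype.ext (funext fun k => ?_))) rfl
    rcases eq_or_ne k r with rfl | hk
    · exact add_right_cancel h2
    · have := congrFun h1 k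
      rwa [Function.update_of_ne hk, Function.update_of_ne hk] at this
  let g := P.equivFin.symm
  refine ⟨P.card, ((g.prodCongr (Equiv.refl _)).toEmbedding.trans ⟨f, hinj⟩), ?_, ?_, ?_⟩
  · ext y
    rw [Finset.mem_image, mem_gathered, ← hMdef]
    constructor
    · rintro ⟨⟨j, i⟩, -, rfl⟩
      change (f (g j, i)).1 ∈ _ ∧ (∀ k, k ≠ r → _ ∣ (f (g j, i)).1 k) ∧ (f (g j, i)).1 r % M < 3
      refine ⟨hcube _ _, fun k hk => ?_, ?_⟩
      · rw [hf, Function.update_of_ne hk]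
        have := (mem_spread.mp (g j).2).2 k
        rwa [Function.update_of_ne hk] at this
      · rw [hf, Function.update_self, hmod]
        exact_mod_cast i.2
    · rintro ⟨hy, hdvd, hlt⟩
      have h0 : 0 ≤ y.1 r % M := Int.emod_nonneg _ (by omega)
      have h1 := Int.emod_add_mul_ediv (y.1 r) M
      have h2 : 0 ≤ M * (y.1 r / M) :=
        mul_nonneg (by omega) (Int.ediv_nonneg (mem_cube.mp hy r).1 (by omega))
      obtain ⟨i, hi⟩ := Int.eq_ofNat_of_zero_le h0
      have hxcube := update_mem_cube hy r (v := M * (y.1 r / M)) h2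
        (by linarith [(mem_cube.mp hy r).2])
      have hxP : ancilla r₀ hxcube ∈ P := by
        refine mem_spread.mpr ⟨hxcube, fun k => ?_⟩
        change _ ∣ Function.update y.1 r _ k
        rcases eq_or_ne k r with rfl | hk
        · rw [Function.update_self, Function.update_self]
          exact Dvd.intro _ rfl
        · rw [Function.update_of_ne hk, Function.update_of_ne hk]
          exact hdvd k hk
      refine ⟨(P.equivFin ⟨_, hxP⟩, ⟨i, by omega⟩), Finset.mem_univ _, Subtype.ext ?_⟩
      change (f (g (P.equivFin ⟨_, hxP⟩), ⟨i, _⟩)).1 = y.1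
      rw [Equiv.symm_apply_apply, hf]
      change Function.update (Function.update y.1 r _) r (Function.update y.1 r _ r + _) = y.1
      rw [Function.update_idem, Function.update_self, Function.update_eq_self_iff]
      change M * (y.1 r / M) + (i : ℤ) = y.1 r
      linarith
  · have hf0 : ∀ x : P, f (x, 0) = x := by
      intro x
      refine Subtype.ext ?_
      rw [hf]
      simp
    ext y
    rw [Finset.mem_image]
    constructor
    · rintro ⟨j, -, rfl⟩
      change f (g j, 0) ∈ P
      rw [hf0]
      exact (g j).2
    · intro hy
      refine ⟨P.equivFin ⟨y, hy⟩, Finset.mem_univ _, ?_⟩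
      change f (g (P.equivFin ⟨y, hy⟩), 0) = y
      rw [Equiv.symm_apply_apply, hf0]
  · intro j i i' h
    refine latticeAdj_of_update (hf (g j, i)) (hf (g j, i')) ?_
    rw [← h]
    simp

end Geometry

/-! ### The compound compressor in the cube -/

section Compound

open scoped Matrix.Norms.Frobenius

variable {d m : ℕ} {r₀ : Fin d}

/-- The layers of one cycle: the gates of the elementary compressor, on all trios in parallel. -/
theorem exists_compress {n : ℕ} {t : Fin n × Fin 3 ↪ resetSites r₀ m}
    (ht : ∀ (j : Fin n) (i i' : Fin 3), (i : ℕ) + 1 = i' → latticeAdj _ (t (j, i)) (t (j, i')))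
    {Vs : List (RegOp (Fin 3))} (hVs : ∀ V ∈ Vs, IsLineGate V) :
    ∃ L : List (Layer (latticeAdj (resetSites r₀ m))),
      List.Forall₂ (fun ℓ V => ℓ.unitary = embedOp t (blockTensor fun _ => V)) L Vs := by
  induction Vs with
  | nil => exact ⟨[], .nil⟩
  | cons V Vs ih =>
    obtain ⟨L, hL⟩ := ih fun V hV => hVs V (List.mem_cons_of_mem _ hV)
    obtain ⟨a, w, u, h1, h2, hu, hw, rfl⟩ := hVs V List.mem_cons_self
    obtain ⟨ℓ, hℓ⟩ := exists_blockLayer (Adj := latticeAdj (resetSites r₀ m)) t h1 h2 w u hu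
      fun j i i' hi => (hw i i' hi).elim (fun h => ht _ _ _ h) fun h => latticeAdj_symm (ht _ _ _ h)
    exact ⟨ℓ :: L, .cons hℓ hL⟩

/-- A cycle that starts with independent qubits of polarization `u` ends with the polarization `u'`.
It consists of the noisy gates `Vs` on every trio, `n` further time steps, and a rotation that
aligns the Bloch vector with the `Z` axis. -/
def IsCycle (N : SuperOp) (Vs : List (RegOp (Fin 3))) (u : ℝ) (n : ℕ) (u' : ℝ) : Prop :=
  ∃ V ∈ Matrix.unitaryGroup (Fin 2) ℂ,
    V * N^[n] (headState (blockRun N Vs (tensorOp fun _ => N (zState u)))) * V.conjTranspose =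
      zState u'

/-- A compound compressor that starts with trios along the axis `r` when the current qubits have the
spacing `3 ^ e i` along the axis `i`; every cycle increases one exponent, until all are `m` and only
the origin is left. If every cycle takes the polarization `u` to some `u'` with `R u u'`, then its
output has the polarization at the end of a chain of such steps. -/
theorem exists_isCQC {N : SuperOp} (hN : ∀ X, (N X).trace = X.trace) {Vs : List (RegOp (Fin 3))}
    (hVs : ∀ V ∈ Vs, IsLineGate V) (hU : Vs.foldl (fun W V => V * W) 1 = trioOp)
    {R : ℝ → ℝ → Prop} (hR : ∀ u, 0 ≤ u → ∀ n ≤ 3 ^ m, ∃ u', 0 ≤ u' ∧ R u u' ∧ IsCycle N Vs u n u')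
    (j : ℕ) : ∀ (e : Fin d → ℕ) (r : Fin d) (u : ℝ), (∀ i, e i ≤ m) → e r < m →
      ∑ i, (m - e i) = j + 1 → 0 ≤ u →
      ∃ L : List (Layer (latticeAdj (resetSites r₀ m))),
        IsCQC (target r₀ m) (j + 1) L (gathered r₀ m e r) (origin r₀ m) ∧
        L.length ≤ (j + 1) * (Vs.length + 3 ^ m + 1) ∧
        ∃ v : ℕ → ℝ, v 0 = u ∧ (∀ i, 0 ≤ v i) ∧ (∀ i ≤ j, R (v i) (v (i + 1))) ∧
          ∀ ρ, ProductOn (gathered r₀ m e r) (N (zState u)) ρ →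
            ProductOn {origin r₀ m} (N (zState (v (j + 1)))) (noisyRun N L ρ) := by
  induction j with
  | zero =>
    intro e r u he her hsum hu
    obtain ⟨n, t, ht, ht0, hadj⟩ := exists_trios (r₀ := r₀) her
    obtain ⟨L, hL⟩ := exists_compress hadj hVs
    obtain ⟨u', hu', hRu, V, hV, hVu⟩ := hR u hu 0 (Nat.zero_le _)
    have hlast : Function.update e r (e r + 1) = fun _ => m := by
      have h1 : ∑ i ∈ Finset.univ.erase r, (m - e i) = 0 := by
        rw [← Finset.add_sum_erase _ _ (Finset.mem_univ r)] at hsum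
        omega
      have h2 : m - e r = 1 := by
        rw [← Finset.add_sum_erase _ _ (Finset.mem_univ r), h1] at hsum
        omega
      funext i
      rcases eq_or_ne i r with rfl | hi
      · rw [Function.update_self]
        omega
      · rw [Function.update_of_ne hi]
        have := Finset.sum_eq_zero_iff.mp h1 i (Finset.mem_erase.mpr ⟨hi, Finset.mem_univ i⟩)
        have := he i
        omega
    rw [hlast, spread_const] at ht0
    have hrest : IsCQC (Adj := latticeAdj (resetSites r₀ m)) (target r₀ m) 0 []
        (Finset.univ.image fun j => (1 : Equiv.Perm (resetSites r₀ m)) (t (j, 0)))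
        (origin r₀ m) := by
      simp only [Equiv.Perm.one_apply]
      rw [ht0]
      exact .done _
    have hideal : idealUnitary L = embedOp t (compressorOp n) := by
      rw [idealUnitary_blocks hL, hU, compressorOp_eq_blockTensor]
      rfl
    refine ⟨L ++ [rotationLayer _ hV], ?_, ?_,
      fun i => Nat.casesOn i u fun _ => u', rfl, ?_, ?_, ?_⟩
    · have := IsCQC.cycle n 0 t L [rotationLayer _ hV] [] 1 (origin r₀ m) hideal
        (IsPermRun.nil.append_rotation hV) rfl hrest
      rwa [ht, List.append_nil] at this
    · rw [List.length_append, List.length_singleton, hL.length_eq, zero_add, one_mul]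
      linarith [Nat.zero_le (3 ^ m)]
    · rintro (_ | i)
      · exact hu
      · exact hu'
    · intro i hi
      obtain rfl : i = 0 := by omega
      exact hRu
    · intro ρ hρ
      rw [← ht] at hρ
      have h1 := (hρ.noisyRun_blocks hN hL).rotationLayer
        (Adj := latticeAdj (resetSites r₀ m)) hN hV
      rw [Function.iterate_zero_apply] at hVu
      rw [ht0, hVu] at h1
      rwa [noisyRun_append]
  | succ j ih =>
    intro e r u he her hsum hu
    obtain ⟨n, t, ht, ht0, hadj⟩ := exists_trios (r₀ := r₀) her
    obtain ⟨L, hL⟩ := exists_compress hadj hVs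
    set e' := Function.update e r (e r + 1) with he'
    have he'm : ∀ i, e' i ≤ m := by
      intro i
      rcases eq_or_ne i r with rfl | hi
      · rw [he', Function.update_self]
        exact her
      · rw [he', Function.update_of_ne hi]
        exact he i
    have hsum' : ∑ i, (m - e' i) = j + 1 := by
      rw [← Finset.add_sum_erase _ _ (Finset.mem_univ r)] at hsum ⊢
      have h1 : ∑ i ∈ Finset.univ.erase r, (m - e' i) = ∑ i ∈ Finset.univ.erase r, (m - e i) :=
        Finset.sum_congr rfl fun i hi => by
          rw [he', Function.update_of_ne (Finset.ne_of_mem_erase hi)]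
      rw [h1, he', Function.update_self]
      omega
    obtain ⟨r', hr'⟩ : ∃ r', e' r' < m := by
      by_contra! h
      have : ∑ i, (m - e' i) = 0 := Finset.sum_eq_zero fun i _ => Nat.sub_eq_zero_of_le (h i)
      omega
    obtain ⟨G, π, hGlen, hGπ, hπ, hGim⟩ := exists_gather (r₀ := r₀) hr'
    obtain ⟨u', hu', hRu, V, hV, hVu⟩ := hR u hu G.length hGlen
    obtain ⟨L', hL', hlen', v, hv0, hvn, hvR, hv⟩ := ih e' r' u' he'm hr' hsum' hu'
    have hideal : idealUnitary L = embedOp t (compressorOp n) := by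
      rw [idealUnitary_blocks hL, hU, compressorOp_eq_blockTensor]
      rfl
    have him : (Finset.univ.image fun j => π (t (j, 0))) = gathered r₀ m e' r' := by
      rw [← hGim, ← ht0, Finset.image_image]
      rfl
    refine ⟨L ++ (G ++ [rotationLayer _ hV]) ++ L', ?_, ?_, fun i => Nat.casesOn i u v, rfl, ?_, ?_,
      ?_⟩
    · have := IsCQC.cycle n (j + 1) t L (G ++ [rotationLayer _ hV]) L' π (origin r₀ m) hideal
        (hGπ.append_rotation hV) hπ (by rw [him]; exact hL')
      rwa [ht] at this
    · rw [List.length_append, List.length_append, List.length_append, List.length_singleton,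
        hL.length_eq, add_mul (j + 1) 1, one_mul]
      omega
    · rintro (_ | i)
      · exact hu
      · exact hvn i
    · rintro (_ | i) hi
      · change R u (v 0)
        rw [hv0]
        exact hRu
      · exact hvR i (by omega)
    · intro ρ hρ
      rw [← ht] at hρ
      have h1 := ((hρ.noisyRun_blocks hN hL).permRun hN hGπ).rotationLayer
        (Adj := latticeAdj (resetSites r₀ m)) hN hV
      rw [ht0, hGim, hVu] at h1
      rw [noisyRun_append, noisyRun_append, noisyRun_append]
      exact hv _ h1

/-- A RESET circuit in the cube, with `n` idle steps and a rotation `V` in the settling stage, where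
the polarization `u` is reached, and any rotation `W` after the final swap. -/
theorem exists_resetCircuit {N : SuperOp} (hN : ∀ X, (N X).trace = X.trace)
    {Vs : List (RegOp (Fin 3))} (hVs : ∀ V ∈ Vs, IsLineGate V)
    (hU : Vs.foldl (fun W V => V * W) 1 = trioOp) (hm : 1 ≤ m) (r₀ : Fin d)
    {R : ℝ → ℝ → Prop} (hR : ∀ u, 0 ≤ u → ∀ n ≤ 3 ^ m, ∃ u', 0 ≤ u' ∧ R u u' ∧ IsCycle N Vs u n u')
    {n : ℕ} {V : Matrix (Fin 2) (Fin 2) ℂ} (hV : V ∈ Matrix.unitaryGroup (Fin 2) ℂ) {u : ℝ}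
    (hu : 0 ≤ u) (hVu : V * N^[n + 1] ((1 / 2 : ℂ) • 1) * V.conjTranspose = zState u) :
    ∃ v : ℕ → ℝ, v 0 = u ∧ (∀ i, 0 ≤ v i) ∧ (∀ i < d * m, R (v i) (v (i + 1))) ∧
      ∀ W ∈ Matrix.unitaryGroup (Fin 2) ℂ,
        ∃ C : ResetCircuit (latticeAdj (resetSites r₀ m)) (target r₀ m),
          C.depth ≤ n + 4 + d * m * (Vs.length + 3 ^ m + 1) ∧
          ∀ ρ, IsDensity ρ → polarization (target r₀ m) (C.run N ρ) =
            (pauli 3 * N (W * N (N (zState (v (d * m)))) * W.conjTranspose)).trace.re := by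
  have hd : 1 ≤ d := Fin.pos r₀
  obtain ⟨j, hj⟩ : ∃ j, d * m = j + 1 := ⟨d * m - 1, by have := Nat.mul_pos hd hm; omega⟩
  obtain ⟨L, hL, hlen, v, hv0, hvn, hvR, hv⟩ := exists_isCQC (r₀ := r₀) hN hVs hU hR j 0 r₀ u
    (fun _ => Nat.zero_le _) hm (by simpa using hj) hu
  rw [← hj] at hL hlen hv
  refine ⟨v, hv0, hvn, fun i hi => hvR i (by omega), fun W hW => ?_⟩
  rw [gathered_zero] at hL hv
  obtain ⟨ℓ, s, hℓ, hs1, hs2, hs3⟩ := exists_swapLayer (ι := Unit)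
    (Adj := latticeAdj (resetSites r₀ m)) (fun _ => origin r₀ m) (fun _ => target r₀ m)
    (fun _ => latticeAdj_origin_target) (fun _ => latticeAdj_symm latticeAdj_origin_target)
    (fun _ _ _ => rfl) (fun _ _ _ => rfl) fun _ _ => ne_target.mpr (mem_cube.mpr fun _ =>
      ⟨le_rfl, by simp [origin, ancilla]⟩)
  have hs : s = Equiv.swap (origin r₀ m) (target r₀ m) := by
    ext1 x
    by_cases h1 : x = origin r₀ m
    · rw [h1, hs1 (), Equiv.swap_apply_left]
    by_cases h2 : x = target r₀ m
    · rw [h2, hs2 (), Equiv.swap_apply_right]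
    rw [hs3 x (fun _ => h1) fun _ => h2, Equiv.swap_apply_of_ne_of_ne h1 h2]
  have hswap : IsPermRun [ℓ] (Equiv.swap (origin r₀ m) (target r₀ m)) := by
    have := IsPermRun.cons ℓ [] s 1 hℓ .nil
    rwa [one_mul, hs] at this
  refine ⟨⟨List.replicate n (idleLayer _) ++ [rotationLayer _ hV], ?_, d * m, L, origin r₀ m, hL,
    [ℓ] ++ [rotationLayer _ hW], hswap.append_rotation hW⟩, ?_, fun ρ hρ => ?_⟩
  · intro ℓ' hℓ' g hg
    rcases List.mem_append.mp hℓ' with h | h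
    · rw [List.eq_of_mem_replicate h] at hg
      exact (List.not_mem_nil hg).elim
    · rw [List.mem_singleton.mp h] at hg
      exact rotationLayer_arity hV g hg
  · simp only [ResetCircuit.depth, List.length_append, List.length_replicate, List.length_singleton]
    omega
  · have h1 := (((productOn_randomize (target r₀ m) hρ.2).noiseLayer hN).idle
      (Adj := latticeAdj (resetSites r₀ m)) hN n).rotationLayer
      (Adj := latticeAdj (resetSites r₀ m)) hN hV
    rw [← Function.iterate_succ_apply, hVu] at h1
    have h2 := ((hv _ h1).permRun hN hswap).rotationLayer
      (Adj := latticeAdj (resetSites r₀ m)) hN hW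
    rw [Finset.image_singleton, Equiv.swap_apply_left] at h2
    have h3 := h2.polarization
    rw [ResetCircuit.run]
    simp only [noisyRun_append]
    exact h3

end Compound

/-! ### The growth of the polarization -/

section Growth

/-- One cycle, with an error `s (u + η)`, at a polarization `u ≥ b` where this error is small. -/
theorem boost_step {u u' s η b γ lam : ℝ} (hb : 0 < b) (hb1 : b ≤ 9 / 10) (hγ : γ ≤ 1 / 100)
    (hγ0 : 0 ≤ γ) (hlam : 4 * γ ≤ 3 / 2 - lam) (hs : s ≤ γ) (hsη : s * η ≤ γ * b)
    (hu : b ≤ u) (hu1 : u ≤ 11 / 10) (h : |u' - boost u| ≤ s * (u + η)) :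
    (b ≤ u' ∧ u' ≤ 11 / 10) ∧ (u ≤ √(3 / 2 - lam) → lam * u ≤ u') ∧
      (21 / 20 * u ≤ u' ∨ 9 / 10 ≤ u') := by
  have hu0 : 0 < u := hb.trans_le hu
  have herr : |u' - boost u| ≤ 2 * γ * u := by
    have h1 : γ * b ≤ γ * u := mul_le_mul_of_nonneg_left hu hγ0
    have h2 : s * u ≤ γ * u := mul_le_mul_of_nonneg_right hs hu0.le
    linarith
  obtain ⟨h1, h2⟩ := abs_le.mp herr
  have hγu : γ * u ≤ 1 / 100 * u := mul_le_mul_of_nonneg_right hγ hu0.le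
  rw [boost] at h1 h2
  have h9 : 21 / 20 * u ≤ u' ∨ 9 / 10 ≤ u' := by
    rcases le_total u (9 / 10) with h9 | h9
    · left
      have h3 : u * u ^ 2 ≤ u * (81 / 100) := mul_le_mul_of_nonneg_left (by nlinarith) hu0.le
      nlinarith
    · right
      have h3 : 0 ≤ (u - 9 / 10) * (11 / 10 - u) * (u + 2) :=
        mul_nonneg (mul_nonneg (by linarith) (by linarith)) (by linarith)
      nlinarith
  refine ⟨⟨?_, ?_⟩, fun hul => ?_, h9⟩
  · rcases h9 with h9 | h9 <;> linarith
  · nlinarith [mul_nonneg (sq_nonneg (u - 1)) (show 0 ≤ u + 2 by linarith)]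
  · have h3 : u ^ 2 ≤ 3 / 2 - lam := by
      have h4 : (0 : ℝ) ≤ 3 / 2 - lam := by linarith
      calc u ^ 2 ≤ √(3 / 2 - lam) ^ 2 := by gcongr
        _ = _ := Real.sq_sqrt h4
    have h4 : u * u ^ 2 ≤ u * (3 / 2 - lam) := mul_le_mul_of_nonneg_left h3 hu0.le
    have h5 : 4 * γ * u ≤ (3 / 2 - lam) * u := mul_le_mul_of_nonneg_right hlam hu0.le
    nlinarith

/-- Close to full polarization the error is squared in every cycle. -/
theorem boost_step_near_one {u u' s η D a : ℝ} (hu : |1 - u| ≤ 1 / 10) (hs : 0 ≤ s)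
    (hD : s * (11 / 10 + η) ≤ D) (hD1 : D ≤ 1 / 8) (h : |u' - boost u| ≤ s * (u + η))
    (ha : 4 * |1 - u| ≤ max a (8 * D)) : 4 * |1 - u'| ≤ max (a ^ 2) (8 * D) := by
  have hu1 := (abs_le.mp hu)
  have h1 : |1 - u'| ≤ 2 * |1 - u| ^ 2 + D := by
    have h2 : 1 - u' = (1 - u) ^ 2 * ((u + 2) / 2) - (u' - boost u) := by
      rw [boost]
      ring
    rw [h2, sq_abs]
    refine (abs_sub _ _).trans (add_le_add ?_ ?_)
    · rw [abs_mul, abs_of_nonneg (sq_nonneg _), mul_comm]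
      refine mul_le_mul_of_nonneg_right ?_ (sq_nonneg _)
      exact abs_le.mpr ⟨by linarith, by linarith⟩
    · refine h.trans (le_trans ?_ hD)
      gcongr
      linarith
  have hy : 0 ≤ 4 * |1 - u| := by positivity
  have hD0 : 0 ≤ D := by
    linarith [abs_nonneg (u' - boost u), mul_le_mul_of_nonneg_left
      (show u + η ≤ 11 / 10 + η by linarith) hs]
  rcases le_max_iff.mp ha with h3 | h3
  · have h4 : (4 * |1 - u|) ^ 2 ≤ a ^ 2 := pow_le_pow_left₀ hy h3 2
    rcases le_total (a ^ 2) (8 * D) with h5 | h5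
    · exact le_max_of_le_right (by nlinarith)
    · exact le_max_of_le_left (by nlinarith)
  · have h4 : (4 * |1 - u|) ^ 2 ≤ (8 * D) ^ 2 := pow_le_pow_left₀ hy h3 2
    exact le_max_of_le_right (by nlinarith [mul_nonneg hD0 (sub_nonneg.mpr hD1)])

/-- The polarization grows by the factor `lam` per cycle while it is small, then by a constant
factor, and finally the distance to `1` decreases doubly exponentially, until it is of the order of
the error of one cycle. -/
theorem abs_one_sub_le_of_boost {v : ℕ → ℝ} {s η b γ lam D : ℝ} {k₁ k₂ k₃ : ℕ} (hb : 0 < b)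
    (hb1 : b ≤ 9 / 10) (hγ : γ ≤ 1 / 100) (hγ0 : 0 ≤ γ) (hlam1 : 1 ≤ lam)
    (hlam : 4 * γ ≤ 3 / 2 - lam) (hs0 : 0 ≤ s) (hs : s ≤ γ) (hsη : s * η ≤ γ * b)
    (hv0 : b ≤ v 0) (hv1 : v 0 ≤ 11 / 10)
    (hrec : ∀ i < k₁ + k₂ + k₃, v i ≤ 6 / 5 → |v (i + 1) - boost (v i)| ≤ s * (v i + η))
    (hk₁ : √(3 / 2 - lam) ≤ lam ^ k₁ * b) (hk₂ : 9 / 10 ≤ (21 / 20) ^ k₂ * √(3 / 2 - lam))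
    (hD : s * (11 / 10 + η) ≤ D) (hD1 : D ≤ 1 / 80) (hk₃ : (1 / 2 : ℝ) ^ 2 ^ k₃ ≤ 8 * D) :
    |1 - v (k₁ + k₂ + k₃)| ≤ 2 * D := by
  have hinv : ∀ i ≤ k₁ + k₂ + k₃, b ≤ v i ∧ v i ≤ 11 / 10 := by
    intro i
    induction i with
    | zero => exact fun _ => ⟨hv0, hv1⟩
    | succ i ih =>
      intro hi
      obtain ⟨h1, h2⟩ := ih (by omega)
      exact (boost_step hb hb1 hγ hγ0 hlam hs hsη h1 h2
        (hrec i (by omega) (by linarith))).1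
  have hstep : ∀ i < k₁ + k₂ + k₃, (v i ≤ √(3 / 2 - lam) → lam * v i ≤ v (i + 1)) ∧
      (21 / 20 * v i ≤ v (i + 1) ∨ 9 / 10 ≤ v (i + 1)) := by
    intro i hi
    obtain ⟨h1, h2⟩ := hinv i hi.le
    exact (boost_step hb hb1 hγ hγ0 hlam hs hsη h1 h2 (hrec i hi (by linarith))).2
  set U := √(3 / 2 - lam) with hU
  have hU1 : U ≤ 9 / 10 := by
    rw [hU]
    exact (Real.sqrt_le_sqrt (show 3 / 2 - lam ≤ (9 / 10) ^ 2 by norm_num; linarith)).trans_eq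
      (Real.sqrt_sq (by norm_num))
  have hU0 : 0 ≤ U := Real.sqrt_nonneg _
  -- exponential growth
  have hA : ∀ i ≤ k₁, min (lam ^ i * b) U ≤ v i := by
    intro i
    induction i with
    | zero =>
      intro _
      rw [pow_zero, one_mul]
      exact (min_le_left _ _).trans hv0
    | succ i ih =>
      intro hi
      have h1 := ih (by omega)
      obtain ⟨h2, h3⟩ := hstep i (by omega)
      rcases le_total (v i) U with h4 | h4
      · rcases min_le_iff.mp h1 with h5 | h5
        · refine (min_le_left _ _).trans ((?_ : _ ≤ lam * v i).trans (h2 h4))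
          rw [pow_succ, mul_assoc, mul_left_comm]
          exact mul_le_mul_of_nonneg_left h5 (by linarith)
        · refine (min_le_right _ _).trans (le_trans ?_ (h2 h4))
          nlinarith
      · refine (min_le_right _ _).trans ?_
        rcases h3 with h3 | h3 <;> linarith
  have hA1 : U ≤ v k₁ := by
    have := hA k₁ le_rfl
    rwa [min_eq_right hk₁] at this
  have hB : ∀ i ≤ k₂, min ((21 / 20) ^ i * U) (9 / 10) ≤ v (k₁ + i) := by
    intro i
    induction i with
    | zero =>
      intro _
      rw [pow_zero, one_mul]
      exact (min_le_left _ _).trans hA1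
    | succ i ih =>
      intro hi
      have h1 := ih (by omega)
      rcases (hstep (k₁ + i) (by omega)).2 with h3 | h3
      · rcases min_le_iff.mp h1 with h5 | h5
        · refine (min_le_left _ _).trans (le_trans ?_ h3)
          rw [pow_succ, mul_assoc, mul_left_comm]
          exact mul_le_mul_of_nonneg_left h5 (by norm_num)
        · refine (min_le_right _ _).trans (le_trans ?_ h3)
          linarith
      · exact (min_le_right _ _).trans h3
  have hC : ∀ i ≤ k₃, 9 / 10 ≤ v (k₁ + k₂ + i) ∧
      4 * |1 - v (k₁ + k₂ + i)| ≤ max ((1 / 2) ^ 2 ^ i) (8 * D) := by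
    intro i
    induction i with
    | zero =>
      intro _
      have h1 := hB k₂ le_rfl
      rw [min_eq_right hk₂] at h1
      refine ⟨h1, le_max_of_le_left ?_⟩
      have h2 : |1 - v (k₁ + k₂)| ≤ 1 / 10 :=
        abs_le.mpr ⟨by linarith [(hinv (k₁ + k₂) (by omega)).2], by linarith⟩
      rw [pow_zero, pow_one, add_zero]
      linarith
    | succ i ih =>
      intro hi
      obtain ⟨h1, h2⟩ := ih (by omega)
      have h3 := (hinv (k₁ + k₂ + i) (by omega)).2
      refine ⟨?_, ?_⟩
      · rcases (hstep (k₁ + k₂ + i) (by omega)).2 with h4 | h4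
        · exact le_trans (by linarith) h4
        · exact h4
      · have h4 : |1 - v (k₁ + k₂ + i)| ≤ 1 / 10 := abs_le.mpr ⟨by linarith, by linarith⟩
        rw [pow_succ, pow_mul]
        exact boost_step_near_one h4 hs0 hD (by linarith)
          (hrec (k₁ + k₂ + i) (by omega) (by linarith)) h2
  have := (hC k₃ le_rfl).2
  rw [max_eq_right hk₃] at this
  linarith

/-- A number of steps after which growth by the factor `a` has exceeded `x`, and its effect on the
number of qubits. -/
theorem exists_pow_ge {a x : ℝ} (ha : 1 < a) (hx : 1 ≤ x) :
    ∃ n : ℕ, x ≤ a ^ n ∧ (3 : ℝ) ^ n ≤ 3 * x ^ (Real.log 3 / Real.log a) := by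
  have hla : 0 < Real.log a := Real.log_pos ha
  have hl3 : 0 < Real.log 3 := Real.log_pos (by norm_num)
  have hx0 : 0 < x := by linarith
  refine ⟨⌈Real.log x / Real.log a⌉₊, ?_, ?_⟩
  · have h1 := Nat.le_ceil (Real.log x / Real.log a)
    rw [div_le_iff₀ hla, ← Real.log_pow] at h1
    exact (Real.log_le_log_iff hx0 (by positivity)).mp h1
  · have h1 := (Nat.ceil_lt_add_one (div_nonneg (Real.log_nonneg hx) hla.le)).le
    rw [← Real.log_le_log_iff (by positivity) (by positivity), Real.log_mul (by norm_num)
      (by positivity), Real.log_pow, Real.log_rpow hx0]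
    calc _ ≤ (Real.log x / Real.log a + 1) * Real.log 3 := by gcongr
      _ = _ := by ring

/-- The size of the cube: its edge `3 ^ m` is such that `d m` cycles suffice, while the number of
qubits and the duration of the compression stay within the required bounds. -/
theorem exists_edge {d : ℕ} (hd : 1 ≤ d) {lam μ : ℝ} (hlam : 1 < lam)
    (hμ : Real.log 3 / Real.log lam < μ) (b : ℝ) (k₂ : ℕ) {θ : ℝ} (hθ : 0 < θ) :
    ∃ ε₀ > 0, ∃ B > 0, ∀ ε w : ℝ, 0 < w → w ≤ ε → ε ≤ ε₀ → ∃ m k₁ k₃ : ℕ, 1 ≤ m ∧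
      k₁ + k₂ + k₃ = d * m ∧ b ≤ lam ^ k₁ * w ∧ (1 / 2 : ℝ) ^ 2 ^ k₃ ≤ ε ^ 2 ∧
      (3 : ℝ) ^ (d * m) ≤ B * (|Real.log ε| ^ Real.logb 2 3 / w ^ μ) ∧
      ((d * m : ℕ) + 1) * (3 ^ m + 1) ≤ θ * w ^ (-(μ / d)) := by
  set μ' := Real.log 3 / Real.log lam with hμ'
  set α := Real.logb 2 3 with hα
  have hl3 : 0 < Real.log 3 := Real.log_pos (by norm_num)
  have hl3' : 1 ≤ Real.log 3 := by
    rw [Real.le_log_iff_exp_le (by norm_num)]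
    linarith [Real.exp_one_lt_d9]
  have hμ'0 : 0 < μ' := div_pos hl3 (Real.log_pos hlam)
  have hα0 : 0 < α := Real.logb_pos (by norm_num) (by norm_num)
  have hd0 : (0 : ℝ) < d := by exact_mod_cast hd
  have hμ0 : 0 < μ := hμ'0.trans hμ
  -- half of the gap between the exponents `μ'` and `μ` absorbs the power of the logarithm, and half
  -- of the rest the number of cycles
  set μ₂ := (μ' + μ) / 2 with hμ₂
  have hμ₂0 : 0 < μ₂ := by positivity
  set β' := (μ - μ') / (2 * α) with hβ'
  have hβ'0 : 0 < β' := div_pos (by linarith) (by positivity)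
  have hβ'μ : μ' + α * β' = μ₂ := by
    rw [hβ', hμ₂]
    field_simp
    ring
  set β := (μ - μ₂) / (2 * (d * μ₂)) with hβ
  have hβ0 : 0 < β := div_pos (by linarith) (by positivity)
  set γ := (μ - μ₂) / (2 * d) with hγ
  have hγ0 : 0 < γ := div_pos (by linarith) (by positivity)
  have hβγ : -(μ₂ * (β + 1 / d)) = γ + -(μ / d) := by
    rw [hβ, hγ]
    field_simp
    ring
  set b' := max b 1 with hb'
  have hb'1 : 1 ≤ b' := le_max_right _ _
  set K₁ : ℝ := 3 ^ (d + k₂) * 9 * b' ^ μ' * 4 ^ α with hK₁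
  have hK₁0 : 0 < K₁ := by positivity
  set K₂ : ℝ := (1 / β + 1) * 2 * (K₁ * (1 / β') ^ α) ^ (β + 1 / d) with hK₂
  have hK₂0 : 0 < K₂ := by positivity
  refine ⟨min (1 / 4) ((θ / K₂) ^ (1 / γ)), by positivity, K₁, hK₁0, fun ε w hw hwε hε => ?_⟩
  have hε0 : 0 < ε := hw.trans_le hwε
  have hε4 : ε ≤ 1 / 4 := hε.trans (min_le_left _ _)
  have hw1 : w ≤ 1 := by linarith
  set l := |Real.log ε| with hl
  have hlneg : Real.log ε < 0 := Real.log_neg hε0 (by linarith)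
  have hleq : l = -Real.log ε := abs_of_neg hlneg
  have hl1 : 1 ≤ l := by
    have h1 : Real.log ε ≤ Real.log (1 / 4) := Real.log_le_log hε0 hε4
    have h2 : Real.log (1 / 4) = -(2 * Real.log 2) := by
      rw [show (1 / 4 : ℝ) = (2 ^ 2)⁻¹ by norm_num, Real.log_inv, Real.log_pow]
      norm_num
    linarith [Real.log_two_gt_d9]
  have hbw : 1 ≤ b' / w := by
    rw [le_div_iff₀ hw]
    linarith
  obtain ⟨k₁, hk₁, hk₁'⟩ := exists_pow_ge hlam hbw
  obtain ⟨k₃, hk₃, hk₃'⟩ := exists_pow_ge one_lt_two (show 1 ≤ 4 * l by linarith)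
  rw [← hμ'] at hk₁'
  have hα' : Real.log 3 / Real.log 2 = α := rfl
  rw [hα'] at hk₃'
  set m := (k₁ + k₂ + k₃) / d + 1 with hm
  have hdm1 : k₁ + k₂ + k₃ ≤ d * m := (Nat.lt_mul_div_succ _ hd).le
  have hdm2 : d * m ≤ k₁ + k₂ + k₃ + d := by
    rw [hm, mul_add, mul_one]
    exact Nat.add_le_add_right (Nat.mul_div_le _ _) _
  have hX : (3 : ℝ) ^ (d * m) ≤ K₁ * (l ^ α * w ^ (-μ')) := by
    have h1 : (b' / w) ^ μ' = b' ^ μ' * w ^ (-μ') := by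
      rw [Real.div_rpow (by positivity) hw.le, Real.rpow_neg hw.le]
      rfl
    have h2 : (4 * l) ^ α = 4 ^ α * l ^ α := Real.mul_rpow (by norm_num) (by positivity)
    calc (3 : ℝ) ^ (d * m) ≤ 3 ^ (k₁ + k₂ + k₃ + d) := pow_le_pow_right₀ (by norm_num) hdm2
      _ = 3 ^ (d + k₂) * (3 ^ k₁ * 3 ^ k₃) := by ring
      _ ≤ 3 ^ (d + k₂) * (3 * (b' / w) ^ μ' * (3 * (4 * l) ^ α)) := by gcongr
      _ = _ := by rw [h1, h2, hK₁]; ring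
  have hwμ : w ^ (-μ') ≤ w ^ (-μ) := Real.rpow_le_rpow_of_exponent_ge hw hw1 (by linarith)
  refine ⟨m, k₁, d * m - k₁ - k₂, Nat.le_add_left _ _, by omega, ?_, ?_, ?_, ?_⟩
  · rw [div_le_iff₀ hw] at hk₁
    exact (le_max_left _ _).trans hk₁
  · have h1 : 2 ^ k₃ ≤ 2 ^ (d * m - k₁ - k₂) := Nat.pow_le_pow_right (by norm_num) (by omega)
    refine (pow_le_pow_of_le_one (by norm_num) (by norm_num) h1).trans ?_
    rw [← Real.log_le_log_iff (by positivity) (by positivity), Real.log_pow, Real.log_pow]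
    push_cast
    rw [one_div, Real.log_inv]
    have h2 : 4 * l * (1 / 2) ≤ 2 ^ k₃ * Real.log 2 :=
      mul_le_mul hk₃ (by linarith [Real.log_two_gt_d9]) (by norm_num) (by positivity)
    linarith
  · refine hX.trans (mul_le_mul_of_nonneg_left ?_ hK₁0.le)
    rw [div_eq_mul_inv, ← Real.rpow_neg hw.le]
    gcongr
  · set X : ℝ := 3 ^ (d * m) with hXdef
    have hX1 : 1 ≤ X := one_le_pow₀ (by norm_num)
    have hX0 : 0 < X := by linarith
    have hlw : l ≤ 1 / β' * w ^ (-β') := by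
      have h1 : Real.log (1 / w) ≤ (1 / w) ^ β' / β' := Real.log_le_rpow_div (by positivity) hβ'0
      rw [one_div, Real.log_inv, Real.inv_rpow hw.le, ← Real.rpow_neg hw.le] at h1
      have h2 := Real.log_le_log hw hwε
      rw [hleq]
      calc -Real.log ε ≤ -Real.log w := by linarith
        _ ≤ _ := h1
        _ = _ := by ring
    have hXw : X ≤ K₁ * (1 / β') ^ α * w ^ (-μ₂) := by
      calc X ≤ K₁ * (l ^ α * w ^ (-μ')) := hX
        _ ≤ K₁ * ((1 / β' * w ^ (-β')) ^ α * w ^ (-μ')) := by gcongr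
        _ = K₁ * (1 / β') ^ α * (w ^ (-β' * α) * w ^ (-μ')) := by
          rw [Real.mul_rpow (by positivity) (by positivity), ← Real.rpow_mul hw.le]
          ring
        _ = _ := by
          rw [← Real.rpow_add hw, ← hβ'μ]
          congr 2
          ring
    have hcyc : ((d * m : ℕ) : ℝ) + 1 ≤ (1 / β + 1) * X ^ β := by
      have h1 : ((d * m : ℕ) : ℝ) * 1 ≤ (d * m : ℕ) * Real.log 3 := by gcongr
      rw [← Real.log_pow, ← hXdef] at h1
      have h2 := Real.log_le_rpow_div hX0.le hβ0
      have h3 : 1 ≤ X ^ β := Real.one_le_rpow hX1 hβ0.le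
      calc _ ≤ X ^ β / β + X ^ β := by linarith
        _ = _ := by ring
    have hedge : (3 : ℝ) ^ m + 1 ≤ 2 * X ^ (1 / (d : ℝ)) := by
      have h1 : X ^ (1 / (d : ℝ)) = 3 ^ m := by
        rw [hXdef, mul_comm, pow_mul, one_div]
        exact Real.pow_rpow_inv_natCast (by positivity) (by omega)
      have h2 : (1 : ℝ) ≤ 3 ^ m := one_le_pow₀ (by norm_num)
      rw [h1]
      linarith
    have hwγ : K₂ * w ^ γ ≤ θ := by
      have h1 : w ≤ (θ / K₂) ^ (1 / γ) := hwε.trans (hε.trans (min_le_right _ _))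
      have h2 : w ^ γ ≤ θ / K₂ := by
        calc w ^ γ ≤ ((θ / K₂) ^ (1 / γ)) ^ γ := by gcongr
          _ = θ / K₂ := by
            rw [← Real.rpow_mul (by positivity), one_div_mul_cancel hγ0.ne', Real.rpow_one]
      rw [le_div_iff₀ hK₂0] at h2
      linarith
    calc (((d * m : ℕ) : ℝ) + 1) * (3 ^ m + 1)
        ≤ (1 / β + 1) * X ^ β * (2 * X ^ (1 / (d : ℝ))) := by gcongr
      _ = (1 / β + 1) * 2 * X ^ (β + 1 / (d : ℝ)) := by
        rw [Real.rpow_add hX0]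
        ring
      _ ≤ (1 / β + 1) * 2 * (K₁ * (1 / β') ^ α * w ^ (-μ₂)) ^ (β + 1 / (d : ℝ)) := by gcongr
      _ = K₂ * (w ^ γ * w ^ (-(μ / d))) := by
        rw [Real.mul_rpow (by positivity) (by positivity), ← Real.rpow_mul hw.le, neg_mul, hβγ,
          Real.rpow_add hw, hK₂]
        ring
      _ ≤ _ := by
        rw [← mul_assoc]
        gcongr

end Growth

/-! ### The RESET circuit -/

section Reset

open scoped Matrix.Norms.Frobenius

/-- The purity parameter of a state is the length of its Bloch vector. -/
theorem IsDensity.isBloch_and_purityParam {σ : Matrix (Fin 2) (Fin 2) ℂ} (hσ : IsDensity σ) :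
    IsBloch (σ - (1 / 2 : ℂ) • 1) ∧ purityParam σ = √2 * ‖σ - (1 / 2 : ℂ) • 1‖ ∧
      purityParam σ ≤ 1 := by
  have hB : IsBloch (σ - (1 / 2 : ℂ) • 1) := isBloch_of_state hσ.1.1 hσ.2
  refine ⟨hB, ?_, ?_⟩
  · have h1 : ‖σ - (1 / 2 : ℂ) • 1‖ ^ 2 = (σ * σ).trace.re - 1 / 2 := by
      apply Complex.ofReal_injective
      have h2 : (σ - (1 / 2 : ℂ) • 1) * (σ - (1 / 2 : ℂ) • 1) = σ * σ - σ + (1 / 4 : ℂ) • 1 := by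
        simp only [Matrix.sub_mul, Matrix.mul_sub, Matrix.smul_mul, Matrix.mul_smul, Matrix.one_mul,
          Matrix.mul_one]
        module
      have h3 : (((σ * σ).trace.re : ℝ) : ℂ) = (σ * σ).trace := by
        rw [← Complex.conj_eq_iff_re, ← Complex.star_def, ← Matrix.trace_conjTranspose,
          Matrix.conjTranspose_mul, hσ.1.1.eq]
      rw [frobenius_norm_sq_eq_trace, hB.1.eq, h2, Matrix.trace_add, Matrix.trace_sub, hσ.2,
        Matrix.trace_smul, Matrix.trace_one, Complex.ofReal_sub, h3, Fintype.card_fin, smul_eq_mul]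
      push_cast
      ring
    rw [purityParam, show 2 * (σ * σ).trace.re - 1 = 2 * ‖σ - (1 / 2 : ℂ) • 1‖ ^ 2 by
      rw [h1]; ring, Real.sqrt_mul (by norm_num), Real.sqrt_sq (norm_nonneg _)]
  · have h1 : (σ * σ).trace = σ.trace ^ 2 - 2 * σ.det := by
      rw [Matrix.trace_fin_two, Matrix.trace_fin_two, Matrix.det_fin_two, Matrix.mul_apply,
        Matrix.mul_apply, Fin.sum_univ_two, Fin.sum_univ_two]
      ring
    have h2 : 0 ≤ σ.det.re := (Complex.le_def.mp hσ.1.det_nonneg).1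
    rw [purityParam, Real.sqrt_le_one, h1, hσ.2]
    simp
    linarith

theorem isNoise_of_isContracting {N : SuperOp} {σ : Matrix (Fin 2) (Fin 2) ℂ} {Δ : ℝ}
    (hN : IsCPTP N) (hΔ : IsContracting Δ N) (hΔ0 : 0 ≤ Δ) (hσ : IsDensity σ) (hfix : N σ = σ) :
    IsNoise N (σ - (1 / 2 : ℂ) • 1) where
  cptp := hN
  norm_le X hX := by
    have h1 := hΔ.norm_apply_le hN hX
    have h2 : 0 ≤ Δ * noiseStrength N * ‖X‖ :=
      mul_nonneg (mul_nonneg hΔ0 (noiseStrength_nonneg N)) (norm_nonneg X)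
    linarith
  bloch := hσ.isBloch_and_purityParam.1
  fixed := by rw [add_sub_cancel, hfix]

theorem one_sub_pow_le {x y : ℝ} {n : ℕ} (hx : 0 ≤ x) (hx1 : x ≤ 1) (hy : 0 ≤ y) (hy1 : y ≤ 1)
    (hn : y ≤ n * x) : (1 - x) ^ n ≤ 1 - y / 2 := by
  have h1 : 1 + n * x ≤ (1 + x) ^ n := one_add_mul_le_pow (by linarith) n
  have h2 : (1 - x) ^ n * (1 + x) ^ n ≤ 1 := by
    rw [← mul_pow]
    exact pow_le_one₀ (mul_nonneg (by linarith) (by linarith)) (by nlinarith)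
  have h3 : 0 ≤ (1 - x) ^ n := pow_nonneg (by linarith) n
  have h4 : (1 - x) ^ n * (1 + y) ≤ 1 :=
    (mul_le_mul_of_nonneg_left (by linarith) h3).trans h2
  by_contra! h5
  have h6 : (1 - y / 2) * (1 + y) < (1 - x) ^ n * (1 + y) :=
    mul_lt_mul_of_pos_right h5 (by linarith)
  nlinarith

/-- The relations between the parameters. -/
theorem parameter_relations {d μ κ η ε : ℝ} (hd : 0 < d) (hμ : 0 < μ) (hκ : 0 < κ) (hη : 0 < η)
    (hε : ε = (κ * η ^ (-(μ / d))) ^ (d / (μ + d))) :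
    0 < ε ∧ κ = ε * (ε * η) ^ (μ / d) ∧ (κ * η) ^ (μ * d / (μ + d)) = (ε * η) ^ μ ∧
      |Real.log ε| ≤ |Real.log (κ * η ^ (-(μ / d)))| ∧
      ∀ e, 0 < e → κ ≤ e ^ (1 + μ / d) * η ^ (μ / d) → ε ≤ e := by
  have hp : (1 + μ / d) * (d / (μ + d)) = 1 := by
    field_simp
    ring
  have ht : 0 < κ * η ^ (-(μ / d)) := by positivity
  have hε0 : 0 < ε := hε ▸ Real.rpow_pos_of_pos ht _
  have hεt : κ * η ^ (-(μ / d)) = ε ^ (1 + μ / d) := by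
    rw [hε, ← Real.rpow_mul ht.le, mul_comm (d / (μ + d)), hp, Real.rpow_one]
  have hκε : κ = ε ^ (1 + μ / d) * η ^ (μ / d) := by
    rw [← hεt, mul_assoc, ← Real.rpow_add hη, neg_add_cancel, Real.rpow_zero, mul_one]
  refine ⟨hε0, ?_, ?_, ?_, fun e he hle => ?_⟩
  · rw [Real.mul_rpow hε0.le hη.le, ← mul_assoc, ← Real.rpow_one_add' hε0.le (by positivity)]
    exact hκε
  · have h1 : κ * η = (ε * η) ^ (1 + μ / d) := by
      rw [Real.mul_rpow hε0.le hη.le, hκε, mul_assoc, ← Real.rpow_add_one' hη.le (by positivity),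
        add_comm (μ / d)]
    rw [h1, ← Real.rpow_mul (by positivity)]
    congr 1
    field_simp
    ring
  · rw [hεt, Real.log_rpow hε0, abs_mul]
    refine le_mul_of_one_le_left (abs_nonneg _) (le_abs_self _ |>.trans' ?_)
    have : 0 < μ / d := by positivity
    linarith
  · rw [hκε] at hle
    have h1 : ε ^ (1 + μ / d) ≤ e ^ (1 + μ / d) := le_of_mul_le_mul_right hle (by positivity)
    exact (Real.rpow_le_rpow_iff hε0.le he.le (by positivity)).mp h1

end Reset

section Main

open scoped Matrix.Norms.Frobenius

/-- Settling for about `x` steps, where `κ x = ε`, gives a polarization of the order of `ε η`. -/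
theorem IsNoise.exists_settle_ge {N : SuperOp} {S : Matrix (Fin 2) (Fin 2) ℂ} (h : IsNoise N S)
    {Δ κ η ε x : ℝ} (hcontr : IsContracting Δ N) (hΔ : 0 ≤ Δ) (hκ : κ = noiseStrength N)
    (hη : η = √2 * ‖S‖) (hη1 : η ≤ 1) (hε0 : 0 ≤ ε) (hε8 : ε ≤ 1 / 8) (hΔε : Δ * ε ≤ 1)
    (hκ0 : 0 ≤ κ) (hκε : κ ≤ ε) (hx : 1 ≤ x) (hκx : κ * x = ε) :
    ∃ n : ℕ, κ * (n + 1) ≤ ε + κ ∧ ∃ V ∈ Matrix.unitaryGroup (Fin 2) ℂ, ∃ u : ℝ,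
      V * N^[n + 1] ((1 / 2 : ℂ) • 1) * V.conjTranspose = zState u ∧
      Δ / 2 * (ε * η) ≤ u ∧ u ≤ 11 / 10 := by
  obtain ⟨n, hn⟩ : ∃ n, ⌈x⌉₊ = n + 1 :=
    ⟨⌈x⌉₊ - 1, by have := Nat.ceil_pos.mpr (zero_lt_one.trans_le hx); omega⟩
  have hn1 : x ≤ (n + 1 : ℕ) := hn ▸ Nat.le_ceil _
  have hn2 : ((n + 1 : ℕ) : ℝ) ≤ x + 1 := hn ▸ (Nat.ceil_lt_add_one (by linarith)).le
  have hκn1 : ε ≤ κ * (n + 1 : ℕ) := hκx ▸ mul_le_mul_of_nonneg_left hn1 hκ0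
  have hκn2 : κ * (n + 1 : ℕ) ≤ ε + κ := by
    have := mul_le_mul_of_nonneg_left hn2 hκ0
    rwa [mul_add, hκx, mul_one] at this
  have hη0 : 0 ≤ η := by rw [hη]; positivity
  obtain ⟨V, hV, u, hVu, hu1, hu2, -⟩ := h.exists_settle hcontr (n + 1)
  rw [← hκ, ← hη] at hu1 hu2
  refine ⟨n, by exact_mod_cast hκn2, V, hV, u, hVu, hu1.trans' ?_, hu2.trans ?_⟩
  · have h1 : (1 - Δ * κ) ^ (n + 1) ≤ 1 - Δ * ε / 2 := by
      refine one_sub_pow_le (by positivity) ((mul_le_mul_of_nonneg_left hκε hΔ).trans hΔε)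
        (by positivity) hΔε ?_
      have := mul_le_mul_of_nonneg_left hκn1 hΔ
      linarith
    calc Δ / 2 * (ε * η) = η * (Δ * ε / 2) := by ring
      _ ≤ _ := mul_le_mul_of_nonneg_left (by linarith) hη0
  · have h1 := mul_le_mul_of_nonneg_right hη1 (show 0 ≤ 2 * ((n + 1 : ℕ) * κ) by positivity)
    linarith

set_option maxHeartbeats 400000 in
/-- The RESET works when the parameters satisfy suitable inequalities: `lam` is the growth factor of
small polarizations, `x` the duration of the settling stage, and `K * θ * ε` bounds the error of the
cycles. The deliberate tilt of the output by `ε` dominates all other errors. -/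
theorem exists_reset {d m : ℕ} (r₀ : Fin d) (hm : 1 ≤ m) {N : SuperOp}
    {S : Matrix (Fin 2) (Fin 2) ℂ} (h : IsNoise N S) {Vs : List (RegOp (Fin 3))}
    (hVs : ∀ V ∈ Vs, IsLineGate V) (hU : Vs.foldl (fun W V => V * W) 1 = trioOp) {K : ℝ}
    (hK : 0 < K)
    (hcycle : ∀ (u : ℝ) (n : ℕ), 0 ≤ u → ∃ V ∈ Matrix.unitaryGroup (Fin 2) ℂ, ∃ u' : ℝ, 0 ≤ u' ∧
      V * N^[n] (headState (blockRun N Vs (tensorOp fun _ => N (zState u)))) * V.conjTranspose =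
        zState u' ∧
      (u ≤ 6 / 5 → |u' - boost u| ≤ K * (noiseStrength N * (n + 1) * (u + ‖S‖))))
    {Δ κ η ε x γ lam θ : ℝ} (hcontr : IsContracting Δ N) (hΔ : 0 < Δ) (hκ : κ = noiseStrength N)
    (hκ0 : 0 < κ) (hη : η = √2 * ‖S‖) (hη0 : 0 < η) (hη1 : η ≤ 1) (hε0 : 0 < ε) (hε8 : ε ≤ 1 / 8)
    (hΔε : Δ * ε ≤ 1) (hκε : κ ≤ ε * (1 / 10000)) (hx : 1 ≤ x) (hκx : κ * x = ε) (hγ0 : 0 < γ)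
    (hγ1 : γ ≤ 1 / 100) (hlam1 : 1 < lam) (hγlam : 4 * γ ≤ 3 / 2 - lam)
    (hθ1 : K * θ ≤ γ * (Δ / 2)) (hθ2 : K * θ ≤ γ) (hθ3 : K * θ ≤ 1 / 40) {k₁ k₂ k₃ : ℕ}
    (hk : k₁ + k₂ + k₃ = d * m) (hk₁ : √(3 / 2 - lam) / (Δ / 2) ≤ lam ^ k₁ * (ε * η))
    (hk₂ : 9 / 10 ≤ (21 / 20) ^ k₂ * √(3 / 2 - lam)) (hk₃ : (1 / 2 : ℝ) ^ 2 ^ k₃ ≤ ε ^ 2)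
    (hedge : ((d * m : ℕ) + 1) * (3 ^ m + 1) ≤ θ * x) :
    ∃ (C : ResetCircuit (latticeAdj (resetSites r₀ m)) (target r₀ m)) (z : ℝ),
      (∀ ρ, IsDensity ρ → polarization (target r₀ m) (C.run N ρ) = z) ∧
      1 / 2 * ε ≤ 1 - z ∧ 1 - z ≤ 2 * ε ∧ κ * C.depth ≤ (5 + (Vs.length + 1) * θ) * ε := by
  have hSη : ‖S‖ ≤ η := by
    rw [hη]
    exact le_mul_of_one_le_left (norm_nonneg _) sqrt_two_bounds.1
  have hS0 : 0 ≤ ‖S‖ := norm_nonneg S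
  obtain ⟨n, hκn, V, hV, u, hVu, hub, hu11⟩ := h.exists_settle_ge hcontr hΔ.le hκ hη hη1 hε0.le hε8
    hΔε hκ0.le (by linarith) hx hκx
  -- `κ` times the duration of the compression, up to a constant factor
  have hcost : κ * (((d * m : ℕ) + 1) * (3 ^ m + 1)) ≤ θ * ε := by
    have h1 := mul_le_mul_of_nonneg_left hedge hκ0.le
    rwa [mul_left_comm κ θ, hκx] at h1
  have hθ0 : 0 ≤ θ := by
    refine nonneg_of_mul_nonneg_left ((?_ : (0 : ℝ) ≤ _).trans hcost) hε0
    positivity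
  have hu0 : 0 ≤ u := hub.trans' (by positivity)
  obtain ⟨s, hs⟩ : ∃ s, s = K * (κ * (3 ^ m + 1)) := ⟨_, rfl⟩
  have hs0 : 0 ≤ s := by rw [hs]; positivity
  -- the error of a cycle that starts with the polarization `u` is at most `s * (u + ‖S‖)`
  have hsε : s ≤ K * θ * ε := by
    rw [hs, mul_assoc K θ]
    refine mul_le_mul_of_nonneg_left (le_trans ?_ hcost) hK.le
    refine mul_le_mul_of_nonneg_left ?_ hκ0.le
    refine le_mul_of_one_le_left (by positivity) ?_
    linarith [Nat.cast_nonneg (α := ℝ) (d * m)]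
  have hcyc : ∀ u, 0 ≤ u → ∀ n ≤ 3 ^ m, ∃ u', 0 ≤ u' ∧
      (u ≤ 6 / 5 → |u' - boost u| ≤ s * (u + ‖S‖)) ∧ IsCycle N Vs u n u' := by
    intro u hu n hn
    obtain ⟨V, hV, u', hu', hVu, herr⟩ := hcycle u n hu
    refine ⟨u', hu', fun h6 => (herr h6).trans ?_, V, hV, hVu⟩
    have hn' : (n : ℝ) ≤ 3 ^ m := by exact_mod_cast hn
    rw [hs, ← hκ, mul_assoc K]
    gcongr
  obtain ⟨v, hv0, hvn, hvR, hcirc⟩ := exists_resetCircuit h.cptp.2 hVs hU hm r₀ hcyc hV hu0 hVu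
  have hs40 : s ≤ 1 / 40 * ε := hsε.trans (mul_le_mul_of_nonneg_right hθ3 hε0.le)
  have hsS : s * (11 / 10 + ‖S‖) ≤ ε / 10 := by
    have h1 := mul_le_mul hs40 (show 11 / 10 + ‖S‖ ≤ 11 / 10 + 1 by linarith) (by positivity)
      (by positivity)
    linarith
  have hfinal : |1 - v (d * m)| ≤ 2 * (ε / 10) := by
    rw [← hk]
    have hΔεη : Δ * (ε * η) ≤ 1 :=
      (mul_le_mul_of_nonneg_left (mul_le_of_le_one_right hε0.le hη1) hΔ.le).trans hΔε
    refine abs_one_sub_le_of_boost (b := Δ / 2 * (ε * η)) (η := ‖S‖) (s := s) (by positivity)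
      (by linarith) hγ1 hγ0.le hlam1.le hγlam hs0 ?_ ?_ (hv0 ▸ hub) (hv0 ▸ hu11)
      (fun i hi => hvR i (hk ▸ hi)) ?_ hk₂ hsS (by linarith) ?_
    · exact hsε.trans ((mul_le_mul hθ2 (show ε ≤ 1 by linarith) hε0.le hγ0.le).trans_eq
        (mul_one γ))
    · have h1 := mul_le_mul_of_nonneg_right hθ1 (show 0 ≤ ε * η by positivity)
      have h2 := mul_le_mul hsε hSη hS0 (by positivity)
      linarith
    · rw [div_le_iff₀ (by positivity)] at hk₁
      linarith
    · refine hk₃.trans ?_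
      nlinarith
  -- a tilt by `cos θ = 1 - ε` lowers the polarization by about `ε`
  obtain ⟨W, hW, hz⟩ := h.exists_tilt (by rw [← hκ]; linarith) (hvn (d * m))
    (show 0 ≤ ε / 2 by positivity) (show ε / 2 ≤ 1 by linarith)
  obtain ⟨C, hdepth, hpol⟩ := hcirc W hW
  rw [← hκ] at hz
  have hvb := abs_le.mp hfinal
  have hzb : 60 * (κ * (v (d * m) + ‖S‖)) ≤ ε / 10 := by
    have h1 := mul_le_mul hκε (show v (d * m) + ‖S‖ ≤ 2 + 1 by linarith)
      (add_nonneg (hvn _) hS0) (by positivity)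
    linarith
  have hzb2 := abs_le.mp (hz.trans hzb)
  have hvεb : |(v (d * m) - 1) * ε| ≤ ε / 10 := by
    rw [abs_mul, abs_sub_comm, abs_of_pos hε0]
    have h1 := mul_le_mul_of_nonneg_right hfinal hε0.le
    nlinarith
  replace hvεb := abs_le.mp hvεb
  refine ⟨C, _, hpol, by linarith, by linarith, ?_⟩
  have h1 : (C.depth : ℝ) ≤ n + 4 + (d * m : ℕ) * (Vs.length + 3 ^ m + 1) := by
    exact_mod_cast hdepth
  have h2 : (1 : ℝ) ≤ 3 ^ m := one_le_pow₀ (by norm_num)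
  have h3 : (Vs.length : ℝ) + 3 ^ m + 1 ≤ (Vs.length + 1) * (3 ^ m + 1) := by
    have : (0 : ℝ) ≤ Vs.length * 3 ^ m := by positivity
    linarith
  have h4 : ((d * m : ℕ) : ℝ) * (Vs.length + 3 ^ m + 1) ≤
      ((d * m : ℕ) + 1) * ((Vs.length + 1) * (3 ^ m + 1)) :=
    mul_le_mul (by linarith) h3 (by positivity) (by positivity)
  have h5 := mul_le_mul_of_nonneg_left (h1.trans (add_le_add_right h4 _)) hκ0.le
  have h6 := mul_le_mul_of_nonneg_left hcost (show (0 : ℝ) ≤ Vs.length + 1 by positivity)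
  linarith

/-- A growth factor of small polarizations, below the factor `3 / 2` of the ideal compressor. -/
theorem exists_growth_factor {δ : ℝ} (hδ : 0 < δ) :
    ∃ lam : ℝ, 1 < lam ∧ lam < 3 / 2 ∧
      Real.log 3 / Real.log lam < Real.log 3 / Real.log (3 / 2) + δ := by
  have hl3 : 0 < Real.log 3 := Real.log_pos (by norm_num)
  have hl32 : 0 < Real.log (3 / 2) := Real.log_pos (by norm_num)
  obtain ⟨μ', hμ'⟩ : ∃ μ', μ' = Real.log 3 / Real.log (3 / 2) + δ / 2 := ⟨_, rfl⟩
  have hμ'0 : 0 < μ' := by rw [hμ']; positivity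
  refine ⟨Real.exp (Real.log 3 / μ'), Real.one_lt_exp_iff.mpr (by positivity), ?_, ?_⟩
  · rw [← Real.lt_log_iff_exp_lt (by norm_num), div_lt_iff₀ hμ'0, hμ', mul_add,
      mul_div_cancel₀ _ hl32.ne']
    have : 0 < Real.log (3 / 2) * (δ / 2) := by positivity
    linarith
  · rw [Real.log_exp, div_div_cancel₀ hl3.ne', hμ']
    linarith

theorem mainTheorem4 (d : ℕ) (hd : 1 ≤ d) (δ Δ : ℝ) (hδ : 0 < δ) (hΔ : 0 < Δ)
    (μ : ℝ) (hμ : μ = Real.log 3 / Real.log (3 / 2) + δ) :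
    ∃ c : ℝ, 0 < c ∧ ∃ a A B D E : ℝ, 0 < a ∧ 0 < A ∧ 0 < B ∧ 0 < D ∧ 0 < E ∧ ∃ p : ℕ,
      ∀ (N : SuperOp) (σ : Matrix (Fin 2) (Fin 2) ℂ) (κ η ε : ℝ),
        IsCPTP N → IsContracting Δ N → IsDensity σ → N σ = σ →
        κ = noiseStrength N → η = purityParam σ → 0 < κ → 0 < η →
        κ ≤ c * η ^ (μ / d) →
        ε = (κ * η ^ (-(μ / d))) ^ ((d : ℝ) / (μ + d)) →
        ∃ (Λ : Finset (Fin d → ℤ)) (τ : Λ) (C : ResetCircuit (latticeAdj Λ) τ) (Na : ℕ) (zout : ℝ),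
          Λ.card = Na + 1 ∧
          FitsInCube Λ (E * (Na : ℝ) ^ ((1 : ℝ) / d)) ∧
          (∀ ρ : RegOp Λ, IsDensity ρ → polarization τ (C.run N ρ) = zout) ∧
          a * ε ≤ 1 - zout ∧ 1 - zout ≤ A * ε ∧
          (Na : ℝ) ≤ B * (|Real.log (κ * η ^ (-(μ / d)))| ^ Real.logb 2 3 /
            (κ * η) ^ (μ * d / (μ + d))) ∧
          κ * (C.depth : ℝ) ≤ D * (ε * (1 + |Real.log ε|) ^ p) := by
  obtain ⟨Vs, hVs, hU⟩ := exists_compressor_gates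
  obtain ⟨K, hK, hcycle⟩ := exists_cycle (fun V hV => (hVs V hV).mem_unitaryGroup) hU
  have hd0 : (0 : ℝ) < d := by exact_mod_cast hd
  obtain ⟨lam, hlam1, hlam2, hlamμ⟩ := exists_growth_factor hδ
  rw [← hμ] at hlamμ
  have hμ0 : 0 < μ :=
    hlamμ.trans' (div_pos (Real.log_pos (by norm_num)) (Real.log_pos hlam1))
  obtain ⟨γ, hγ0, hγ1, hγlam⟩ : ∃ γ : ℝ, 0 < γ ∧ γ ≤ 1 / 100 ∧ 4 * γ ≤ 3 / 2 - lam := by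
    refine ⟨min ((3 / 2 - lam) / 4) (1 / 100), lt_min (by linarith) (by norm_num),
      min_le_right _ _, ?_⟩
    linarith [min_le_left ((3 / 2 - lam) / 4) (1 / 100)]
  have hU0 : 0 < √(3 / 2 - lam) := Real.sqrt_pos.mpr (by linarith)
  obtain ⟨k₂, hk₂⟩ := pow_unbounded_of_one_lt (9 / 10 / √(3 / 2 - lam))
    (show (1 : ℝ) < 21 / 20 by norm_num)
  rw [div_lt_iff₀ hU0] at hk₂
  obtain ⟨θ, hθ0, hθ1, hθ2, hθ3⟩ : ∃ θ : ℝ, 0 < θ ∧ K * θ ≤ γ * (Δ / 2) ∧ K * θ ≤ γ ∧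
      K * θ ≤ 1 / 40 := by
    refine ⟨min (γ * (Δ / 2)) (min γ (1 / 40)) / K, by positivity, ?_⟩
    rw [mul_div_cancel₀ _ hK.ne']
    exact ⟨min_le_left _ _, (min_le_right _ _).trans (min_le_left _ _),
      (min_le_right _ _).trans (min_le_right _ _)⟩
  obtain ⟨ε₁, hε₁, B, hB, hedge⟩ := exists_edge hd hlam1 hlamμ (√(3 / 2 - lam) / (Δ / 2)) k₂ hθ0
  have hν : 0 < μ / d := by positivity
  obtain ⟨ε₀, hε₀0, hε₀1, hε₀8, hε₀Δ, hε₀ν⟩ : ∃ ε₀ : ℝ, 0 < ε₀ ∧ ε₀ ≤ ε₁ ∧ ε₀ ≤ 1 / 8 ∧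
      ε₀ ≤ 1 / Δ ∧ ε₀ ≤ (1 / 10000) ^ (1 / (μ / d)) :=
    ⟨min (min ε₁ (1 / 8)) (min (1 / Δ) ((1 / 10000) ^ (1 / (μ / d)))), by positivity,
      (min_le_left _ _).trans (min_le_left _ _), (min_le_left _ _).trans (min_le_right _ _),
      (min_le_right _ _).trans (min_le_left _ _), (min_le_right _ _).trans (min_le_right _ _)⟩
  refine ⟨ε₀ ^ (1 + μ / d), by positivity, 1 / 2, 2, B, 5 + (Vs.length + 1) * θ, 2, by norm_num,
    by norm_num, hB, by positivity, by norm_num, 0, ?_⟩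
  intro N σ κ η ε hN hcontr hσ hfix hκ hη hκ0 hη0 hκη hε
  obtain ⟨hε0, hκw, hdenom, hlog, hle⟩ := parameter_relations hd0 hμ0 hκ0 hη0 hε
  have hεε₀ := hle ε₀ hε₀0 hκη
  have hε8 : ε ≤ 1 / 8 := hεε₀.trans hε₀8
  have hΔε : Δ * ε ≤ 1 := by
    have := hεε₀.trans hε₀Δ
    rw [le_div_iff₀ hΔ] at this
    linarith
  obtain ⟨-, hηS, hη1⟩ := hσ.isBloch_and_purityParam
  rw [← hη] at hηS hη1
  have hS1 : ‖σ - (1 / 2 : ℂ) • 1‖ ≤ 1 := by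
    refine le_trans ?_ hη1
    rw [hηS]
    exact le_mul_of_one_le_left (norm_nonneg _) sqrt_two_bounds.1
  have hnoise := isNoise_of_isContracting hN hcontr hΔ.le hσ hfix
  have hw0 : 0 < ε * η := by positivity
  have hwε : ε * η ≤ ε := mul_le_of_le_one_right hε0.le hη1
  have hwν : (ε * η) ^ (μ / d) ≤ 1 / 10000 := by
    calc (ε * η) ^ (μ / d) ≤ ((1 / 10000 : ℝ) ^ (1 / (μ / d))) ^ (μ / d) :=
          Real.rpow_le_rpow hw0.le (hwε.trans (hεε₀.trans hε₀ν)) hν.le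
      _ = 1 / 10000 := by
        rw [← Real.rpow_mul (by norm_num), one_div_mul_cancel hν.ne', Real.rpow_one]
  have hκε : κ ≤ ε * (1 / 10000) := hκw.trans_le (mul_le_mul_of_nonneg_left hwν hε0.le)
  have hκx : κ * (ε * η) ^ (-(μ / d)) = ε := by
    rw [hκw, mul_assoc, ← Real.rpow_add hw0, add_neg_cancel, Real.rpow_zero, mul_one]
  have hx : 1 ≤ (ε * η) ^ (-(μ / d)) :=
    Real.one_le_rpow_of_pos_of_le_one_of_nonpos hw0 (by linarith) (by linarith)
  obtain ⟨m, k₁, k₃, hm, hk, hk₁, hk₃, hNa, hedge⟩ := hedge ε (ε * η) hw0 hwε (hεε₀.trans hε₀1)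
  obtain ⟨C, z, hz, hz1, hz2, hdepth⟩ := exists_reset (⟨0, hd⟩ : Fin d) hm hnoise hVs hU hK
    (hcycle N _ hnoise hS1 (by rw [← hκ]; linarith)) hcontr hΔ hκ hκ0 hηS hη0 hη1 hε0 hε8 hΔε hκε hx
    hκx hγ0 hγ1 hlam1 hγlam hθ1 hθ2 hθ3 hk hk₁ hk₂.le hk₃ hedge
  refine ⟨resetSites _ m, target _ m, C, 3 ^ (d * m), z, card_resetSites _ m, ?_, hz, hz1, hz2, ?_,
    ?_⟩
  · have h1 : (((3 ^ (d * m) : ℕ) : ℝ)) ^ (1 / (d : ℝ)) = 3 ^ m := by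
      rw [mul_comm d, pow_mul]
      push_cast
      rw [one_div]
      exact Real.pow_rpow_inv_natCast (by positivity) (by omega)
    rw [h1]
    exact fitsInCube_resetSites _ m
  · push_cast
    rw [hdenom]
    refine hNa.trans ?_
    have hα : 0 ≤ Real.logb 2 3 := (Real.logb_pos (by norm_num) (by norm_num)).le
    gcongr
  · rwa [pow_zero, mul_one]

end Main
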